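/- Let $N\ge 1$, let $\lambda$ be a partition of $N$, and work over the field $\mathbb C(q,s)$ of rational functions in two indeterminates. All operators act on the right. Diagrams are drawn with rows numbered from the bottom (the longest row is row $1$), and the content of a cell is (column) $-$ (row). *The module $V_\lambda$.* Let $\mathrm{Tab}_\lambda$ be the set of reverse standard tableaux of shape $\lambda$ (entries $1,\dots,N$, strictly decreasing along rows and up columns), and write $\mathrm{ROW}_{\mathbb T}[i],\mathrm{COL}_{\mathbb T}[i],\mathrm{CT}_{\mathbb T}[i]$ for the row, column and content of the entry $i$ of $\mathbb T$. $V_\lambda$ is the vector space with basis $\mathrm{Tab}_\lambda$, and $T_1,\dots,T_{N-1}$ act on it as follows, where $m=\mathrm{CT}_{\mathbb T}[i+1]-\mathrm{CT}_{\mathbb T}[i]$ and $\mathbb T^{(i,j)}$ is $\mathbb T$ with $i$ and $j$ exchanged: $\mathbb TT_i=s\mathbb T$ if $i,i+1$ lie in the same row; $\mathbb TT_i=-\mathbb T$ if they lie in the same column; $\mathbb TT_i=\mathbb T^{(i,i+1)}-\frac{1-s}{1-s^m}\mathbb T$ if $\mathrm{ROW}_{\mathbb T}[i]<\mathrm{ROW}_{\mathbb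 T}[i+1]$ and $\mathrm{COL}_{\mathbb T}[i]\ne\mathrm{COL}_{\mathbb T}[i+1]$; and $\mathbb TT_i=\frac{s-1}{1-s^m}\mathbb T+\frac{s(1-s^{m+1})(1-s^{m-1})}{(1-s^m)^2}\mathbb T^{(i,i+1)}$ if $\mathrm{ROW}_{\mathbb T}[i]>\mathrm{ROW}_{\mathbb T}[i+1]$ and $\mathrm{COL}_{\mathbb T}[i]\ne\mathrm{COL}_{\mathbb T}[i+1]$. *Vector valued polynomials.* On $\mathcal M_\lambda=\mathbb C(q,s)[x_1,\dots,x_N]\otimes V_\lambda$ put $(f\otimes u)\mathbf T_i=(1-s)x_{i+1}\frac{f-fs_i}{x_i-x_{i+1}}\otimes u+fs_i\otimes uT_i$, where $fs_i$ is $f$ with $x_i,x_{i+1}$ exchanged; further $\mathbf T_i^{-1}=\frac1s(\mathbf T_i+1-s)$ and $\mathbf\Phi=\mathbf T_1^{-1}\cdots\mathbf T_{N-1}^{-1}x_N$. For $\sigma\in\mathfrak S_N$ with a shortest expression $\sigma=s_{i_1}\cdots s_{i_k}$ (so $k=\ell(\sigma)$) put $\widetilde{\mathbf T}_\sigma=\mathbf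 T_{i_1}\cdots\mathbf T_{i_k}$ and $\overline{\mathbf T}_\sigma=\mathbf T_{i_1}^{-1}\cdots\mathbf T_{i_k}^{-1}$, and let $$\mathbf S_N=\sum_{\sigma\in\mathfrak S_N}\widetilde{\mathbf T}_\sigma,\qquad \mathbf A_N=\sum_{\sigma\in\mathfrak S_N}(-s)^{\ell(\sigma)}\,\overline{\mathbf T}_\sigma .$$ *The Yang–Baxter graph.* Its vertices are the pairs $(\mathbb T,v)\in\mathrm{Tab}_\lambda\times\mathbb N^N$. With $r_v[i]=\#\{j\le i:v[j]\ge v[i]\}+\#\{j>i:v[j]>v[i]\}$, the spectral vector of $(\mathbb T,v)$ is $\zeta[i]=q^{v[i]}s^{\mathrm{CT}_{\mathbb T}[r_v[i]]}$; it determines the vertex. There is an arrow $s_i$ from $(\mathbb T,v)$ to $(\mathbb T,vs_i)$ if $v[i]<v[i+1]$, and an arrow $s_i$ from $(\mathbb T,v)$ to $(\mathbb T^{(k,k+1)},v)$ if $v[i]=v[i+1]$ and $\mathrm{CT}_{\mathbb T}[k]\ge\mathrm{CT}_{\mathbb T}[k+1]+2$, where $k=r_v[i]$; in both cases the spectral vector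 of the target is $\zeta s_i$, that is, $\zeta$ with $\zeta[i],\zeta[i+1]$ exchanged. There is an affine arrow from $(\mathbb T,v)$ to $(\mathbb T,[v[2],\dots,v[N],v[1]+1])$. The nonsymmetric Macdonald polynomials $P_\zeta\in\mathcal M_\lambda$ are obtained along paths: $P=1\otimes\mathbb T_\lambda$ at $(\mathbb T_\lambda,0^N)$, where $\mathbb T_\lambda$ is filled with $N,N-1,\dots,1$ column by column from left to right, each column from bottom to top; $P_{\zeta s_i}=P_\zeta\bigl(\mathbf T_i+\frac{1-s}{1-\zeta[i+1]/\zeta[i]}\bigr)$ along an arrow $s_i$; and $P$ is replaced by $P\mathbf\Phi$ along an affine arrow. (The result does not depend on the path.) *Components.* Let $T$ be a filling of the diagram of $\lambda$ by nonnegative integers. $H_T$ is the connected component, in the graph without the affine arrows, of the vertices $(\mathbb T,v)$ for which replacing each entry $k$ of $\mathbb T$ by the $k$-th entry of the decreasing rearrangement of $v$ gives $T$; $\zeta\in T$ means that $\zeta$ is the spectral vector of a vertex of $H_T$. A root (sink) of $H_T$ is a vertex of $H_T$ without incoming (outgoing) non-affine arrow. When $H_T$ has a unique root $\mathrm{root}(T)$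 and a unique sink $\mathrm{sink}(T)$, set $b_{\zeta_{\mathrm{root}(T)}}=b^a_{\zeta_{\mathrm{root}(T)}}=1$ and, along the arrows $s_i$ of $H_T$, $$b_{\zeta s_i}=\frac{\zeta[i]-\zeta[i+1]}{s\zeta[i]-\zeta[i+1]}\,b_\zeta,\qquad b^a_{\zeta s_i}=-\frac{\zeta[i]-\zeta[i+1]}{\zeta[i]-s\zeta[i+1]}\,b^a_\zeta,$$ $$\mathfrak M_T=\sum_{\zeta\in T}b_\zeta P_\zeta,\qquad \mathfrak M^a_T=\sum_{\zeta\in T}b^a_\zeta P_\zeta,$$ and let $\ell(\sigma_T)$ be the length of a shortest directed path from $\mathrm{root}(T)$ to $\mathrm{sink}(T)$ in $H_T$, that is, the length of the shortest permutation $\sigma_T$ with $\zeta_{\mathrm{root}(T)}\sigma_T=\zeta_{\mathrm{sink}(T)}$. *The group $\mathfrak S_T$.* Let $\mathrm{std}_1T$ be the tableau whose entry in a cell $c$ is the number of cells $d$ with $T(d)>T(c)$, plus the number of cells $d$ with $T(d)=T(c)$ in a higher row than $c$, plus the number of cells $d$ with $T(d)=T(c)$ in the row of $c$ and weakly to the right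 of $c$. $\mathfrak S_T$ is the group of the permutations of $\{1,\dots,N\}$ that, acting on the entries of $\mathrm{std}_1T$, preserve the set of entries of each row and leave $T$ invariant, and $\phi_T(s)=\sum_{\sigma\in\mathfrak S_T}s^{\ell(\sigma)}$ is its Poincaré polynomial. $\overline T$ denotes the conjugate of $T$ (rows and columns exchanged). **Theorem.** (1) If $T$ is column-strict (weakly increasing along rows, strictly increasing up columns), then $H_T$ has a unique root and a unique sink, and $$\mathfrak M_T=\frac{b_{\zeta_{\mathrm{sink}(T)}}}{\phi_T(s)}\,P_{\zeta_{\mathrm{root}(T)}}\mathbf S_N .$$ (2) If $T$ is row-strict (strictly increasing along rows, weakly increasing up columns), then $H_T$ has a unique root and a unique sink, and $$\mathfrak M^a_T=(-1)^{\ell(\sigma_T)}\,\frac{b^a_{\zeta_{\mathrm{sink}(T)}}}{\phi_{\overline T}(s)}\,P_{\zeta_{\mathrm{root}(T)}}\mathbf A_N .$$ -/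

import Mathlib

open scoped TensorProduct

noncomputable section

namespace VVMac

/-! ### Words in the adjacent transpositions of `S_N`, where `N = n + 1` -/

/-- The adjacent transposition `s_i`, exchanging the `i`-th and the `(i+1)`-st position. -/
def adj {n : ℕ} (i : Fin n) : Equiv.Perm (Fin (n + 1)) :=
  Equiv.swap i.castSucc i.succ

/-- The permutation expressed by a word in the adjacent transpositions. -/
def wordPerm {n : ℕ} (l : List (Fin n)) : Equiv.Perm (Fin (n + 1)) :=
  (l.map adj).prod

/-- The length of a permutation: its number of inversions. -/
def ell {n : ℕ} (σ : Equiv.Perm (Fin (n + 1))) : ℕ :=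
  (Finset.univ.filter
    (fun p : Fin (n + 1) × Fin (n + 1) => p.1 < p.2 ∧ σ p.2 < σ p.1)).card

/-- `l` is a shortest expression of `σ`. -/
def IsReducedWord {n : ℕ} (σ : Equiv.Perm (Fin (n + 1))) (l : List (Fin n)) : Prop :=
  wordPerm l = σ ∧ ∀ l' : List (Fin n), wordPerm l' = σ → l.length ≤ l'.length

theorem exists_word {n : ℕ} (σ : Equiv.Perm (Fin (n + 1))) :
    ∃ l : List (Fin n), wordPerm l = σ := by
  have h : σ ∈ Submonoid.closure
      (Set.range fun i : Fin n => Equiv.swap i.castSucc i.succ) := by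
    rw [Equiv.Perm.mclosure_swap_castSucc_succ]
    trivial
  induction h using Submonoid.closure_induction with
  | mem x hx =>
    obtain ⟨i, rfl⟩ := hx
    exact ⟨[i], by simp [wordPerm, adj]⟩
  | one => exact ⟨[], by simp [wordPerm]⟩
  | mul x y _ _ hx hy =>
    obtain ⟨l, rfl⟩ := hx
    obtain ⟨l', rfl⟩ := hy
    exact ⟨l ++ l', by simp [wordPerm]⟩

theorem exists_reducedWord {n : ℕ} (σ : Equiv.Perm (Fin (n + 1))) :
    ∃ l : List (Fin n), IsReducedWord σ l := by
  classical
  have h : ∃ m, ∃ l : List (Fin n), wordPerm l = σ ∧ l.length = m := by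
    obtain ⟨l, hl⟩ := exists_word σ
    exact ⟨l.length, l, hl, rfl⟩
  obtain ⟨l, hl, hm⟩ := Nat.find_spec h
  exact ⟨l, hl, fun l' hl' => hm ▸ Nat.find_min' h ⟨l', hl', rfl⟩⟩

/-- A shortest expression of `σ`. -/
def reducedWord {n : ℕ} (σ : Equiv.Perm (Fin (n + 1))) : List (Fin n) :=
  (exists_reducedWord σ).choose

/-- The operator `f ↦ f A_{i_1} A_{i_2} ⋯ A_{i_k}` for a word `[i_1, …, i_k]`. Operators act on the
right in the mathematics, so `A_{i_1}` is applied first. -/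
def wordOp {K M : Type*} [Field K] [AddCommGroup M] [Module K M] {n : ℕ}
    (A : Fin n → M →ₗ[K] M) (l : List (Fin n)) : M →ₗ[K] M :=
  l.foldl (fun B i => A i ∘ₗ B) LinearMap.id

/-! ### Tableaux

A cell `(i, j)` of a Young diagram is in row `i` and column `j`, counted from `0`; row `0` is the
longest row. The entry `k + 1` of a tableau corresponds to `k : Fin (n + 1)`. -/

/-- The entries are strictly decreasing along each row and each column; `e k` is the cell that
contains the entry `k + 1`. -/
def IsRST {n : ℕ} {μ : YoungDiagram} (e : Fin (n + 1) ≃ μ.cells) : Prop :=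
  ∀ a b : Fin (n + 1),
    ((e a).1.1 = (e b).1.1 → (e a).1.2 < (e b).1.2 → b < a) ∧
    ((e a).1.2 = (e b).1.2 → (e a).1.1 < (e b).1.1 → b < a)

/-- Reverse standard tableaux of shape `μ` with entries `1, …, n + 1`. -/
def RST (n : ℕ) (μ : YoungDiagram) : Type :=
  {e : Fin (n + 1) ≃ μ.cells // IsRST e}

def RST.row {n : ℕ} {μ : YoungDiagram} (t : RST n μ) (k : Fin (n + 1)) : ℕ := (t.1 k).1.1

def RST.col {n : ℕ} {μ : YoungDiagram} (t : RST n μ) (k : Fin (n + 1)) : ℕ := (t.1 k).1.2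

/-- The content (column minus row) of the entry `k`. -/
def RST.content {n : ℕ} {μ : YoungDiagram} (t : RST n μ) (k : Fin (n + 1)) : ℤ :=
  (t.col k : ℤ) - (t.row k : ℤ)

open Classical in
/-- The tableau in which the entries `a` and `b` are exchanged, if it is a reverse standard
tableau (otherwise `t` itself). -/
def RST.exchange {n : ℕ} {μ : YoungDiagram} (t : RST n μ) (a b : Fin (n + 1)) : RST n μ :=
  if h : IsRST ((Equiv.swap a b).trans t.1) then ⟨(Equiv.swap a b).trans t.1, h⟩ else t

/-- `t` is the tableau obtained by writing `n + 1, …, 2, 1` column by column, from left to right,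
starting in each column with row `0`. -/
def RST.IsInitial {n : ℕ} {μ : YoungDiagram} (t : RST n μ) : Prop :=
  ∀ a b : Fin (n + 1), a < b →
    t.col b < t.col a ∨ (t.col b = t.col a ∧ t.row b < t.row a)

/-! ### The Hecke algebra on `V_λ`, on polynomials, and on vector valued polynomials -/

/-- The space `V_λ` with basis the reverse standard tableaux. -/
abbrev VMod (K : Type*) [Field K] (n : ℕ) (μ : YoungDiagram) : Type _ := RST n μ →₀ K

/-- The vector `𝕋 T_i`. -/
def heckeTab {K : Type*} [Field K] (s : K) {n : ℕ} {μ : YoungDiagram} (i : Fin n)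
    (t : RST n μ) : VMod K n μ :=
  let a := i.castSucc
  let b := i.succ
  let m : ℤ := t.content b - t.content a
  if t.row a = t.row b then Finsupp.single t s
  else if t.col a = t.col b then Finsupp.single t (-1)
  else if t.row a < t.row b then
    Finsupp.single (t.exchange a b) 1 - Finsupp.single t ((1 - s) / (1 - s ^ m))
  else
    Finsupp.single t ((s - 1) / (1 - s ^ m)) +
      Finsupp.single (t.exchange a b)
        (s * (1 - s ^ (m + 1)) * (1 - s ^ (m - 1)) / (1 - s ^ m) ^ 2)

/-- The action of `T_i` on `V_λ`. -/
def heckeV {K : Type*} [Field K] (s : K) {n : ℕ} {μ : YoungDiagram} (i : Fin n) :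
    VMod K n μ →ₗ[K] VMod K n μ :=
  Finsupp.linearCombination K (heckeTab s i)

/-- `s_i` acting on polynomials by exchanging `x_i` and `x_{i+1}`. -/
def swapX (K : Type*) [Field K] {n : ℕ} (i : Fin n) :
    MvPolynomial (Fin (n + 1)) K →ₗ[K] MvPolynomial (Fin (n + 1)) K :=
  (MvPolynomial.rename (R := K) (adj i)).toLinearMap

theorem dvd_sub_swapX {K : Type*} [Field K] {n : ℕ} (i : Fin n)
    (f : MvPolynomial (Fin (n + 1)) K) :
    (MvPolynomial.X i.castSucc - MvPolynomial.X i.succ : MvPolynomial (Fin (n + 1)) K) ∣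
      f - swapX K i f := by
  induction f using MvPolynomial.induction_on with
  | C a => simp [swapX]
  | add p r hp hr =>
    rw [map_add, add_sub_add_comm]
    exact dvd_add hp hr
  | mul_X p j hp =>
    have e : p * MvPolynomial.X j - swapX K i (p * MvPolynomial.X j) =
        (p - swapX K i p) * MvPolynomial.X j +
          swapX K i p * (MvPolynomial.X j - MvPolynomial.X (adj i j)) := by
      simp only [swapX, AlgHom.toLinearMap_apply, map_mul, MvPolynomial.rename_X]
      ring
    rw [e]
    refine dvd_add (hp.mul_right _) (Dvd.dvd.mul_left ?_ _)
    by_cases h1 : j = i.castSucc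
    · subst h1
      simp [adj]
    · by_cases h2 : j = i.succ
      · subst h2
        rw [adj, Equiv.swap_apply_right]
        exact ⟨-1, by ring⟩
      · rw [adj, Equiv.swap_apply_of_ne_of_ne h1 h2]
        simp

theorem X_sub_X_ne_zero {K : Type*} [Field K] {n : ℕ} (i : Fin n) :
    (MvPolynomial.X i.castSucc - MvPolynomial.X i.succ : MvPolynomial (Fin (n + 1)) K) ≠ 0 := by
  rw [sub_ne_zero]
  intro h
  exact (Fin.castSucc_lt_succ (i := i)).ne (MvPolynomial.X_injective h)

/-- The divided difference `∂_i`: the polynomial `(f - f s_i) / (x_i - x_{i+1})`. -/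
def divDiff (K : Type*) [Field K] {n : ℕ} (i : Fin n) :
    MvPolynomial (Fin (n + 1)) K →ₗ[K] MvPolynomial (Fin (n + 1)) K where
  toFun f := (dvd_sub_swapX i f).choose
  map_add' f g := by
    apply mul_left_cancel₀ (X_sub_X_ne_zero (K := K) i)
    rw [mul_add, ← (dvd_sub_swapX i (f + g)).choose_spec, ← (dvd_sub_swapX i f).choose_spec,
      ← (dvd_sub_swapX i g).choose_spec, map_add, add_sub_add_comm]
  map_smul' c f := by
    apply mul_left_cancel₀ (X_sub_X_ne_zero (K := K) i)
    rw [RingHom.id_apply, mul_smul_comm, ← (dvd_sub_swapX i (c • f)).choose_spec,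
      ← (dvd_sub_swapX i f).choose_spec, map_smul, smul_sub]

/-- `δ_i = (1 - s) ∂_i x_{i+1}`. -/
def delta {K : Type*} [Field K] (s : K) {n : ℕ} (i : Fin n) :
    MvPolynomial (Fin (n + 1)) K →ₗ[K] MvPolynomial (Fin (n + 1)) K :=
  (1 - s) • (LinearMap.mulLeft K (MvPolynomial.X i.succ) ∘ₗ divDiff K i)

/-- Vector valued polynomials `K[x_1, …, x_N] ⊗ V_λ`. -/
abbrev VPoly (K : Type*) [Field K] (n : ℕ) (μ : YoungDiagram) : Type _ :=
  MvPolynomial (Fin (n + 1)) K ⊗[K] VMod K n μ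

/-- The operator `𝐓_i = δ_i + s_i T_i`, with `δ_i`, `s_i` acting on the variables and `T_i` on the
tableaux. -/
def hecke {K : Type*} [Field K] (s : K) {n : ℕ} {μ : YoungDiagram} (i : Fin n) :
    VPoly K n μ →ₗ[K] VPoly K n μ :=
  TensorProduct.map (delta s i) LinearMap.id + TensorProduct.map (swapX K i) (heckeV s i)

/-- The operator `𝐓_i⁻¹ = (𝐓_i + 1 - s) / s`. -/
def heckeInv {K : Type*} [Field K] (s : K) {n : ℕ} {μ : YoungDiagram} (i : Fin n) :
    VPoly K n μ →ₗ[K] VPoly K n μ :=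
  s⁻¹ • (hecke s i + (1 - s) • LinearMap.id)

/-- The raising operator `f ↦ f 𝐓_1⁻¹ ⋯ 𝐓_{N-1}⁻¹ x_N`. -/
def raising {K : Type*} [Field K] (s : K) {n : ℕ} {μ : YoungDiagram} :
    VPoly K n μ →ₗ[K] VPoly K n μ :=
  TensorProduct.map (LinearMap.mulLeft K (MvPolynomial.X (Fin.last n))) LinearMap.id ∘ₗ
    wordOp (heckeInv s) (List.finRange n)

/-- The symmetrizer `𝐒_N = ∑_σ 𝐓_{i_1} ⋯ 𝐓_{i_k}`, where `σ = s_{i_1} ⋯ s_{i_k}` is a shortest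
expression. -/
def symmetrizer {K : Type*} [Field K] (s : K) {n : ℕ} {μ : YoungDiagram} :
    VPoly K n μ →ₗ[K] VPoly K n μ :=
  ∑ σ : Equiv.Perm (Fin (n + 1)), wordOp (hecke s) (reducedWord σ)

/-- The antisymmetrizer `𝐀_N = ∑_σ (-s)^{ℓ(σ)} 𝐓_{i_1}⁻¹ ⋯ 𝐓_{i_k}⁻¹`, where
`σ = s_{i_1} ⋯ s_{i_k}` is a shortest expression. -/
def antisymmetrizer {K : Type*} [Field K] (s : K) {n : ℕ} {μ : YoungDiagram} :
    VPoly K n μ →ₗ[K] VPoly K n μ :=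
  ∑ σ : Equiv.Perm (Fin (n + 1)), (-s) ^ ell σ • wordOp (heckeInv s) (reducedWord σ)

/-! ### The Yang-Baxter graph and the nonsymmetric Macdonald polynomials -/

/-- The rank function `r_v`: the position of `v i` when the entries of `v` are sorted decreasingly,
equal entries keeping their order. -/
def rank {n : ℕ} (v : Fin (n + 1) → ℕ) (i : Fin (n + 1)) : Fin (n + 1) :=
  ⟨(Finset.univ.filter (fun j => v i < v j ∨ (v j = v i ∧ j < i))).card, by
    have h : (Finset.univ.filter (fun j => v i < v j ∨ (v j = v i ∧ j < i))) ⊂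
        (Finset.univ : Finset (Fin (n + 1))) := by
      refine Finset.filter_ssubset.2 ⟨i, Finset.mem_univ i, ?_⟩
      simp
    simpa using Finset.card_lt_card h⟩

/-- The vertices of the Yang-Baxter graph, labelled by pairs `(𝕋, v)`. -/
abbrev Vertex (n : ℕ) (μ : YoungDiagram) : Type := RST n μ × (Fin (n + 1) → ℕ)

/-- The spectral vector `ζ_{v,𝕋}[i] = q^{v[i]} s^{CT_𝕋[r_v[i]]}`. -/
def spec {K : Type*} [Field K] (q s : K) {n : ℕ} {μ : YoungDiagram} (x : Vertex n μ)
    (i : Fin (n + 1)) : K :=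
  q ^ x.2 i * s ^ x.1.content (rank x.2 i)

/-- The arrow `x ⟶ y` labelled `s_i` (arrows to the empty vertex excluded): either a step, which
exchanges the values `v[i] < v[i+1]`, or a jump, which, when `v[i] = v[i+1]`, exchanges in `𝕋` the
entries `r_v[i]` and `r_v[i+1]`, the former having a content larger by at least `2`. -/
def Arrow {n : ℕ} {μ : YoungDiagram} (i : Fin n) (x y : Vertex n μ) : Prop :=
  (x.2 i.castSucc < x.2 i.succ ∧ y = (x.1, x.2 ∘ adj i)) ∨
  (x.2 i.castSucc = x.2 i.succ ∧
    x.1.content (rank x.2 i.succ) + 2 ≤ x.1.content (rank x.2 i.castSucc) ∧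
    y = (x.1.exchange (rank x.2 i.castSucc) (rank x.2 i.succ), x.2))

/-- The affine arrow `v ↦ (v[2], …, v[N], v[1] + 1)`. -/
def affine {n : ℕ} {μ : YoungDiagram} (x : Vertex n μ) : Vertex n μ :=
  (x.1, Fin.snoc (α := fun _ => ℕ) (fun i : Fin n => x.2 i.succ) (x.2 0 + 1))

/-- `PathPoly q s x f`: there is a path in the Yang-Baxter graph from its root
`(𝕋_λ, [0, …, 0])` to `x` whose associated polynomial is `f`. -/
inductive PathPoly {K : Type*} [Field K] (q s : K) {n : ℕ} {μ : YoungDiagram} :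
    Vertex n μ → VPoly K n μ → Prop
  | nil (t : RST n μ) (ht : t.IsInitial) :
      PathPoly q s (t, fun _ => 0) ((1 : MvPolynomial (Fin (n + 1)) K) ⊗ₜ[K] Finsupp.single t 1)
  | arrow (i : Fin n) (x y : Vertex n μ) (f : VPoly K n μ) (hf : PathPoly q s x f)
      (hxy : Arrow i x y) :
      PathPoly q s y
        (hecke s i f + ((1 - s) / (1 - spec q s x i.succ / spec q s x i.castSucc)) • f)
  | affine (x : Vertex n μ) (f : VPoly K n μ) (hf : PathPoly q s x f) :
      PathPoly q s (affine x) (raising s f)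

open Classical in
/-- The nonsymmetric vector valued Macdonald polynomial `P_{v,𝕋}`: the polynomial associated with
a path from the root to `x = (𝕋, v)` (all paths give the same polynomial). -/
def macdonald {K : Type*} [Field K] (q s : K) {n : ℕ} {μ : YoungDiagram} (x : Vertex n μ) :
    VPoly K n μ :=
  if h : ∃ f, PathPoly q s x f then h.choose else 0

/-! ### Connected components without the affine arrows -/

/-- Fillings of the diagram by nonnegative integers. -/
abbrev Filling (μ : YoungDiagram) : Type := μ.cells → ℕ

/-- Weakly increasing along rows, strictly increasing along columns. -/
def ColumnStrict {μ : YoungDiagram} (T : Filling μ) : Prop :=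
  (∀ c d : μ.cells, c.1.1 = d.1.1 → c.1.2 ≤ d.1.2 → T c ≤ T d) ∧
  (∀ c d : μ.cells, c.1.2 = d.1.2 → c.1.1 < d.1.1 → T c < T d)

/-- Strictly increasing along rows, weakly increasing along columns. -/
def RowStrict {μ : YoungDiagram} (T : Filling μ) : Prop :=
  (∀ c d : μ.cells, c.1.1 = d.1.1 → c.1.2 < d.1.2 → T c < T d) ∧
  (∀ c d : μ.cells, c.1.2 = d.1.2 → c.1.1 ≤ d.1.1 → T c ≤ T d)

/-- The conjugate filling, with rows and columns exchanged. -/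
def conj {μ : YoungDiagram} (T : Filling μ) : Filling μ.transpose := fun c =>
  T ⟨c.1.swap, by
    have h := c.2
    rw [YoungDiagram.mem_cells, YoungDiagram.mem_transpose] at h
    exact (YoungDiagram.mem_cells _).2 h⟩

/-- `v⁺`, the decreasing rearrangement of `v`. -/
def decreasing {n : ℕ} (v : Fin (n + 1) → ℕ) (k : Fin (n + 1)) : ℕ :=
  v (Tuple.sort v (Fin.rev k))

/-- `T(𝕋, v)`: each entry `k` of `𝕋` is replaced by `v⁺[k]`. -/
def fillingOf {n : ℕ} {μ : YoungDiagram} (x : Vertex n μ) : Filling μ :=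
  fun c => decreasing x.2 (x.1.1.symm c)

/-- The vertices of `H_T`, the connected component, in the graph without the affine arrows, of
the vertices `x` with `T(𝕋, v) = T`. -/
def component (n : ℕ) {μ : YoungDiagram} (T : Filling μ) : Set (Vertex n μ) :=
  {y | ∃ x : Vertex n μ, fillingOf x = T ∧
    Relation.EqvGen (fun a b => ∃ i : Fin n, Arrow i a b) x y}

/-- `r` is a root of `H_T`: a vertex of `H_T` without incoming arrow. -/
def IsRoot {n : ℕ} {μ : YoungDiagram} (T : Filling μ) (r : Vertex n μ) : Prop :=
  r ∈ component n T ∧ ∀ (i : Fin n) (y : Vertex n μ), ¬ Arrow i y r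

/-- `k` is a sink of `H_T`: a vertex of `H_T` without outgoing arrow. -/
def IsSink {n : ℕ} {μ : YoungDiagram} (T : Filling μ) (k : Vertex n μ) : Prop :=
  k ∈ component n T ∧ ∀ (i : Fin n) (y : Vertex n μ), ¬ Arrow i k y

/-- There is a directed path of length `m` from `x` to `y`, without affine arrows. -/
inductive DirPath {n : ℕ} {μ : YoungDiagram} (x : Vertex n μ) : Vertex n μ → ℕ → Prop
  | nil : DirPath x x 0
  | cons (i : Fin n) (y z : Vertex n μ) (m : ℕ) (hy : DirPath x y m) (hyz : Arrow i y z) :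
      DirPath x z (m + 1)

/-- The length of the shortest directed paths from `x` to `y`. When `x` and `y` are the root and
the sink of a component, it is the length of the shortest permutation that carries the spectral
vector of `x` to that of `y` by permissible transpositions. -/
def pathLength {n : ℕ} {μ : YoungDiagram} (x y : Vertex n μ) : ℕ := sInf {m | DirPath x y m}

/-- `PathCoeff q s fac r x c`: starting with `1` at `r` and multiplying by
`fac ζ[i] ζ[i+1]` along each arrow labelled `s_i` that starts at a vertex with spectral vector `ζ`,
some directed path from `r` to `x` gives `c`. -/
inductive PathCoeff {K : Type*} [Field K] (q s : K) (fac : K → K → K) {n : ℕ} {μ : YoungDiagram}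
    (r : Vertex n μ) : Vertex n μ → K → Prop
  | nil : PathCoeff q s fac r r 1
  | cons (i : Fin n) (x y : Vertex n μ) (c : K) (hx : PathCoeff q s fac r x c)
      (hxy : Arrow i x y) :
      PathCoeff q s fac r y (fac (spec q s x i.castSucc) (spec q s x i.succ) * c)

open Classical in
/-- The coefficient at `x` obtained along a directed path from `r` (all paths give the same). -/
def coeff {K : Type*} [Field K] (q s : K) (fac : K → K → K) {n : ℕ} {μ : YoungDiagram}
    (r x : Vertex n μ) : K :=
  if h : ∃ c, PathCoeff q s fac r x c then h.choose else 0

/-- The coefficients `b_ζ`: `b = 1` at the root `r`, and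
`b_{ζ s_i} = (ζ[i] - ζ[i+1]) / (s ζ[i] - ζ[i+1]) b_ζ` along the arrows. -/
def symCoeff {K : Type*} [Field K] (q s : K) {n : ℕ} {μ : YoungDiagram} (r x : Vertex n μ) : K :=
  coeff q s (fun a b => (a - b) / (s * a - b)) r x

/-- The coefficients `bᵃ_ζ`: `bᵃ = 1` at the root `r`, and
`bᵃ_{ζ s_i} = - (ζ[i] - ζ[i+1]) / (ζ[i] - s ζ[i+1]) bᵃ_ζ` along the arrows. -/
def antiCoeff {K : Type*} [Field K] (q s : K) {n : ℕ} {μ : YoungDiagram} (r x : Vertex n μ) : K :=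
  coeff q s (fun a b => -((a - b) / (a - s * b))) r x

/-- The symmetric Macdonald polynomial `𝔐_T = ∑_{ζ ∈ T} b_ζ P_ζ`, where `r` is the root of
`H_T`. -/
def symMacdonald {K : Type*} [Field K] (q s : K) {n : ℕ} {μ : YoungDiagram} (T : Filling μ)
    (r : Vertex n μ) : VPoly K n μ :=
  ∑ᶠ x ∈ component n T, symCoeff q s r x • macdonald q s x

/-- The antisymmetric Macdonald polynomial `𝔐ᵃ_T = ∑_{ζ ∈ T} bᵃ_ζ P_ζ`, where `r` is the root of
`H_T`. -/
def antiMacdonald {K : Type*} [Field K] (q s : K) {n : ℕ} {μ : YoungDiagram} (T : Filling μ)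
    (r : Vertex n μ) : VPoly K n μ :=
  ∑ᶠ x ∈ component n T, antiCoeff q s r x • macdonald q s x

/-! ### The stabilizer of a filling and its Poincaré polynomial -/

/-- The standardization `std_1 T`, with entries `1, …, N`. -/
def std1 {μ : YoungDiagram} (T : Filling μ) (c : μ.cells) : ℕ :=
  (Finset.univ.filter (fun d : μ.cells => T c < T d)).card +
  (Finset.univ.filter (fun d : μ.cells => c.1.1 < d.1.1 ∧ T d = T c)).card +
  (Finset.univ.filter (fun d : μ.cells => d.1.1 = c.1.1 ∧ c.1.2 ≤ d.1.2 ∧ T d = T c)).card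

open Classical in
/-- The group `𝔖_T` of the permutations of `{1, …, N}` that, acting on the entries of `std_1 T`,
preserve the set of entries of each row and leave `T` invariant. -/
def stabilizer (n : ℕ) {μ : YoungDiagram} (T : Filling μ) :
    Finset (Equiv.Perm (Fin (n + 1))) :=
  Finset.univ.filter (fun σ => ∀ (k : Fin (n + 1)) (c d : μ.cells),
    std1 T c = (k : ℕ) + 1 → std1 T d = (σ k : ℕ) + 1 → d.1.1 = c.1.1 ∧ T d = T c)

/-- The Poincaré polynomial `φ_T(s) = ∑_{σ ∈ 𝔖_T} s^{ℓ(σ)}`. -/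
def poincare {K : Type*} [Field K] (s : K) (n : ℕ) {μ : YoungDiagram} (T : Filling μ) : K :=
  ∑ σ ∈ stabilizer n T, s ^ ell σ

/-! ### The field of coefficients -/

/-- The field `ℂ(q, s)` of rational functions in two indeterminates. -/
abbrev Coeff : Type := FractionRing (MvPolynomial (Fin 2) ℂ)

def qq : Coeff := algebraMap (MvPolynomial (Fin 2) ℂ) Coeff (MvPolynomial.X 0)

def ss : Coeff := algebraMap (MvPolynomial (Fin 2) ℂ) Coeff (MvPolynomial.X 1)

end VVMac

end

/-!
Both parts rest on one observation about the symmetrizer `𝐒 = ∑_σ 𝐓_σ` of a Hecke algebra: since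
`𝐒 𝐓_i = s 𝐒` (`apply_sum_wordOp`), the coefficients of `P_root 𝐒`, expanded over the Macdonald
polynomials of the component, have to change along each arrow by the factor that defines `b_ζ`.
Hence `P_root 𝐒` is proportional to `𝔐_T`, and the constant is read off at the sink, where the
coefficient of `P_root 𝐒` is the Poincaré polynomial `φ_T(s)`.

To make this precise, the vertices of `H_T` are encoded as orderings of the cells of the diagram
(`cellOrder`). The cells with a common value of `T` form a horizontal or a vertical strip; the cells
of one row (column) of such a strip form a block, whose cells occur in a fixed order at every vertex
of the component. Relative to the numbering of the cells at the sink, a vertex becomes a permutation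
that is increasing on each block (`InOrder`), and an arrow exchanges two neighbours of different
blocks that are in decreasing order (`LineStrict.arrow_iff`). So `H_T` has the identity as its only
sink and the permutation that reverses the order of the blocks (`IsTop`) as its only root.

These permutations are a basis of a seminormal representation of the Hecke algebra
(`model_isHecke`), in which the coefficients do make sense, and which maps to `𝓜_λ` equivariantly,
sending each vertex to its Macdonald polynomial (`exists_expansion`); linear independence of the
Macdonald polynomials is not needed. The coefficient at the sink is computed in the model by
induction on the length of `σ` (`wordOp_model_apply_one`): only the `σ` for which `ρ σ` preserves all
blocks contribute, where `ρ` is the root, and they contribute `s ^ ℓ(ρ σ)`.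

What remains is the action of `𝐓_i` on the nonsymmetric Macdonald polynomials. They are defined by a
recursion on the exponent `v` that uses only steps and the affine operation (`mac`), and it is shown
by induction on `v` that they obey the rule of the arrows at every step and at every pair of equal
consecutive exponents (`mac_rules`). The ingredients are the Yang-Baxter equation (`stepOp_braid`)
and the commutation of the raising operator with the generators (`raising_hecke`,
`raising_raising_hecke`). Consequently all paths to a vertex give the same polynomial
(`macdonald_eq_mac`).

For the antisymmetric part everything is applied to the operators `-s 𝐓_i⁻¹`, which satisfy the same
quadratic relation, to the inverse spectral values, and to the Macdonald polynomials multiplied by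
the signs of the vertices. In this case the blocks of the sink come in a different order than those
of the standardization of the conjugate filling; this does not affect the Poincaré polynomial
(`sum_pow_ell_eq`).
-/

namespace VVMac

set_option linter.unusedSectionVars false

/-! ### Words, lengths and Matsumoto's theorem in the symmetric group -/

section Coxeter

variable {n : ℕ}

theorem adj_mul_self (i : Fin n) : adj i * adj i = 1 := Equiv.swap_mul_self _ _

theorem adj_adj (i : Fin n) (a : Fin (n + 1)) : adj i (adj i a) = a := Equiv.swap_apply_self _ _ _

@[simp] theorem adj_inv (i : Fin n) : (adj i)⁻¹ = adj i := Equiv.swap_inv _ _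

@[simp] theorem adj_castSucc (i : Fin n) : adj i i.castSucc = i.succ :=
  Equiv.swap_apply_left _ _

@[simp] theorem adj_succ (i : Fin n) : adj i i.succ = i.castSucc :=
  Equiv.swap_apply_right _ _

theorem adj_of_ne {i : Fin n} {a : Fin (n + 1)} (h1 : a ≠ i.castSucc) (h2 : a ≠ i.succ) :
    adj i a = a := Equiv.swap_apply_of_ne_of_ne h1 h2

theorem mul_adj_adj (σ : Equiv.Perm (Fin (n + 1))) (i : Fin n) : σ * adj i * adj i = σ := by
  rw [mul_assoc, adj_mul_self, mul_one]

theorem adj_val (i : Fin n) (a : Fin (n + 1)) :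
    (adj i a : ℕ) = if (a : ℕ) = i then (i : ℕ) + 1 else if (a : ℕ) = i + 1 then (i : ℕ) else a := by
  split_ifs with h1 h2
  · have : a = i.castSucc := Fin.ext h1
    simp [this]
  · have : a = i.succ := Fin.ext h2
    simp [this]
  · rw [adj_of_ne (fun h => h1 (by simp [h])) (fun h => h2 (by simp [h]))]

theorem adj_comm {i j : Fin n} (h : (i : ℕ) + 1 < j) : adj i * adj j = adj j * adj i := by
  ext a
  simp only [Equiv.Perm.mul_apply, adj_val]
  split_ifs <;> omega

theorem adj_braid {i j : Fin n} (h : (j : ℕ) = i + 1) :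
    adj i * adj j * adj i = adj j * adj i * adj j := by
  have hs : j.castSucc = i.succ := Fin.ext (by simp [h])
  have h1 : i.castSucc ≠ i.succ := Fin.castSucc_lt_succ.ne
  have h2 : i.succ ≠ j.succ := hs ▸ Fin.castSucc_lt_succ.ne
  have h3 : i.castSucc ≠ j.succ := by simp [Fin.ext_iff, h]; omega
  have e1 := Equiv.swap_mul_swap_mul_swap h1 h3
  have e2 := Equiv.swap_mul_swap_mul_swap h2.symm h3.symm
  rw [adj, adj, hs, e1, Equiv.swap_comm i.castSucc i.succ, Equiv.swap_comm i.succ j.succ, e2,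
    Equiv.swap_comm]

/-- The inversions of a permutation. -/
def inv (σ : Equiv.Perm (Fin (n + 1))) : Finset (Fin (n + 1) × Fin (n + 1)) :=
  Finset.univ.filter (fun p => p.1 < p.2 ∧ σ p.2 < σ p.1)

theorem ell_eq_card_inv (σ : Equiv.Perm (Fin (n + 1))) : ell σ = (inv σ).card := rfl

theorem mem_inv {σ : Equiv.Perm (Fin (n + 1))} {p : Fin (n + 1) × Fin (n + 1)} :
    p ∈ inv σ ↔ p.1 < p.2 ∧ σ p.2 < σ p.1 := by simp [inv]

theorem adj_lt_adj {i : Fin n} {a b : Fin (n + 1)} (h : a < b)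
    (hab : ¬ (a = i.castSucc ∧ b = i.succ)) : adj i a < adj i b := by
  rw [Fin.lt_def] at h ⊢
  rw [adj_val, adj_val]
  have : ¬ ((a : ℕ) = i ∧ (b : ℕ) = i + 1) := fun h => hab ⟨Fin.ext h.1, Fin.ext h.2⟩
  split_ifs <;> omega

theorem ell_mul_adj_of_lt {σ : Equiv.Perm (Fin (n + 1))} {i : Fin n}
    (h : σ i.castSucc < σ i.succ) : ell (σ * adj i) = ell σ + 1 := by
  have hn : (i.castSucc, i.succ) ∉ (inv σ).image (Prod.map (adj i) (adj i)) := by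
    intro hc
    obtain ⟨⟨a, b⟩, hp, he⟩ := Finset.mem_image.1 hc
    obtain ⟨h1, -⟩ := mem_inv.1 hp
    simp only [Prod.map_apply, Prod.mk.injEq] at he
    have ha : a = i.succ := by rw [← adj_adj i a, he.1, adj_castSucc]
    have hb : b = i.castSucc := by rw [← adj_adj i b, he.2, adj_succ]
    subst ha hb
    exact absurd h1 (by simp [Fin.castSucc_lt_succ.le])
  have e : inv (σ * adj i) =
      insert (i.castSucc, i.succ) ((inv σ).image (Prod.map (adj i) (adj i))) := by
    ext ⟨a, b⟩
    rw [Finset.mem_insert, Finset.mem_image, mem_inv]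
    simp only [Equiv.Perm.mul_apply]
    constructor
    · rintro ⟨h1, h2⟩
      by_cases hab : a = i.castSucc ∧ b = i.succ
      · left; rw [hab.1, hab.2]
      · right
        exact ⟨(adj i a, adj i b), mem_inv.2 ⟨adj_lt_adj h1 hab, h2⟩, by simp [adj_adj]⟩
    · rintro (h1 | ⟨⟨c, d⟩, hp, he⟩)
      · simp only [Prod.mk.injEq] at h1
        rw [h1.1, h1.2, adj_castSucc, adj_succ]
        exact ⟨Fin.castSucc_lt_succ, h⟩
      · obtain ⟨h1, h2⟩ := mem_inv.1 hp
        simp only [Prod.map_apply, Prod.mk.injEq] at he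
        rw [← he.1, ← he.2, adj_adj, adj_adj]
        refine ⟨adj_lt_adj h1 ?_, h2⟩
        rintro ⟨rfl, rfl⟩
        exact absurd h2 h.le.not_gt
  rw [ell_eq_card_inv, e, Finset.card_insert_of_notMem hn, Finset.card_image_of_injective,
    ell_eq_card_inv]
  exact Function.Injective.prodMap (adj i).injective (adj i).injective

theorem ell_eq_of_gt {σ : Equiv.Perm (Fin (n + 1))} {i : Fin n}
    (h : σ i.succ < σ i.castSucc) : ell σ = ell (σ * adj i) + 1 := by
  rw [← ell_mul_adj_of_lt (σ := σ * adj i) (i := i) (by simpa using h), mul_adj_adj]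

theorem lt_or_gt_adj (σ : Equiv.Perm (Fin (n + 1))) (i : Fin n) :
    σ i.castSucc < σ i.succ ∨ σ i.succ < σ i.castSucc :=
  lt_or_gt_of_ne fun h => Fin.castSucc_lt_succ.ne (σ.injective h)

theorem ell_one : ell (1 : Equiv.Perm (Fin (n + 1))) = 0 := by
  rw [ell_eq_card_inv, Finset.card_eq_zero, Finset.eq_empty_iff_forall_notMem]
  intro p hp
  have := mem_inv.1 hp
  exact absurd this.1 this.2.le.not_gt

theorem eq_one_of_strictMono {σ : Equiv.Perm (Fin (n + 1))} (h : StrictMono σ) : σ = 1 := by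
  ext1 a
  have := Subsingleton.elim (StrictMono.orderIsoOfSurjective σ h σ.surjective)
    (OrderIso.refl (Fin (n + 1)))
  exact congrArg (fun f : Fin (n + 1) ≃o Fin (n + 1) => f a) this

theorem eq_one_of_forall_lt {σ : Equiv.Perm (Fin (n + 1))}
    (h : ∀ i : Fin n, σ i.castSucc < σ i.succ) : σ = 1 :=
  eq_one_of_strictMono (Fin.strictMono_iff_lt_succ.2 h)

theorem exists_descent {σ : Equiv.Perm (Fin (n + 1))} (h : σ ≠ 1) :
    ∃ i : Fin n, σ i.succ < σ i.castSucc := by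
  by_contra! hc
  exact h (eq_one_of_forall_lt fun i => (lt_or_gt_adj σ i).resolve_right (hc i).not_gt)

theorem wordPerm_concat (l : List (Fin n)) (i : Fin n) :
    wordPerm (l ++ [i]) = wordPerm l * adj i := by
  simp [wordPerm]

theorem ell_mul_adj_le (σ : Equiv.Perm (Fin (n + 1))) (i : Fin n) :
    ell (σ * adj i) ≤ ell σ + 1 := by
  rcases lt_or_gt_adj σ i with h | h
  · exact (ell_mul_adj_of_lt h).le
  · have := ell_eq_of_gt h
    omega

theorem ell_le_ell_mul_adj (σ : Equiv.Perm (Fin (n + 1))) (i : Fin n) :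
    ell σ ≤ ell (σ * adj i) + 1 := by
  simpa [mul_adj_adj] using ell_mul_adj_le (σ * adj i) i

theorem ell_wordPerm_le (l : List (Fin n)) : ell (wordPerm l) ≤ l.length := by
  induction l using List.reverseRecOn with
  | nil => simp [wordPerm, ell_one]
  | append_singleton l i ih =>
    rw [wordPerm_concat, List.length_append, List.length_singleton]
    exact (ell_mul_adj_le _ _).trans (by omega)

theorem exists_word_length_eq_ell (σ : Equiv.Perm (Fin (n + 1))) :
    ∃ l : List (Fin n), wordPerm l = σ ∧ l.length = ell σ := by
  induction hm : ell σ generalizing σ with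
  | zero =>
    refine ⟨[], ?_, rfl⟩
    by_contra hc
    obtain ⟨i, hi⟩ := exists_descent (σ := σ) (fun h => hc (by simp [h, wordPerm]))
    have := ell_eq_of_gt hi
    omega
  | succ m ih =>
    have hne : σ ≠ 1 := by
      rintro rfl
      simp [ell_one] at hm
    obtain ⟨i, hi⟩ := exists_descent hne
    have h1 := ell_eq_of_gt hi
    obtain ⟨l, hl, hl'⟩ := ih (σ * adj i) (by omega)
    exact ⟨l ++ [i], by rw [wordPerm_concat, hl, mul_adj_adj], by simp [hl']⟩

theorem wordPerm_reducedWord (σ : Equiv.Perm (Fin (n + 1))) : wordPerm (reducedWord σ) = σ :=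
  (exists_reducedWord σ).choose_spec.1

theorem length_reducedWord (σ : Equiv.Perm (Fin (n + 1))) :
    (reducedWord σ).length = ell σ := by
  obtain ⟨l, hl, hl'⟩ := exists_word_length_eq_ell σ
  refine le_antisymm (hl' ▸ (exists_reducedWord σ).choose_spec.2 l hl) ?_
  conv_lhs => rw [← wordPerm_reducedWord σ]
  exact ell_wordPerm_le _

theorem ell_inv (σ : Equiv.Perm (Fin (n + 1))) : ell σ⁻¹ = ell σ := by
  rw [ell_eq_card_inv, ell_eq_card_inv]
  refine Finset.card_bij' (fun p _ => (σ⁻¹ p.2, σ⁻¹ p.1)) (fun p _ => (σ p.2, σ p.1)) ?_ ?_ ?_ ?_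
  · intro p hp
    have := mem_inv.1 hp
    exact mem_inv.2 ⟨this.2, by simpa using this.1⟩
  · intro p hp
    have := mem_inv.1 hp
    exact mem_inv.2 ⟨this.2, by simpa using this.1⟩
  · intro p hp
    simp
  · intro p hp
    simp

end Coxeter

section Matsumoto

variable {K M : Type*} [Field K] [AddCommGroup M] [Module K M] {n : ℕ}

/-- The relations of the Hecke algebra of type `A_n` with parameter `s`, for linear
operators: the quadratic relation `(A_i - s)(A_i + 1) = 0` and the braid relations. -/
structure IsHecke (s : K) (A : Fin n → M →ₗ[K] M) : Prop where
  quad : ∀ i f, A i (A i f) = (s - 1) • A i f + s • f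
  comm : ∀ i j : Fin n, (i : ℕ) + 1 < j → ∀ f, A i (A j f) = A j (A i f)
  braid : ∀ i j : Fin n, (j : ℕ) = i + 1 → ∀ f, A i (A j (A i f)) = A j (A i (A j f))

theorem wordOp_concat (A : Fin n → M →ₗ[K] M) (l : List (Fin n)) (i : Fin n) (f : M) :
    wordOp A (l ++ [i]) f = A i (wordOp A l f) := by
  simp [wordOp, List.foldl_append]

theorem wordOp_nil (A : Fin n → M →ₗ[K] M) (f : M) : wordOp A [] f = f := rfl

/-- Matsumoto's theorem: two shortest expressions of the same permutation give the same operator. -/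
theorem wordOp_eq_of_wordPerm_eq {s : K} {A : Fin n → M →ₗ[K] M} (hA : IsHecke s A)
    {l l' : List (Fin n)} (h : wordPerm l = wordPerm l') (hl : l.length = ell (wordPerm l))
    (hl' : l'.length = ell (wordPerm l)) (f : M) : wordOp A l f = wordOp A l' f := by
  induction hm : l.length using Nat.strong_induction_on generalizing l l' with
  | _ m ih =>
  rcases l.eq_nil_or_concat' with rfl | ⟨l, i, rfl⟩
  · have : l' = [] := List.length_eq_zero_iff.1 (by rw [hl', ← hl]; rfl)
    rw [this]
  rcases l'.eq_nil_or_concat' with rfl | ⟨l', j, rfl⟩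
  · rw [← hl] at hl'
    simp at hl'
  set σ := wordPerm (l ++ [i]) with hσ
  have eσ : σ * adj i = wordPerm l := by rw [hσ, wordPerm_concat, mul_adj_adj]
  have eσ' : σ * adj j = wordPerm l' := by rw [h, wordPerm_concat, mul_adj_adj]
  simp only [List.length_append, List.length_singleton] at hl hl' hm
  have key : ∀ (k : Fin n) (w : List (Fin n)), σ * adj k = wordPerm w → w.length + 1 = ell σ →
      σ k.succ < σ k.castSucc ∧ w.length = ell (wordPerm w) := by
    intro k w h1 h2
    have h3 := ell_wordPerm_le w
    rcases lt_or_gt_adj σ k with h4 | h4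
    · have := ell_mul_adj_of_lt h4
      rw [h1] at this
      omega
    · have := ell_eq_of_gt h4
      rw [h1] at this
      exact ⟨h4, by omega⟩
  obtain ⟨di, li⟩ := key i l eσ hl
  obtain ⟨dj, lj⟩ := key j l' eσ' hl'
  rw [wordOp_concat, wordOp_concat]
  -- Replaces a prefix by another shortest expression, using the induction hypothesis.
  have swap : ∀ (k : Fin n) (w w' : List (Fin n)), σ * adj k = wordPerm w → w.length + 1 = ell σ →
      wordPerm w' = wordPerm w → w'.length = w.length → wordOp A w f = wordOp A w' f := by
    intro k w w' h1 h2 h3 h4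
    obtain ⟨-, h5⟩ := key k w h1 h2
    exact ih w.length (by omega) h3.symm h5 (by omega) rfl
  have far : ∀ (i j : Fin n) (l l' : List (Fin n)), (i : ℕ) + 1 < j → σ * adj i = wordPerm l →
      σ * adj j = wordPerm l' → l.length + 1 = ell σ → l'.length + 1 = ell σ →
      A i (wordOp A l f) = A j (wordOp A l' f) := by
    intro i j l l' hij h1 h2 h3 h4
    obtain ⟨di, -⟩ := key i l h1 h3
    obtain ⟨dj, -⟩ := key j l' h2 h4
    obtain ⟨w, hw, hw'⟩ := exists_word_length_eq_ell (σ * adj i * adj j)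
    have hd : (σ * adj i) j.succ < (σ * adj i) j.castSucc := by
      simp only [Equiv.Perm.mul_apply]
      rwa [adj_of_ne, adj_of_ne] <;> simp [Fin.ext_iff] <;> omega
    have e1 := ell_eq_of_gt di
    have e2 := ell_eq_of_gt hd
    rw [swap i l (w ++ [j]) h1 h3 (by rw [wordPerm_concat, hw, mul_adj_adj, h1])
        (by simp; omega),
      swap j l' (w ++ [i]) h2 h4 (by
        rw [wordPerm_concat, hw, mul_assoc σ, adj_comm hij, ← mul_assoc, mul_adj_adj, h2])
        (by simp; omega),
      wordOp_concat, wordOp_concat, hA.comm i j hij]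
  have near : ∀ (i j : Fin n) (l l' : List (Fin n)), (j : ℕ) = i + 1 → σ * adj i = wordPerm l →
      σ * adj j = wordPerm l' → l.length + 1 = ell σ → l'.length + 1 = ell σ →
      A i (wordOp A l f) = A j (wordOp A l' f) := by
    intro i j l l' hij h1 h2 h3 h4
    obtain ⟨di, -⟩ := key i l h1 h3
    obtain ⟨dj, -⟩ := key j l' h2 h4
    have hs : i.succ = j.castSucc := Fin.ext (by simp [hij])
    have a1 : adj i j.succ = j.succ := by
      rw [adj_of_ne] <;> simp [Fin.ext_iff] <;> omega
    have a2 : adj j i.castSucc = i.castSucc := by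
      rw [adj_of_ne] <;> simp [Fin.ext_iff] <;> omega
    obtain ⟨w, hw, hw'⟩ := exists_word_length_eq_ell (σ * adj i * adj j * adj i)
    have hd : (σ * adj i) j.succ < (σ * adj i) j.castSucc := by
      simp only [Equiv.Perm.mul_apply]
      rw [a1, ← hs, adj_succ]
      exact dj.trans (hs ▸ di)
    have hd' : (σ * adj i * adj j) i.succ < (σ * adj i * adj j) i.castSucc := by
      simp only [Equiv.Perm.mul_apply]
      rw [hs, adj_castSucc, a1, a2, adj_castSucc, hs]
      exact dj
    have e1 := ell_eq_of_gt di
    have e2 := ell_eq_of_gt hd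
    have e3 := ell_eq_of_gt hd'
    rw [swap i l (w ++ [i] ++ [j]) h1 h3
        (by rw [wordPerm_concat, wordPerm_concat, hw, mul_adj_adj, mul_adj_adj, h1])
        (by simp; omega),
      swap j l' (w ++ [j] ++ [i]) h2 h4 (by
        rw [wordPerm_concat, wordPerm_concat, hw, mul_assoc σ, mul_assoc σ, adj_braid hij,
          ← mul_assoc, ← mul_assoc, mul_adj_adj, mul_adj_adj, h2])
        (by simp; omega),
      wordOp_concat, wordOp_concat, wordOp_concat, wordOp_concat, hA.braid i j hij]
  rcases lt_trichotomy (i : ℕ) j with hij | hij | hij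
  · rcases Nat.lt_or_ge ((i : ℕ) + 1) j with h1 | h1
    · exact far i j l l' h1 eσ eσ' hl hl'
    · exact near i j l l' (by omega) eσ eσ' hl hl'
  · obtain rfl : i = j := Fin.ext hij
    rw [swap i l l' eσ hl (by rw [← eσ, eσ']) (by omega)]
  · rcases Nat.lt_or_ge ((j : ℕ) + 1) i with h1 | h1
    · exact (far j i l' l h1 eσ' eσ hl' hl).symm
    · exact (near j i l' l (by omega) eσ' eσ hl' hl).symm

/-- Lengthening a permutation by `s_i` appends the operator `A_i`. -/
theorem wordOp_reducedWord_mul_adj {s : K} {A : Fin n → M →ₗ[K] M} (hA : IsHecke s A)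
    {σ : Equiv.Perm (Fin (n + 1))} {i : Fin n} (h : σ i.castSucc < σ i.succ) (f : M) :
    wordOp A (reducedWord (σ * adj i)) f = A i (wordOp A (reducedWord σ) f) := by
  rw [← wordOp_concat]
  apply wordOp_eq_of_wordPerm_eq hA
  · rw [wordPerm_concat, wordPerm_reducedWord, wordPerm_reducedWord]
  · rw [wordPerm_reducedWord, length_reducedWord]
  · rw [wordPerm_reducedWord, List.length_append, length_reducedWord, ell_mul_adj_of_lt h,
      List.length_singleton]

/-- The symmetrizer absorbs `A_i` into the scalar `s`. -/
theorem apply_sum_wordOp {s : K} {A : Fin n → M →ₗ[K] M} (hA : IsHecke s A) (i : Fin n) (f : M) :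
    A i (∑ σ, wordOp A (reducedWord σ) f) = s • ∑ σ, wordOp A (reducedWord σ) f := by
  have hsplit : ∀ F : Equiv.Perm (Fin (n + 1)) → M, ∑ σ, F σ =
      ∑ σ with σ i.castSucc < σ i.succ, (F σ + F (σ * adj i)) := by
    intro F
    rw [← Finset.sum_filter_add_sum_filter_not Finset.univ (fun σ => σ i.castSucc < σ i.succ) F,
      Finset.sum_add_distrib]
    congr 1
    refine Finset.sum_bij' (fun σ _ => σ * adj i) (fun σ _ => σ * adj i) ?_ ?_ ?_ ?_ ?_
    · intro σ hσ
      have := (lt_or_gt_adj σ i).resolve_left (Finset.mem_filter.1 hσ).2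
      simpa using this
    · intro σ hσ
      simpa using (Finset.mem_filter.1 hσ).2.le
    · intro σ _; exact mul_adj_adj σ i
    · intro σ _; exact mul_adj_adj σ i
    · intro σ _; rw [mul_adj_adj]
  rw [hsplit, map_sum, Finset.smul_sum]
  refine Finset.sum_congr rfl fun σ hσ => ?_
  rw [wordOp_reducedWord_mul_adj hA (Finset.mem_filter.1 hσ).2, map_add, hA.quad]
  module

end Matsumoto

/-! ### Seminormal representations of the Hecke algebra -/

section Seminormal

variable {K : Type*} [Field K]

/-- The diagonal entry of a seminormal matrix at a pair of consecutive spectral values `a`, `b`. -/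
def diag (s a b : K) : K := (s - 1) * a / (a - b)

/-- The product of the two off-diagonal entries of a seminormal matrix at a pair of consecutive
spectral values `a`, `b`. -/
def offdiag (s a b : K) : K := (a - s * b) * (s * a - b) / (a - b) ^ 2

theorem diag_add_diag {s a b : K} (h : a ≠ b) : diag s a b + diag s b a = s - 1 := by
  have h1 := sub_ne_zero.2 h
  have h2 := sub_ne_zero.2 h.symm
  simp only [diag]
  field_simp
  ring

theorem diag_mul_diag_add {s a b : K} (h : a ≠ b) :
    diag s a b * diag s a b + offdiag s a b = (s - 1) * diag s a b + s := by
  have h1 := sub_ne_zero.2 h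
  simp only [diag, offdiag]
  field_simp
  ring

theorem diag_braid_self {s a b c : K} (hab : a ≠ b) (hbc : b ≠ c) (hac : a ≠ c) :
    diag s a b ^ 2 * diag s b c + offdiag s a b * diag s a c =
      diag s b c ^ 2 * diag s a b + offdiag s b c * diag s a c := by
  have h1 := sub_ne_zero.2 hab
  have h2 := sub_ne_zero.2 hbc
  have h3 := sub_ne_zero.2 hac
  simp only [diag, offdiag]
  field_simp
  ring

theorem diag_braid_left {s a b c : K} (hab : a ≠ b) (hbc : b ≠ c) (hac : a ≠ c) :
    diag s a b * diag s b c + diag s a c * diag s b a = diag s b c * diag s a c := by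
  have h1 := sub_ne_zero.2 hab
  have h2 := sub_ne_zero.2 hbc
  have h3 := sub_ne_zero.2 hac
  have h4 := sub_ne_zero.2 hab.symm
  simp only [diag]
  field_simp
  ring

theorem diag_braid_right {s a b c : K} (hab : a ≠ b) (hbc : b ≠ c) (hac : a ≠ c) :
    diag s a b * diag s a c = diag s b c * diag s a b + diag s a c * diag s c b := by
  have h1 := sub_ne_zero.2 hab
  have h2 := sub_ne_zero.2 hbc
  have h3 := sub_ne_zero.2 hac
  have h4 := sub_ne_zero.2 hbc.symm
  simp only [diag]
  field_simp
  ring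

variable {n : ℕ} {L : Type*}

/-- The spectral data of a seminormal representation with basis the orderings `e` of the labels
`L` that satisfy `St`: `z` is the spectral value of a label, and `κ (e i) (e (i + 1))` is the
matrix coefficient from `e` to the ordering with these two labels exchanged. -/
structure IsSeminormal (s : K) (z : L → K) (κ : L → L → K) (St : (Fin (n + 1) ≃ L) → Prop) :
    Prop where
  ne_succ : ∀ e, St e → ∀ i : Fin n, z (e i.castSucc) ≠ z (e i.succ)
  ne_succ_succ : ∀ e, St e → ∀ i j : Fin n, (j : ℕ) = i + 1 → z (e i.castSucc) ≠ z (e j.succ)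
  mul : ∀ e, St e → ∀ i : Fin n, κ (e i.castSucc) (e i.succ) * κ (e i.succ) (e i.castSucc) =
    offdiag s (z (e i.castSucc)) (z (e i.succ))
  step : ∀ e, St e → ∀ i : Fin n, κ (e i.castSucc) (e i.succ) ≠ 0 → St ((adj i).trans e)

open Classical in
/-- The generators of the Hecke algebra in a seminormal representation. On the orderings that
violate `St` they act by the scalar `s`. -/
noncomputable def seminormal (s : K) (z : L → K) (κ : L → L → K) (St : (Fin (n + 1) ≃ L) → Prop)
    (i : Fin n) : ((Fin (n + 1) ≃ L) →₀ K) →ₗ[K] ((Fin (n + 1) ≃ L) →₀ K) :=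
  Finsupp.linearCombination K fun e =>
    if St e then diag s (z (e i.castSucc)) (z (e i.succ)) • Finsupp.single e 1 +
      κ (e i.castSucc) (e i.succ) • Finsupp.single ((adj i).trans e) 1
    else s • Finsupp.single e 1

variable {s : K} {z : L → K} {κ : L → L → K} {St : (Fin (n + 1) ≃ L) → Prop}

theorem seminormal_single {e : Fin (n + 1) ≃ L} (he : St e) (i : Fin n) :
    seminormal s z κ St i (Finsupp.single e 1) =
      diag s (z (e i.castSucc)) (z (e i.succ)) • Finsupp.single e 1 +
      κ (e i.castSucc) (e i.succ) • Finsupp.single ((adj i).trans e) 1 := by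
  rw [seminormal, Finsupp.linearCombination_single, one_smul, if_pos he]

theorem seminormal_single_of_not {e : Fin (n + 1) ≃ L} (he : ¬ St e) (i : Fin n) :
    seminormal s z κ St i (Finsupp.single e 1) = s • Finsupp.single e 1 := by
  rw [seminormal, Finsupp.linearCombination_single, one_smul, if_neg he]

/-- Off-diagonal terms vanish unless the target ordering satisfies `St`, so the formula for the
generators may be used on them. -/
theorem smul_seminormal_single {e : Fin (n + 1) ≃ L} {c : K} (he : c ≠ 0 → St e) (i : Fin n) :
    c • seminormal s z κ St i (Finsupp.single e 1) =
      (c * diag s (z (e i.castSucc)) (z (e i.succ))) • Finsupp.single e 1 +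
      (c * κ (e i.castSucc) (e i.succ)) • Finsupp.single ((adj i).trans e) 1 := by
  by_cases hc : c = 0
  · simp [hc]
  · rw [seminormal_single (he hc), smul_add, smul_smul, smul_smul]

theorem finsupp_ext_single {X V : Type*} [AddCommGroup V] [Module K V] {A B : (X →₀ K) →ₗ[K] V}
    (h : ∀ e, A (Finsupp.single e 1) = B (Finsupp.single e 1)) (f : X →₀ K) : A f = B f := by
  have : A = B := by
    ext e
    exact h e
  rw [this]

theorem seminormal_isHecke (H : IsSeminormal s z κ St) : IsHecke s (seminormal s z κ St) where
  quad i f := by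
    refine finsupp_ext_single (A := seminormal s z κ St i ∘ₗ seminormal s z κ St i)
      (B := (s - 1) • seminormal s z κ St i + s • LinearMap.id) (fun e => ?_) f
    simp only [LinearMap.comp_apply, LinearMap.add_apply, LinearMap.smul_apply, LinearMap.id_apply]
    by_cases he : St e
    · have h1 := H.ne_succ e he i
      have e1 := diag_add_diag (s := s) h1
      have e2 := diag_mul_diag_add (s := s) h1
      have e3 := H.mul e he i
      rw [seminormal_single he, map_add, map_smul, map_smul, seminormal_single he,
        smul_seminormal_single (H.step e he i)]
      simp only [Equiv.trans_apply, adj_castSucc, adj_succ]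
      have e4 : (adj i).trans ((adj i).trans e) = e := by
        ext1 a
        simp [adj_adj]
      rw [e4]
      generalize diag s (z (e i.castSucc)) (z (e i.succ)) = d at *
      generalize diag s (z (e i.succ)) (z (e i.castSucc)) = d' at *
      generalize κ (e i.castSucc) (e i.succ) = k at *
      generalize κ (e i.succ) (e i.castSucc) = k' at *
      linear_combination (norm := module) (k * e1) • (Finsupp.single ((adj i).trans e) (1 : K)) +
        (e2 + e3) • (Finsupp.single e (1 : K))
    · rw [seminormal_single_of_not he, map_smul, seminormal_single_of_not he]
      module
  comm i j hij f := by
    refine finsupp_ext_single (A := seminormal s z κ St i ∘ₗ seminormal s z κ St j)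
      (B := seminormal s z κ St j ∘ₗ seminormal s z κ St i) (fun e => ?_) f
    simp only [LinearMap.comp_apply]
    by_cases he : St e
    · rw [seminormal_single he, seminormal_single he, map_add, map_smul, map_smul, map_add,
        map_smul, map_smul, seminormal_single he, seminormal_single he,
        smul_seminormal_single (H.step e he i), smul_seminormal_single (H.step e he j)]
      simp only [Equiv.trans_apply]
      have a1 : adj i j.castSucc = j.castSucc := by
        rw [adj_of_ne] <;> simp [Fin.ext_iff] <;> omega
      have a2 : adj i j.succ = j.succ := by rw [adj_of_ne] <;> simp [Fin.ext_iff] <;> omega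
      have a3 : adj j i.castSucc = i.castSucc := by
        rw [adj_of_ne] <;> simp [Fin.ext_iff] <;> omega
      have a4 : adj j i.succ = i.succ := by rw [adj_of_ne] <;> simp [Fin.ext_iff] <;> omega
      have a5 : (adj i).trans ((adj j).trans e) = (adj j).trans ((adj i).trans e) := by
        ext1 a
        exact congrArg e (Equiv.congr_fun (adj_comm hij) a).symm
      rw [a1, a2, a3, a4, a5]
      module
    · simp only [seminormal_single_of_not he, map_smul]
  braid i j hij f := by
    refine finsupp_ext_single
      (A := seminormal s z κ St i ∘ₗ seminormal s z κ St j ∘ₗ seminormal s z κ St i)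
      (B := seminormal s z κ St j ∘ₗ seminormal s z κ St i ∘ₗ seminormal s z κ St j)
      (fun e => ?_) f
    simp only [LinearMap.comp_apply]
    by_cases he : St e
    swap
    · simp only [seminormal_single_of_not he, map_smul]
    have hs : j.castSucc = i.succ := Fin.ext (by simp [hij])
    have a1 : adj i j.succ = j.succ := by
      rw [adj_of_ne] <;> simp [Fin.ext_iff] <;> omega
    have a2 : adj j i.castSucc = i.castSucc := by
      rw [adj_of_ne] <;> simp [Fin.ext_iff] <;> omega
    have a3 : adj j i.succ = j.succ := by rw [← hs, adj_castSucc]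
    have a4 : adj j j.succ = i.succ := by rw [adj_succ, hs]
    have hab := H.ne_succ e he i
    have hbc := H.ne_succ e he j
    have hac := H.ne_succ_succ e he i j hij
    have mi := H.mul e he i
    have mj := H.mul e he j
    have st1 := H.step e he i
    have st2 := H.step e he j
    have st12 : κ (e i.castSucc) (e i.succ) * κ (e i.castSucc) (e j.succ) ≠ 0 →
        St ((adj j).trans ((adj i).trans e)) := fun h => by
      refine H.step _ (st1 (left_ne_zero_of_mul h)) j ?_
      simpa [hs, a1] using right_ne_zero_of_mul h
    have st21 : κ (e i.succ) (e j.succ) * κ (e i.castSucc) (e j.succ) ≠ 0 →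
        St ((adj i).trans ((adj j).trans e)) := fun h => by
      refine H.step _ (st2 (hs ▸ left_ne_zero_of_mul h)) i ?_
      simpa [a2, a3] using right_ne_zero_of_mul h
    have t0i := seminormal_single (s := s) (z := z) (κ := κ) he i
    have t0j := seminormal_single (s := s) (z := z) (κ := κ) he j
    have t1i := smul_seminormal_single (s := s) (z := z) (κ := κ) st1 i
    have t1j := smul_seminormal_single (s := s) (z := z) (κ := κ) st1 j
    have t2i := smul_seminormal_single (s := s) (z := z) (κ := κ) st2 i
    have t2j := smul_seminormal_single (s := s) (z := z) (κ := κ) st2 j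
    have t12 := smul_seminormal_single (s := s) (z := z) (κ := κ) st12 i
    have t21 := smul_seminormal_single (s := s) (z := z) (κ := κ) st21 j
    have ei : (adj i).trans ((adj i).trans e) = e := by
      ext1 a
      simp [adj_adj]
    have ej : (adj j).trans ((adj j).trans e) = e := by
      ext1 a
      simp [adj_adj]
    have eij : (adj j).trans ((adj i).trans ((adj j).trans e)) =
        (adj i).trans ((adj j).trans ((adj i).trans e)) := by
      ext1 a
      exact congrArg e (Equiv.congr_fun (adj_braid hij) a).symm
    simp only [Equiv.trans_apply, adj_castSucc, adj_succ, hs, a1, a2, a3, a4, ei, ej, eij] at *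
    have q0 := diag_braid_self (s := s) hab hbc hac
    have q1 := diag_braid_left (s := s) hab hbc hac
    have q2 := diag_braid_right (s := s) hab hbc hac
    rw [← mi, ← mj] at q0
    clear mi mj hab hbc hac st1 st2 st12 st21 ei ej eij
    have u1 := congrArg (seminormal s z κ St i) t1j
    have u2 := congrArg (seminormal s z κ St j) t2i
    simp only [map_add, map_smul] at u1 u2
    rw [t0i, t0j]
    simp only [map_add, map_smul]
    rw [t0i, t0j, u1, u2]
    simp only [map_add, map_smul]
    rw [t0i, t0j, t12, t21]
    linear_combination (norm := module) (diag s (z (e i.castSucc)) (z (e i.succ))) • t2i +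
      (diag s (z (e i.castSucc)) (z (e j.succ))) • t1i -
      (diag s (z (e i.succ)) (z (e j.succ))) • t1j -
      (diag s (z (e i.castSucc)) (z (e j.succ))) • t2j + q0 • Finsupp.single e (1 : K) +
      (κ (e i.castSucc) (e i.succ) * q1) • Finsupp.single ((adj i).trans e) (1 : K) +
      (κ (e i.succ) (e j.succ) * q2) • Finsupp.single ((adj j).trans e) (1 : K)

end Seminormal

/-! ### Orderings that respect the blocks -/

section Blocks

variable {n : ℕ} {B : Type*} [LinearOrder B] {blk : Fin (n + 1) → B}

/-- In the word `π 0, π 1, …` the elements of each block occur in increasing order. -/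
def InOrder (blk : Fin (n + 1) → B) (π : Equiv.Perm (Fin (n + 1))) : Prop :=
  ∀ a b, a < b → blk a = blk b → π⁻¹ a < π⁻¹ b

/-- In the word `π 0, π 1, …` the elements of each block occur in increasing order, and the blocks
occur in decreasing order. -/
def IsTop (blk : Fin (n + 1) → B) (π : Equiv.Perm (Fin (n + 1))) : Prop :=
  InOrder blk π ∧ ∀ a b, a < b → blk a ≠ blk b → π⁻¹ b < π⁻¹ a

theorem perm_inv_apply_self {α : Type*} (π : Equiv.Perm α) (a : α) : π⁻¹ (π a) = a :=
  π.symm_apply_apply a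

theorem perm_apply_inv_self {α : Type*} (π : Equiv.Perm α) (a : α) : π (π⁻¹ a) = a :=
  π.apply_symm_apply a

theorem inOrder_one : InOrder blk 1 := fun _ _ h _ => h

theorem InOrder.mul_adj {π : Equiv.Perm (Fin (n + 1))} (hπ : InOrder blk π) {i : Fin n}
    (h : blk (π i.castSucc) ≠ blk (π i.succ)) : InOrder blk (π * adj i) := by
  intro a b hab he
  rw [mul_inv_rev, adj_inv, Equiv.Perm.mul_apply, Equiv.Perm.mul_apply]
  refine adj_lt_adj (hπ a b hab he) ?_
  rintro ⟨h1, h2⟩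
  apply h
  rw [← h1, ← h2]
  simpa using he

theorem InOrder.lt_of_blk_eq {π : Equiv.Perm (Fin (n + 1))} (hπ : InOrder blk π)
    {j k : Fin (n + 1)} (hjk : j < k) (h : blk (π j) = blk (π k)) : π j < π k := by
  by_contra hc
  have h1 := hπ _ _ (lt_of_le_of_ne (not_lt.1 hc) fun e => hjk.ne (π.injective e).symm) h.symm
  simp only [perm_inv_apply_self] at h1
  exact absurd h1 hjk.not_gt

/-- Neighbours of the same block in a word that is in order are consecutive numbers: since the blocks
are intervals, a number between them would have to stand between them in the word. -/
theorem InOrder.succ_eq (hb : Monotone blk) {π : Equiv.Perm (Fin (n + 1))} (hπ : InOrder blk π)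
    {i : Fin n} (h : blk (π i.castSucc) = blk (π i.succ)) :
    (π i.succ : ℕ) = π i.castSucc + 1 := by
  have h1 : π i.castSucc < π i.succ := hπ.lt_of_blk_eq Fin.castSucc_lt_succ h
  by_contra hc
  have h2 : (π i.castSucc : ℕ) + 1 < π i.succ := by
    have := Fin.lt_def.1 h1
    omega
  let c : Fin (n + 1) := ⟨π i.castSucc + 1, by omega⟩
  have c1 : π i.castSucc < c := Fin.lt_def.2 (Nat.lt_succ_self _)
  have c2 : c < π i.succ := Fin.lt_def.2 h2
  have e1 : blk (π i.castSucc) = blk c := le_antisymm (hb c1.le) (h ▸ hb c2.le)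
  have l1 := hπ _ _ c1 e1
  have l2 := hπ _ _ c2 (e1.symm.trans h)
  rw [perm_inv_apply_self] at l1 l2
  rw [Fin.lt_def] at l1 l2
  simp at l1 l2
  omega

/-- A permutation is determined by its inversions. -/
theorem inv_injective {σ τ : Equiv.Perm (Fin (n + 1))} (h : inv σ = inv τ) : σ = τ := by
  have key : ∀ a b, a < b → (σ b < σ a ↔ τ b < τ a) := fun a b hab => by
    have := Finset.ext_iff.1 h (a, b)
    rw [mem_inv, mem_inv] at this
    simpa [hab] using this
  have hm : StrictMono (σ * τ⁻¹) := by
    intro a b hab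
    simp only [Equiv.Perm.mul_apply]
    have ne : τ⁻¹ a ≠ τ⁻¹ b := fun e => hab.ne (τ⁻¹.injective e)
    rcases lt_or_gt_of_ne ne with h1 | h1
    · have := (key _ _ h1).not.2 (by simpa using hab.le)
      exact lt_of_le_of_ne (not_lt.1 this) (fun e => ne (σ.injective e))
    · exact (key _ _ h1).2 (by simpa using hab)
  exact mul_inv_eq_one.1 (eq_one_of_strictMono hm)

theorem IsTop.mem_inv {π : Equiv.Perm (Fin (n + 1))} (hπ : IsTop blk π)
    {p : Fin (n + 1) × Fin (n + 1)} : p ∈ inv π⁻¹ ↔ p.1 < p.2 ∧ blk p.1 ≠ blk p.2 := by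
  rw [VVMac.mem_inv]
  refine and_congr_right fun h => ⟨fun h1 h2 => ?_, fun h1 => hπ.2 _ _ h h1⟩
  exact absurd (hπ.1 _ _ h h2) h1.not_gt

theorem IsTop.unique {π ρ : Equiv.Perm (Fin (n + 1))} (hπ : IsTop blk π) (hρ : IsTop blk ρ) :
    π = ρ := by
  apply inv_inj.1
  apply inv_injective
  ext p
  rw [hπ.mem_inv, hρ.mem_inv]

/-- A word without ascents between different blocks lists the blocks in decreasing order. -/
theorem InOrder.isTop (hb : Monotone blk) {π : Equiv.Perm (Fin (n + 1))} (hπ : InOrder blk π)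
    (h : ∀ i : Fin n, blk (π i.castSucc) ≠ blk (π i.succ) → ¬ π i.castSucc < π i.succ) :
    IsTop blk π := by
  refine ⟨hπ, fun a b hab hne => ?_⟩
  have anti : Antitone (blk ∘ π) := by
    rw [Fin.antitone_iff_succ_le]
    intro i
    by_cases he : blk (π i.castSucc) = blk (π i.succ)
    · exact he.ge
    · exact hb (not_lt.1 (h i he))
  by_contra hc
  have h1 := anti (not_lt.1 hc)
  simp only [Function.comp_apply, perm_apply_inv_self] at h1
  exact hne (le_antisymm (hb hab.le) h1)

theorem IsTop.not_lt {π : Equiv.Perm (Fin (n + 1))} (hπ : IsTop blk π)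
    (i : Fin n) (hne : blk (π i.castSucc) ≠ blk (π i.succ)) : ¬ π i.castSucc < π i.succ := by
  intro h
  have := hπ.2 _ _ h hne
  simp only [perm_inv_apply_self] at this
  exact absurd this Fin.castSucc_lt_succ.not_gt

theorem exists_isTop (blk : Fin (n + 1) → B) (hb : Monotone blk) : ∃ ρ, IsTop blk ρ := by
  classical
  obtain ⟨ρ, hρ, hmax⟩ := Finset.exists_max_image
    (Finset.univ.filter fun π : Equiv.Perm (Fin (n + 1)) => InOrder blk π) ell
    ⟨1, by simpa using inOrder_one⟩
  have hρ' : InOrder blk ρ := (Finset.mem_filter.1 hρ).2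
  refine ⟨ρ, hρ'.isTop hb fun i hi hlt => ?_⟩
  have h1 := hmax (ρ * adj i) (by simpa using hρ'.mul_adj hi)
  rw [ell_mul_adj_of_lt hlt] at h1
  omega

theorem InOrder.eq_one {π : Equiv.Perm (Fin (n + 1))} (hπ : InOrder blk π)
    (h : ∀ i : Fin n, blk (π i.castSucc) ≠ blk (π i.succ) → ¬ π i.succ < π i.castSucc) :
    π = 1 := by
  refine eq_one_of_forall_lt fun i => ?_
  by_cases he : blk (π i.castSucc) = blk (π i.succ)
  · exact hπ.lt_of_blk_eq Fin.castSucc_lt_succ he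
  · exact (lt_or_gt_adj π i).resolve_right (h i he)

end Blocks

/-! ### The formal model of a component and its symmetric vector -/

section Model

variable {K : Type*} [Field K] {n : ℕ} {B : Type*} [LinearOrder B]

/-- The off-diagonal coefficients of the formal model: an arrow has coefficient `1`, and elements
of the same block are not exchanged. -/
def modelCoef (s : K) (z : Fin (n + 1) → K) (blk : Fin (n + 1) → B) (a b : Fin (n + 1)) : K :=
  if blk a = blk b then 0 else if b < a then 1 else offdiag s (z a) (z b)

/-- The assumptions on the spectral values `z`: they are distinct, consecutive elements of the same
block have ratio `s`, and this ratio does not occur between different blocks. -/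
structure IsSpectrum (s : K) (z : Fin (n + 1) → K) (blk : Fin (n + 1) → B) : Prop where
  mono : Monotone blk
  inj : Function.Injective z
  ratio : ∀ i : Fin n, blk i.castSucc = blk i.succ → z i.castSucc = s * z i.succ
  generic : ∀ a b, blk a ≠ blk b → s * z a ≠ z b

variable {s : K} {z : Fin (n + 1) → K} {blk : Fin (n + 1) → B}

theorem InOrder.ratio_of_blk_eq (H : IsSpectrum s z blk) {π : Equiv.Perm (Fin (n + 1))}
    (hπ : InOrder blk π) {i : Fin n} (h : blk (π i.castSucc) = blk (π i.succ)) :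
    z (π i.castSucc) = s * z (π i.succ) := by
  have h1 := hπ.succ_eq H.mono h
  have hlt : (π i.castSucc : ℕ) < n := by
    have := (π i.succ).isLt
    omega
  have e1 : π i.castSucc = (⟨π i.castSucc, hlt⟩ : Fin n).castSucc := rfl
  have e2 : π i.succ = (⟨π i.castSucc, hlt⟩ : Fin n).succ := Fin.ext h1
  rw [e1, e2] at h ⊢
  exact H.ratio _ h

theorem InOrder.diag_of_blk_eq (H : IsSpectrum s z blk) {π : Equiv.Perm (Fin (n + 1))}
    (hπ : InOrder blk π) {i : Fin n} (h : blk (π i.castSucc) = blk (π i.succ)) :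
    diag s (z (π i.castSucc)) (z (π i.succ)) = s := by
  have h1 := sub_ne_zero.2 (H.inj.ne (π.injective.ne (Fin.castSucc_lt_succ (i := i)).ne))
  have h2 := hπ.ratio_of_blk_eq H h
  rw [diag, div_eq_iff h1]
  rw [h2]
  ring

theorem isSeminormal_model (H : IsSpectrum s z blk) :
    IsSeminormal s z (modelCoef s z blk) (InOrder blk) where
  ne_succ e _ i := H.inj.ne (e.injective.ne Fin.castSucc_lt_succ.ne)
  ne_succ_succ e _ i j hij := by
    refine H.inj.ne (e.injective.ne ?_)
    simp [Fin.ext_iff, hij]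
    omega
  mul e he i := by
    by_cases h : blk (e i.castSucc) = blk (e i.succ)
    · rw [modelCoef, if_pos h, zero_mul, offdiag, InOrder.ratio_of_blk_eq H he h]
      simp
    · rw [modelCoef, modelCoef, if_neg h, if_neg (Ne.symm h)]
      rcases lt_or_gt_adj e i with h1 | h1
      · rw [if_neg h1.not_gt, if_pos h1, mul_one]
      · rw [if_pos h1, if_neg h1.not_gt, one_mul]
        unfold offdiag
        rw [← neg_sub (z (e i.castSucc)) (z (e i.succ)), neg_sq]
        ring
  step e he i h := by
    refine InOrder.mul_adj he fun h1 => h ?_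
    rw [modelCoef, if_pos h1]

/-- The generators of the Hecke algebra in the formal model of a component. -/
noncomputable def model (s : K) (z : Fin (n + 1) → K) (blk : Fin (n + 1) → B) (i : Fin n) :
    (Equiv.Perm (Fin (n + 1)) →₀ K) →ₗ[K] (Equiv.Perm (Fin (n + 1)) →₀ K) :=
  seminormal s z (modelCoef s z blk) (InOrder blk) i

theorem model_isHecke (H : IsSpectrum s z blk) : IsHecke s (model s z blk) :=
  seminormal_isHecke (isSeminormal_model H)

theorem model_single {π : Equiv.Perm (Fin (n + 1))} (hπ : InOrder blk π) (i : Fin n) :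
    model s z blk i (Finsupp.single π 1) =
      diag s (z (π i.castSucc)) (z (π i.succ)) • Finsupp.single π 1 +
      modelCoef s z blk (π i.castSucc) (π i.succ) • Finsupp.single (π * adj i) 1 :=
  seminormal_single hπ i

theorem eq_sum_single {X : Type*} [Fintype X] (u : X →₀ K) :
    u = ∑ x, u x • Finsupp.single x (1 : K) := by
  classical
  ext y
  simp

theorem model_apply {u : Equiv.Perm (Fin (n + 1)) →₀ K} (hu : ∀ π, u π ≠ 0 → InOrder blk π)
    (i : Fin n) (π : Equiv.Perm (Fin (n + 1))) :
    model s z blk i u π = diag s (z (π i.castSucc)) (z (π i.succ)) * u π +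
      modelCoef s z blk (π i.succ) (π i.castSucc) * u (π * adj i) := by
  have h : model s z blk i u = ∑ τ, u τ •
      (diag s (z (τ i.castSucc)) (z (τ i.succ)) • Finsupp.single τ (1 : K) +
      modelCoef s z blk (τ i.castSucc) (τ i.succ) • Finsupp.single (τ * adj i) 1) := by
    conv_lhs => rw [eq_sum_single u]
    rw [map_sum]
    refine Finset.sum_congr rfl fun τ _ => ?_
    rw [map_smul]
    by_cases hτ : u τ = 0
    · rw [hτ, zero_smul, zero_smul]
    · rw [model_single (hu τ hτ)]
  have e : ∀ τ : Equiv.Perm (Fin (n + 1)), τ * adj i = π ↔ τ = π * adj i := fun τ =>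
    ⟨fun h => by rw [← h, mul_adj_adj], fun h => by rw [h, mul_adj_adj]⟩
  rw [h, Finsupp.finsetSum_apply]
  simp only [smul_add, Finsupp.add_apply, Finsupp.smul_apply, Finsupp.single_apply, smul_eq_mul,
    Finset.sum_add_distrib, e, mul_ite, mul_one, mul_zero, Finset.sum_ite_eq', Finset.mem_univ,
    if_true, Equiv.Perm.mul_apply, adj_castSucc, adj_succ]
  ring

theorem model_support {u : Equiv.Perm (Fin (n + 1)) →₀ K} (hu : ∀ π, u π ≠ 0 → InOrder blk π)
    (i : Fin n) (π : Equiv.Perm (Fin (n + 1))) (h : model s z blk i u π ≠ 0) : InOrder blk π := by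
  rw [model_apply hu] at h
  by_cases h1 : u π = 0
  · rw [h1, mul_zero, zero_add] at h
    have h2 := hu _ (right_ne_zero_of_mul h)
    have h3 := left_ne_zero_of_mul h
    rw [← mul_adj_adj π i]
    refine h2.mul_adj fun he => h3 ?_
    simp only [Equiv.Perm.mul_apply, adj_castSucc, adj_succ] at he
    rw [modelCoef, if_pos he]
  · exact hu π h1

/-- The orderings that occur in the image of `ρ` under a word of length `k` are in order and shorter
than `ρ` by at most `k`. -/
theorem wordOp_model_support {ρ : Equiv.Perm (Fin (n + 1))} (hρ : InOrder blk ρ)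
    (l : List (Fin n)) : ∀ π, wordOp (model s z blk) l (Finsupp.single ρ 1) π ≠ 0 →
      InOrder blk π ∧ ell ρ ≤ ell π + l.length := by
  induction l using List.reverseRecOn with
  | nil =>
    intro π h
    rw [wordOp_nil, Finsupp.single_apply] at h
    obtain rfl : ρ = π := by
      by_contra hc
      simp [hc] at h
    exact ⟨hρ, by simp⟩
  | append_singleton l i ih =>
    intro π h
    rw [wordOp_concat] at h
    have hu := fun π h => (ih π h).1
    refine ⟨model_support hu i π h, ?_⟩
    rw [List.length_append, List.length_singleton]
    rw [model_apply hu] at h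
    by_cases h1 : wordOp (model s z blk) l (Finsupp.single ρ 1) π = 0
    · rw [h1, mul_zero, zero_add] at h
      have h2 := (ih _ (right_ne_zero_of_mul h)).2
      have h3 := ell_mul_adj_le π i
      omega
    · have := (ih π h1).2
      omega

theorem ell_le_ell_mul_wordPerm (σ : Equiv.Perm (Fin (n + 1))) (l : List (Fin n)) :
    ell σ ≤ ell (σ * wordPerm l) + l.length := by
  induction l using List.reverseRecOn with
  | nil => simp [wordPerm]
  | append_singleton l i ih =>
    rw [wordPerm_concat, List.length_append, List.length_singleton, ← mul_assoc]
    have := ell_le_ell_mul_adj (σ * wordPerm l) i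
    omega

/-- Along a directed path the new ordering occurs with coefficient `1`. -/
theorem wordOp_model_apply_eq_one {ρ : Equiv.Perm (Fin (n + 1))} (hρ : InOrder blk ρ)
    (l : List (Fin n)) (hl : ell (ρ * wordPerm l) + l.length = ell ρ) :
    InOrder blk (ρ * wordPerm l) ∧
      wordOp (model s z blk) l (Finsupp.single ρ 1) (ρ * wordPerm l) = 1 := by
  induction l using List.reverseRecOn with
  | nil => simpa [wordPerm, wordOp_nil] using hρ
  | append_singleton l i ih =>
    rw [wordPerm_concat, List.length_append, List.length_singleton, ← mul_assoc] at hl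
    rw [wordPerm_concat, ← mul_assoc, wordOp_concat]
    have h1 := ell_le_ell_mul_wordPerm ρ l
    have h2 := ell_le_ell_mul_adj (ρ * wordPerm l) i
    obtain ⟨h3, h4⟩ := ih (by omega)
    set π := ρ * wordPerm l
    have h5 : π i.succ < π i.castSucc := by
      refine (lt_or_gt_adj π i).resolve_left fun h => ?_
      have := ell_mul_adj_of_lt h
      omega
    have h6 : blk (π i.castSucc) ≠ blk (π i.succ) := fun h =>
      absurd (h3.lt_of_blk_eq Fin.castSucc_lt_succ h) h5.not_gt
    refine ⟨h3.mul_adj h6, ?_⟩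
    have h7 : wordOp (model s z blk) l (Finsupp.single ρ 1) (π * adj i) = 0 := by
      by_contra hc
      have := (wordOp_model_support hρ l _ hc).2
      omega
    rw [model_apply fun π h => (wordOp_model_support hρ l π h).1, h7, mul_adj_adj, h4]
    simp only [Equiv.Perm.mul_apply π, adj_castSucc, adj_succ]
    rw [modelCoef, if_neg h6, if_pos h5]
    ring

theorem lt_of_forall_blk_succ (hb : Monotone blk) {σ : Equiv.Perm (Fin (n + 1))}
    (h : ∀ i : Fin n, blk i.castSucc = blk i.succ → σ i.castSucc < σ i.succ) {a b : Fin (n + 1)}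
    (hab : a < b) (he : blk a = blk b) : σ a < σ b := by
  induction b using Fin.induction with
  | zero => exact absurd hab (Fin.not_lt_zero a)
  | succ i ih =>
    have h1 : a ≤ i.castSucc := Fin.le_castSucc_iff.2 hab
    have h2 : blk i.castSucc = blk i.succ :=
      le_antisymm (hb Fin.castSucc_lt_succ.le) (he ▸ hb h1)
    rcases h1.lt_or_eq with h3 | h3
    · exact (ih h3 (he.trans h2.symm)).trans (h i h2)
    · rw [h3]
      exact h i h2

/-- The coefficient of the sink in the image of the root under `𝐓_σ`. A descent of `σ` inside a block
contributes a factor `s`; if there is none, `σ` has to be `ρ⁻¹` for the sink to be reached. -/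
theorem wordOp_model_apply_one (H : IsSpectrum s z blk) {ρ : Equiv.Perm (Fin (n + 1))}
    (hρ : IsTop blk ρ) (σ : Equiv.Perm (Fin (n + 1))) [Decidable (∀ k, blk ((ρ * σ) k) = blk k)] :
    wordOp (model s z blk) (reducedWord σ) (Finsupp.single ρ 1) 1 =
      if ∀ k, blk ((ρ * σ) k) = blk k then s ^ ell (ρ * σ) else 0 := by
  induction hm : ell σ using Nat.strong_induction_on generalizing σ with
  | _ m ih =>
  by_cases hd : ∃ i : Fin n, blk i.castSucc = blk i.succ ∧ σ i.succ < σ i.castSucc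
  · obtain ⟨i, hi, hσ⟩ := hd
    have h1 := ell_eq_of_gt hσ
    classical
    have h2 := ih _ (by omega) (σ * adj i) rfl
    have h3 : wordOp (model s z blk) (reducedWord σ) (Finsupp.single ρ 1) =
        model s z blk i (wordOp (model s z blk) (reducedWord (σ * adj i))
          (Finsupp.single ρ 1)) := by
      rw [← wordOp_reducedWord_mul_adj (model_isHecke H) (by simpa using hσ), mul_adj_adj]
    have h4 : diag s (z i.castSucc) (z i.succ) = s :=
      InOrder.diag_of_blk_eq H (π := 1) inOrder_one hi
    have h5 : ∀ k, blk (adj i k) = blk k := fun k => by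
      by_cases k1 : k = i.castSucc
      · rw [k1, adj_castSucc, hi]
      · by_cases k2 : k = i.succ
        · rw [k2, adj_succ, hi]
        · rw [adj_of_ne k1 k2]
    have h6 : (∀ k, blk ((ρ * (σ * adj i)) k) = blk k) ↔ ∀ k, blk ((ρ * σ) k) = blk k := by
      constructor
      · intro h k
        have := h (adj i k)
        rwa [h5, ← mul_assoc, Equiv.Perm.mul_apply _ (adj i), adj_adj] at this
      · intro h k
        rw [← mul_assoc, Equiv.Perm.mul_apply _ (adj i), h, h5]
    rw [h3, model_apply fun π h => (wordOp_model_support hρ.1 _ π h).1, Equiv.Perm.one_apply,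
      Equiv.Perm.one_apply, h4, modelCoef, if_pos hi.symm, zero_mul, add_zero, h2]
    by_cases hτ : ∀ k, blk ((ρ * σ) k) = blk k
    · rw [if_pos (h6.2 hτ), if_pos hτ]
      have h7 : (ρ * σ) i.succ < (ρ * σ) i.castSucc := by
        refine (lt_or_gt_adj _ i).resolve_left fun h => ?_
        have := hρ.1 _ _ h (by rw [hτ, hτ, hi])
        simp only [Equiv.Perm.mul_apply, perm_inv_apply_self] at this
        exact absurd this hσ.not_gt
      rw [ell_eq_of_gt h7, mul_assoc, pow_succ, mul_comm]
    · rw [if_neg (fun h => hτ (h6.1 h)), if_neg hτ, mul_zero]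
  -- Without descents inside the blocks, every inversion of `σ` is an inversion of `ρ⁻¹`, so `σ` is
  -- too short to lead from `ρ` to the identity unless it is equal to `ρ⁻¹`.
  · have hinc : ∀ a b, a < b → blk a = blk b → σ a < σ b := fun a b hab he =>
      lt_of_forall_blk_succ H.mono (fun i hi => (lt_or_gt_adj σ i).resolve_right
        fun h => hd ⟨i, hi, h⟩) hab he
    by_cases hσ : σ = ρ⁻¹
    · have h1 := wordOp_model_apply_eq_one (s := s) (z := z) hρ.1 (reducedWord σ) (by
        rw [wordPerm_reducedWord, length_reducedWord, hσ, mul_inv_cancel, ell_one, ell_inv,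
          zero_add])
      rw [wordPerm_reducedWord, hσ, mul_inv_cancel] at h1
      subst hσ
      rw [h1.2, if_pos (fun k => by simp), mul_inv_cancel, ell_one, pow_zero]
    · rw [if_neg]
      · by_contra hc
        have h1 := (wordOp_model_support hρ.1 _ _ hc).2
        rw [ell_one, length_reducedWord, zero_add, ← ell_inv, ell_eq_card_inv,
          ell_eq_card_inv] at h1
        have h2 : inv σ ⊆ inv ρ⁻¹ := fun p hp => by
          rw [hρ.mem_inv]
          obtain ⟨p1, p2⟩ := VVMac.mem_inv.1 hp
          exact ⟨p1, fun he => absurd (hinc _ _ p1 he) p2.not_gt⟩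
        exact hσ (inv_injective (Finset.eq_of_subset_of_card_le h2 h1))
      · intro hτ
        apply hσ
        have : ρ * σ = 1 := by
          refine eq_one_of_strictMono fun a b hab => ?_
          by_cases he : blk a = blk b
          · by_contra hc
            have hne : (ρ * σ) b ≠ (ρ * σ) a := fun e => hab.ne' ((ρ * σ).injective e)
            have := hρ.1 _ _ (lt_of_le_of_ne (not_lt.1 hc) hne) (by rw [hτ, hτ, he])
            simp only [Equiv.Perm.mul_apply, perm_inv_apply_self] at this
            exact absurd this (hinc a b hab he).not_gt
          · have h1 : blk ((ρ * σ) a) < blk ((ρ * σ) b) := by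
              rw [hτ, hτ]
              exact lt_of_le_of_ne (H.mono hab.le) he
            exact H.mono.reflect_lt h1
        exact eq_inv_of_mul_eq_one_right this

theorem modelCoef_of_lt {a b : Fin (n + 1)} (h : blk a ≠ blk b) (hab : b < a) :
    modelCoef s z blk a b = 1 := by rw [modelCoef, if_neg h, if_pos hab]

/-- A family of vectors that transforms along the arrows as the Macdonald polynomials do is the
image of the formal model: the transformation rule against the arrows follows from the quadratic
relation. -/
theorem apply_family {M : Type*} [AddCommGroup M] [Module K M] {A : Fin n → M →ₗ[K] M}
    (H : IsSpectrum s z blk) (quad : ∀ i f, A i (A i f) = (s - 1) • A i f + s • f)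
    {P : Equiv.Perm (Fin (n + 1)) → M}
    (hsame : ∀ π i, InOrder blk π → blk (π i.castSucc) = blk (π i.succ) →
      A i (P π) = s • P π)
    (harrow : ∀ π i, InOrder blk π → blk (π i.castSucc) ≠ blk (π i.succ) →
      π i.succ < π i.castSucc →
      A i (P π) = diag s (z (π i.castSucc)) (z (π i.succ)) • P π + P (π * adj i))
    {π : Equiv.Perm (Fin (n + 1))} (hπ : InOrder blk π) (i : Fin n) :
    A i (P π) = diag s (z (π i.castSucc)) (z (π i.succ)) • P π +
      modelCoef s z blk (π i.castSucc) (π i.succ) • P (π * adj i) := by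
  by_cases h : blk (π i.castSucc) = blk (π i.succ)
  · rw [hsame π i hπ h, hπ.diag_of_blk_eq H h, modelCoef, if_pos h, zero_smul, add_zero]
  · rcases lt_or_gt_adj π i with h1 | h1
    · have h2 := harrow (π * adj i) i (hπ.mul_adj h) (by simpa using Ne.symm h) (by simpa using h1)
      simp only [mul_adj_adj, Equiv.Perm.mul_apply π, adj_castSucc, adj_succ] at h2
      have hne := H.inj.ne (π.injective.ne (Fin.castSucc_lt_succ (i := i)).ne)
      have e1 := diag_add_diag (s := s) hne
      have e2 := diag_mul_diag_add (s := s) hne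
      have h3 := quad i (P (π * adj i))
      rw [h2, map_add, map_smul, h2] at h3
      rw [modelCoef, if_neg h, if_neg h1.not_gt]
      generalize diag s (z (π i.castSucc)) (z (π i.succ)) = d at *
      obtain rfl : d = s - 1 - diag s (z (π i.succ)) (z (π i.castSucc)) := by
        linear_combination e1
      linear_combination (norm := module) h3 - e2 • P (π * adj i)
    · rw [harrow π i hπ h h1, modelCoef_of_lt h h1, one_smul]

/-- The symmetrization of the polynomial at the root of a component, expanded over the vertices of
the component. -/
theorem exists_expansion {M : Type*} [AddCommGroup M] [Module K M] {A : Fin n → M →ₗ[K] M}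
    (H : IsSpectrum s z blk) (quad : ∀ i f, A i (A i f) = (s - 1) • A i f + s • f)
    {P : Equiv.Perm (Fin (n + 1)) → M}
    (hsame : ∀ π i, InOrder blk π → blk (π i.castSucc) = blk (π i.succ) →
      A i (P π) = s • P π)
    (harrow : ∀ π i, InOrder blk π → blk (π i.castSucc) ≠ blk (π i.succ) →
      π i.succ < π i.castSucc →
      A i (P π) = diag s (z (π i.castSucc)) (z (π i.succ)) • P π + P (π * adj i))
    {ρ : Equiv.Perm (Fin (n + 1))} (hρ : IsTop blk ρ)
    [DecidablePred fun τ : Equiv.Perm (Fin (n + 1)) => ∀ k, blk (τ k) = blk k] :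
    ∃ X : Equiv.Perm (Fin (n + 1)) → K,
      X 1 = ∑ τ with ∀ k, blk (τ k) = blk k, s ^ ell τ ∧
      (∀ π i, InOrder blk π → blk (π i.castSucc) ≠ blk (π i.succ) → π i.succ < π i.castSucc →
        X (π * adj i) = (z (π i.castSucc) - z (π i.succ)) /
          (s * z (π i.castSucc) - z (π i.succ)) * X π) ∧
      (∀ π, ¬ InOrder blk π → X π = 0) ∧
      ∑ σ, wordOp A (reducedWord σ) (P ρ) = ∑ π, X π • P π := by
  let X := ∑ σ, wordOp (model s z blk) (reducedWord σ) (Finsupp.single ρ 1)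
  have hX : ∀ π, X π ≠ 0 → InOrder blk π := by
    intro π h
    rw [Finsupp.finsetSum_apply] at h
    obtain ⟨σ, -, hσ⟩ := Finset.exists_ne_zero_of_sum_ne_zero h
    exact (wordOp_model_support hρ.1 _ π hσ).1
  refine ⟨X, ?_, ?_, fun π hπ => by_contra fun h => hπ (hX π h), ?_⟩
  · rw [Finsupp.finsetSum_apply]
    have : ∀ σ ∈ Finset.univ, wordOp (model s z blk) (reducedWord σ) (Finsupp.single ρ 1) 1 =
        if ∀ k, blk ((ρ * σ) k) = blk k then s ^ ell (ρ * σ) else 0 := fun σ _ =>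
      wordOp_model_apply_one H hρ σ
    rw [Finset.sum_congr rfl this, Finset.sum_filter]
    exact Fintype.sum_equiv (Equiv.mulLeft ρ) _ _ fun σ => rfl
  -- The rule along the arrows is the coefficient at the target of the equation `X 𝐓_i = s X`.
  · intro π i hπ hne hlt
    have h1 := DFunLike.congr_fun
      (apply_sum_wordOp (model_isHecke H) i (Finsupp.single ρ 1)) (π * adj i)
    change model s z blk i X (π * adj i) = s * X (π * adj i) at h1
    rw [model_apply hX, mul_adj_adj] at h1
    simp only [Equiv.Perm.mul_apply π, adj_castSucc, adj_succ] at h1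
    rw [modelCoef_of_lt hne hlt, diag] at h1
    have n1 := sub_ne_zero.2 (H.inj.ne (π.injective.ne (Fin.castSucc_lt_succ (i := i)).ne'))
    have n2 := sub_ne_zero.2 (H.generic _ _ hne)
    rw [div_mul_eq_mul_div, eq_div_iff n2]
    field_simp at h1
    linear_combination h1
  · let Θ := Finsupp.linearCombination K P
    have hΘ : ∀ u : Equiv.Perm (Fin (n + 1)) →₀ K, Θ u = ∑ π, u π • P π := fun u => by
      rw [Finsupp.linearCombination_apply]
      exact Finsupp.sum_fintype _ _ fun π => zero_smul K _
    have equiv : ∀ (u : Equiv.Perm (Fin (n + 1)) →₀ K), (∀ π, u π ≠ 0 → InOrder blk π) → ∀ i,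
        Θ (model s z blk i u) = A i (Θ u) := by
      intro u hu i
      conv_lhs => rw [eq_sum_single u]
      rw [hΘ u, map_sum, map_sum, map_sum]
      refine Finset.sum_congr rfl fun π _ => ?_
      by_cases hπ : u π = 0
      · simp [hπ]
      · rw [map_smul, map_smul, map_smul, model_single (hu π hπ), map_add, map_smul, map_smul,
          apply_family H quad hsame harrow (hu π hπ)]
        simp [Θ]
    have hword : ∀ l : List (Fin n), Θ (wordOp (model s z blk) l (Finsupp.single ρ 1)) =
        wordOp A l (P ρ) := by
      intro l
      induction l using List.reverseRecOn with
      | nil => simp [wordOp_nil, Θ]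
      | append_singleton l i ih =>
        rw [wordOp_concat, wordOp_concat, ← ih,
          equiv _ fun π h => (wordOp_model_support hρ.1 l π h).1]
    rw [← hΘ X, map_sum]
    exact Finset.sum_congr rfl fun σ _ => (hword _).symm

end Model

/-! ### Consecutive entries of reverse standard tableaux -/

section Tableaux

variable {n : ℕ} {μ : YoungDiagram}

theorem exists_entry (t : RST n μ) {r c : ℕ} (h : (r, c) ∈ μ) :
    ∃ k, t.row k = r ∧ t.col k = c :=
  ⟨t.1.symm ⟨(r, c), h⟩, by simp [RST.row], by simp [RST.col]⟩

theorem entry_mem (t : RST n μ) (k : Fin (n + 1)) : (t.row k, t.col k) ∈ μ := (t.1 k).2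

theorem entry_ext (t : RST n μ) {a b : Fin (n + 1)} (h1 : t.row a = t.row b)
    (h2 : t.col a = t.col b) : a = b :=
  t.1.injective (Subtype.ext (Prod.ext h1 h2))

theorem entry_lt_of_row (t : RST n μ) {a b : Fin (n + 1)} (h1 : t.row a = t.row b)
    (h2 : t.col a < t.col b) : b < a := (t.2 a b).1 h1 h2

theorem entry_lt_of_col (t : RST n μ) {a b : Fin (n + 1)} (h1 : t.col a = t.col b)
    (h2 : t.row a < t.row b) : b < a := (t.2 a b).2 h1 h2

theorem entry_le_of_le (t : RST n μ) {a b : Fin (n + 1)} (h1 : t.row a ≤ t.row b)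
    (h2 : t.col a ≤ t.col b) : b ≤ a := by
  obtain ⟨c, hc1, hc2⟩ := exists_entry t (μ.up_left_mem h1 le_rfl (entry_mem t b))
  have h3 : c ≤ a := by
    rcases h2.lt_or_eq with h | h
    · exact (entry_lt_of_row t hc1.symm (by omega)).le
    · exact (entry_ext t hc1 (by omega)).le
  have h4 : b ≤ c := by
    rcases h1.lt_or_eq with h | h
    · exact (entry_lt_of_col t hc2 (by omega)).le
    · exact (entry_ext t (by omega) hc2.symm).le
  exact h4.trans h3

/-- The possible relative positions of two consecutive entries. -/
theorem consecutive (t : RST n μ) (i : Fin n) :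
    (t.row i.castSucc = t.row i.succ ∧ t.col i.castSucc = t.col i.succ + 1) ∨
    (t.col i.castSucc = t.col i.succ ∧ t.row i.castSucc = t.row i.succ + 1) ∨
    (t.row i.castSucc < t.row i.succ ∧ t.col i.succ < t.col i.castSucc) ∨
    (t.row i.succ < t.row i.castSucc ∧ t.col i.castSucc < t.col i.succ) := by
  have hno : ∀ c : Fin (n + 1), i.castSucc < c → ¬ c < i.succ := fun c h1 h2 => by
    rw [Fin.lt_def] at h1 h2
    simp at h1 h2
    omega
  have h0 : ¬ (t.row i.castSucc ≤ t.row i.succ ∧ t.col i.castSucc ≤ t.col i.succ) := fun h =>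
    absurd (entry_le_of_le t h.1 h.2) Fin.castSucc_lt_succ.not_ge
  rcases lt_trichotomy (t.row i.castSucc) (t.row i.succ) with h1 | h1 | h1
  · omega
  · left
    refine ⟨h1, ?_⟩
    by_contra hc
    obtain ⟨c, hc1, hc2⟩ := exists_entry t (r := t.row i.castSucc) (c := t.col i.succ + 1)
      (μ.up_left_mem le_rfl (by omega) (entry_mem t i.castSucc))
    exact hno c (entry_lt_of_row t hc1 (by omega)) (entry_lt_of_row t (by omega) (by omega))
  · rcases lt_trichotomy (t.col i.castSucc) (t.col i.succ) with h2 | h2 | h2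
    · omega
    · right; left
      refine ⟨h2, ?_⟩
      by_contra hc
      obtain ⟨c, hc1, hc2⟩ := exists_entry t (r := t.row i.succ + 1) (c := t.col i.castSucc)
        (μ.up_left_mem (by omega) le_rfl (entry_mem t i.castSucc))
      exact hno c (entry_lt_of_col t hc2 (by omega)) (entry_lt_of_col t (by omega) (by omega))
    · exfalso
      obtain ⟨c, hc1, hc2⟩ := exists_entry t (r := t.row i.succ) (c := t.col i.castSucc)
        (μ.up_left_mem (by omega) le_rfl (entry_mem t i.castSucc))
      exact hno c (entry_lt_of_col t hc2 (by omega)) (entry_lt_of_row t (by omega) (by omega))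

theorem content_ne_succ (t : RST n μ) (i : Fin n) :
    t.content i.castSucc ≠ t.content i.succ := by
  have := consecutive t i
  simp only [RST.content]
  omega

theorem content_ne_succ_succ (t : RST n μ) {i j : Fin n} (hij : (j : ℕ) = i + 1) :
    t.content i.castSucc ≠ t.content j.succ := by
  intro h
  simp only [RST.content] at h
  have hlt : i.castSucc < j.succ := by simp [Fin.lt_def, hij]
  have h0 : ¬ (t.row i.castSucc ≤ t.row j.succ ∧ t.col i.castSucc ≤ t.col j.succ) := fun h =>
    absurd (entry_le_of_le t h.1 h.2) hlt.not_ge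
  obtain ⟨c, hc1, hc2⟩ := exists_entry t (r := t.row j.succ) (c := t.col i.castSucc)
    (μ.up_left_mem (by omega) le_rfl (entry_mem t i.castSucc))
  obtain ⟨d, hd1, hd2⟩ := exists_entry t (r := t.row i.castSucc) (c := t.col j.succ)
    (μ.up_left_mem le_rfl (by omega) (entry_mem t i.castSucc))
  have c1 := entry_lt_of_col t hc2 (by omega)
  have c2 := entry_lt_of_row t hc1.symm (by omega)
  have d1 := entry_lt_of_row t hd1 (by omega)
  have d2 := entry_lt_of_col t hd2.symm (by omega)
  rw [Fin.lt_def] at c1 c2 d1 d2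
  simp at c1 c2 d1 d2
  have : c = d := Fin.ext (by omega)
  rw [this] at hc1
  omega

theorem isRST_adj_trans {t : RST n μ} {i : Fin n} (h1 : t.row i.castSucc ≠ t.row i.succ)
    (h2 : t.col i.castSucc ≠ t.col i.succ) : IsRST ((adj i).trans t.1) := by
  intro a b
  simp only [Equiv.trans_apply]
  constructor
  · intro ha hb
    have h3 := adj_lt_adj (i := i) ((t.2 (adj i a) (adj i b)).1 ha hb)
    rw [adj_adj, adj_adj] at h3
    refine h3 ?_
    rintro ⟨e1, e2⟩
    rw [e1, e2] at ha
    exact h1 ha.symm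
  · intro ha hb
    have h3 := adj_lt_adj (i := i) ((t.2 (adj i a) (adj i b)).2 ha hb)
    rw [adj_adj, adj_adj] at h3
    refine h3 ?_
    rintro ⟨e1, e2⟩
    rw [e1, e2] at ha
    exact h2 ha.symm

theorem exchange_val {t : RST n μ} {i : Fin n} (h1 : t.row i.castSucc ≠ t.row i.succ)
    (h2 : t.col i.castSucc ≠ t.col i.succ) :
    (t.exchange i.castSucc i.succ).1 = (adj i).trans t.1 := by
  have h : t.exchange i.castSucc i.succ = ⟨(adj i).trans t.1, isRST_adj_trans h1 h2⟩ :=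
    dif_pos (isRST_adj_trans h1 h2)
  rw [h]

end Tableaux

/-! ### The Hecke algebra relations on `V_λ` -/

section HeckeV

variable {K : Type*} [Field K] {n : ℕ} {μ : YoungDiagram}

/-- The spectral value of a cell. -/
def cellValue (s : K) (c : μ.cells) : K := s ^ ((c.1.2 : ℤ) - (c.1.1 : ℤ))

/-- The off-diagonal coefficients of the representation `V_λ`. -/
def cellCoef (s : K) (a b : μ.cells) : K :=
  if a.1.1 = b.1.1 ∨ a.1.2 = b.1.2 then 0 else if a.1.1 < b.1.1 then 1
  else offdiag s (cellValue s a) (cellValue s b)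

theorem cellCoef_of_not_lt {s : K} {a b : μ.cells} (h1 : a.1.1 ≠ b.1.1) (h2 : a.1.2 ≠ b.1.2)
    (h : ¬ a.1.1 < b.1.1) : cellCoef s a b = offdiag s (cellValue s a) (cellValue s b) := by
  rw [cellCoef, if_neg (not_or.2 ⟨h1, h2⟩), if_neg h]

theorem cellCoef_of_lt {s : K} {a b : μ.cells} (h1 : a.1.1 < b.1.1) (h2 : a.1.2 ≠ b.1.2) :
    cellCoef s a b = 1 := by
  rw [cellCoef, if_neg (not_or.2 ⟨h1.ne, h2⟩), if_pos h1]

theorem cellValue_apply (s : K) (t : RST n μ) (k : Fin (n + 1)) :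
    cellValue s (t.1 k) = s ^ t.content k := rfl

theorem zpow_sub_ne_zero {s : K} (hs : s ≠ 0) (hs' : ∀ m : ℤ, m ≠ 0 → s ^ m ≠ 1) {a b : ℤ}
    (h : a ≠ b) : s ^ a ≠ s ^ b := by
  intro h1
  refine hs' (a - b) (sub_ne_zero.2 h) ?_
  rw [zpow_sub₀ hs, h1, div_self (zpow_ne_zero _ hs)]

theorem offdiag_comm (s a b : K) : offdiag s a b = offdiag s b a := by
  unfold offdiag
  rw [← neg_sub a b, neg_sq]
  ring

theorem heckeTab_eq {s : K} (hs : s ≠ 0) (hs' : ∀ m : ℤ, m ≠ 0 → s ^ m ≠ 1) (i : Fin n)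
    (t : RST n μ) : heckeTab s i t =
      diag s (s ^ t.content i.castSucc) (s ^ t.content i.succ) • Finsupp.single t (1 : K) +
      cellCoef s (t.1 i.castSucc) (t.1 i.succ) •
        Finsupp.single (t.exchange i.castSucc i.succ) (1 : K) := by
  have hc := content_ne_succ t i
  have z1 := sub_ne_zero.2 (zpow_sub_ne_zero hs hs' hc)
  obtain ⟨m, hm⟩ : ∃ m, m = t.content i.succ - t.content i.castSucc := ⟨_, rfl⟩
  have ha := zpow_ne_zero (t.content i.castSucc) hs
  have hb : s ^ t.content i.succ = s ^ t.content i.castSucc * s ^ m := by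
    rw [← zpow_add₀ hs]
    congr 1
    omega
  have z2 : 1 - s ^ m ≠ 0 := sub_ne_zero.2 (hs' m (by omega)).symm
  have hd : diag s (s ^ t.content i.castSucc) (s ^ t.content i.succ) = (s - 1) / (1 - s ^ m) := by
    rw [diag, div_eq_div_iff z1 z2, hb]
    ring
  have hk : offdiag s (cellValue s (t.1 i.castSucc)) (cellValue s (t.1 i.succ)) =
      s * (1 - s ^ (m + 1)) * (1 - s ^ (m - 1)) / (1 - s ^ m) ^ 2 := by
    rw [cellValue_apply, cellValue_apply, offdiag,
      div_eq_div_iff (pow_ne_zero 2 z1) (pow_ne_zero 2 z2), hb, zpow_add₀ hs, zpow_sub₀ hs, zpow_one]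
    generalize s ^ m = y
    generalize s ^ t.content i.castSucc = x
    field_simp
  have hco : m = ((t.col i.succ : ℤ) - t.row i.succ) - ((t.col i.castSucc : ℤ) - t.row i.castSucc) :=
    hm
  rw [hd, cellCoef, hk]
  change _ = _ + (if t.row i.castSucc = t.row i.succ ∨ t.col i.castSucc = t.col i.succ then (0 : K)
    else if t.row i.castSucc < t.row i.succ then 1 else _) • _
  unfold heckeTab
  simp only [← hm]
  have hcon := consecutive t i
  by_cases h1 : t.row i.castSucc = t.row i.succ
  · have : m = -1 := by omega
    rw [if_pos h1, if_pos (Or.inl h1), zero_smul, add_zero, Finsupp.smul_single, smul_eq_mul,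
      mul_one]
    congr 1
    rw [this] at z2 ⊢
    rw [eq_div_iff z2, zpow_neg_one]
    field_simp
  · rw [if_neg h1]
    by_cases h2 : t.col i.castSucc = t.col i.succ
    · have : m = 1 := by omega
      rw [if_pos h2, if_pos (Or.inr h2), zero_smul, add_zero, Finsupp.smul_single, smul_eq_mul,
        mul_one]
      congr 1
      rw [this] at z2 ⊢
      rw [eq_div_iff z2, zpow_one]
      ring
    · rw [if_neg h2, if_neg (not_or.2 ⟨h1, h2⟩)]
      by_cases h3 : t.row i.castSucc < t.row i.succ
      · rw [if_pos h3, if_pos h3, one_smul, Finsupp.smul_single, smul_eq_mul, mul_one,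
          sub_eq_add_neg, add_comm, ← Finsupp.single_neg, ← neg_div, neg_sub]
      · rw [if_neg h3, if_neg h3, Finsupp.smul_single, Finsupp.smul_single, smul_eq_mul, mul_one,
          smul_eq_mul, mul_one]

theorem heckeV_single {s : K} (hs : s ≠ 0) (hs' : ∀ m : ℤ, m ≠ 0 → s ^ m ≠ 1) (i : Fin n)
    (t : RST n μ) : heckeV s i (Finsupp.single t 1) =
      diag s (s ^ t.content i.castSucc) (s ^ t.content i.succ) • Finsupp.single t (1 : K) +
      cellCoef s (t.1 i.castSucc) (t.1 i.succ) •
        Finsupp.single (t.exchange i.castSucc i.succ) (1 : K) := by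
  rw [heckeV, Finsupp.linearCombination_single, one_smul, heckeTab_eq hs hs']

theorem isSeminormal_cell {s : K} (hs : s ≠ 0) (hs' : ∀ m : ℤ, m ≠ 0 → s ^ m ≠ 1) :
    IsSeminormal s (cellValue s) (cellCoef s) (IsRST (n := n) (μ := μ)) where
  ne_succ e he i := zpow_sub_ne_zero hs hs' (content_ne_succ ⟨e, he⟩ i)
  ne_succ_succ e he i j hij := zpow_sub_ne_zero hs hs' (content_ne_succ_succ ⟨e, he⟩ hij)
  mul e he i := by
    have hcon := consecutive ⟨e, he⟩ i
    simp only [RST.row, RST.col] at hcon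
    by_cases h : (e i.castSucc).1.1 = (e i.succ).1.1 ∨ (e i.castSucc).1.2 = (e i.succ).1.2
    · rw [cellCoef, if_pos h, zero_mul, offdiag]
      rcases h with h | h
      · have : cellValue s (e i.castSucc) = s * cellValue s (e i.succ) := by
          rw [cellValue, cellValue, mul_comm, ← zpow_add_one₀ hs]
          congr 1
          omega
        rw [this]
        simp
      · have : cellValue s (e i.succ) = s * cellValue s (e i.castSucc) := by
          rw [cellValue, cellValue, mul_comm, ← zpow_add_one₀ hs]
          congr 1
          omega
        rw [this]
        simp
    · obtain ⟨h1, h2⟩ := not_or.1 h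
      rcases lt_or_gt_of_ne h1 with h3 | h3
      · rw [cellCoef_of_lt h3 h2, cellCoef_of_not_lt (Ne.symm h1) (Ne.symm h2) h3.not_gt, one_mul,
          offdiag_comm]
      · rw [cellCoef_of_lt h3 (Ne.symm h2), cellCoef_of_not_lt h1 h2 h3.not_gt, mul_one]
  step e he i h := by
    have h1 : ¬ ((e i.castSucc).1.1 = (e i.succ).1.1 ∨ (e i.castSucc).1.2 = (e i.succ).1.2) :=
      fun h1 => h (by rw [cellCoef, if_pos h1])
    exact isRST_adj_trans (t := ⟨e, he⟩) (not_or.1 h1).1 (not_or.1 h1).2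

/-- `V_λ` as the subspace of a seminormal representation spanned by the reverse standard
tableaux. -/
noncomputable def embedV (K : Type*) [Field K] (n : ℕ) (μ : YoungDiagram) :
    VMod K n μ →ₗ[K] ((Fin (n + 1) ≃ μ.cells) →₀ K) :=
  Finsupp.lmapDomain K K Subtype.val

theorem embedV_injective : Function.Injective (embedV K n μ) :=
  Finsupp.mapDomain_injective Subtype.val_injective

theorem embedV_heckeV {s : K} (hs : s ≠ 0) (hs' : ∀ m : ℤ, m ≠ 0 → s ^ m ≠ 1) (i : Fin n)
    (f : VMod K n μ) :
    embedV K n μ (heckeV s i f) =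
      seminormal s (cellValue s) (cellCoef s) IsRST i (embedV K n μ f) := by
  have hsingle : ∀ t : RST n μ,
      embedV K n μ (Finsupp.single t 1) = Finsupp.single t.1 1 := fun t =>
    Finsupp.mapDomain_single
  refine finsupp_ext_single (A := embedV K n μ ∘ₗ heckeV s i)
    (B := seminormal s (cellValue s) (cellCoef s) IsRST i ∘ₗ embedV K n μ) (fun t => ?_) f
  simp only [LinearMap.comp_apply]
  rw [heckeV_single hs hs', hsingle, seminormal_single t.2, map_add, map_smul, map_smul, hsingle,
    hsingle]
  congr 1
  by_cases h : (t.1 i.castSucc).1.1 = (t.1 i.succ).1.1 ∨ (t.1 i.castSucc).1.2 = (t.1 i.succ).1.2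
  · rw [cellCoef, if_pos h, zero_smul, zero_smul]
  · rw [exchange_val (not_or.1 h).1 (not_or.1 h).2]

theorem heckeV_isHecke {s : K} (hs : s ≠ 0) (hs' : ∀ m : ℤ, m ≠ 0 → s ^ m ≠ 1) :
    IsHecke s (heckeV (K := K) (n := n) (μ := μ) s) := by
  have H := seminormal_isHecke (isSeminormal_cell (n := n) (μ := μ) hs hs')
  constructor
  · intro i f
    apply embedV_injective
    simp only [embedV_heckeV hs hs', map_add, map_smul, H.quad]
  · intro i j hij f
    apply embedV_injective
    simp only [embedV_heckeV hs hs', H.comm i j hij]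
  · intro i j hij f
    apply embedV_injective
    simp only [embedV_heckeV hs hs', H.braid i j hij]

end HeckeV

/-! ### The Hecke algebra relations on vector valued polynomials -/

section Polynomials

variable {K : Type*} [Field K] {n : ℕ}

theorem X_sub_X_mul_divDiff (i : Fin n) (f : MvPolynomial (Fin (n + 1)) K) :
    (MvPolynomial.X i.castSucc - MvPolynomial.X i.succ) * divDiff K i f = f - swapX K i f :=
  (dvd_sub_swapX i f).choose_spec.symm

theorem delta_apply (s : K) (i : Fin n) (f : MvPolynomial (Fin (n + 1)) K) :
    delta s i f = (1 - s) • (MvPolynomial.X i.succ * divDiff K i f) := rfl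

/-- The permuted polynomial `f`, as a rational function. -/
noncomputable def permFrac (π : Equiv.Perm (Fin (n + 1))) (f : MvPolynomial (Fin (n + 1)) K) :
    FractionRing (MvPolynomial (Fin (n + 1)) K) :=
  algebraMap _ _ (MvPolynomial.rename π f)

/-- The variables, as rational functions. -/
noncomputable def fracX (K : Type*) [Field K] {n : ℕ} (k : Fin (n + 1)) :
    FractionRing (MvPolynomial (Fin (n + 1)) K) :=
  algebraMap (MvPolynomial (Fin (n + 1)) K) _ (MvPolynomial.X k)

theorem fracX_sub_ne_zero {a b : Fin (n + 1)} (h : a ≠ b) : fracX K a - fracX K b ≠ 0 := by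
  rw [sub_ne_zero]
  intro he
  exact h (MvPolynomial.X_injective (R := K)
    (IsFractionRing.injective (MvPolynomial (Fin (n + 1)) K)
    (FractionRing (MvPolynomial (Fin (n + 1)) K)) he))

theorem permFrac_one_injective :
    Function.Injective (permFrac (K := K) (1 : Equiv.Perm (Fin (n + 1)))) := by
  intro f g h
  have h1 := IsFractionRing.injective (MvPolynomial (Fin (n + 1)) K)
    (FractionRing (MvPolynomial (Fin (n + 1)) K)) h
  simpa using h1

theorem permFrac_add (π : Equiv.Perm (Fin (n + 1))) (f g : MvPolynomial (Fin (n + 1)) K) :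
    permFrac π (f + g) = permFrac π f + permFrac π g := by
  simp [permFrac]

theorem permFrac_smul (π : Equiv.Perm (Fin (n + 1))) (c : K) (f : MvPolynomial (Fin (n + 1)) K) :
    permFrac π (c • f) =
      algebraMap _ _ (MvPolynomial.C (σ := Fin (n + 1)) c) * permFrac π f := by
  simp [permFrac, MvPolynomial.smul_eq_C_mul]

theorem permFrac_mul (π : Equiv.Perm (Fin (n + 1))) (f g : MvPolynomial (Fin (n + 1)) K) :
    permFrac π (f * g) = permFrac π f * permFrac π g := by
  simp [permFrac]

theorem permFrac_X (π : Equiv.Perm (Fin (n + 1))) (k : Fin (n + 1)) :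
    permFrac π (MvPolynomial.X k) = fracX K (π k) := by
  simp [permFrac, fracX]

theorem permFrac_swapX (π : Equiv.Perm (Fin (n + 1))) (i : Fin n)
    (f : MvPolynomial (Fin (n + 1)) K) : permFrac π (swapX K i f) = permFrac (π * adj i) f := by
  rw [permFrac, permFrac, swapX, AlgHom.toLinearMap_apply, MvPolynomial.rename_rename]
  rfl

/-- In the field of fractions `δ_i` is given by its defining formula, which reduces the relations
between the `δ_i` and the transpositions to identities of rational functions. -/
theorem permFrac_delta (π : Equiv.Perm (Fin (n + 1))) (s : K) (i : Fin n)
    (f : MvPolynomial (Fin (n + 1)) K) :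
    permFrac π (delta s i f) = (1 - algebraMap _ _ (MvPolynomial.C (σ := Fin (n + 1)) s)) *
      fracX K (π i.succ) * (permFrac π f - permFrac (π * adj i) f) /
      (fracX K (π i.castSucc) - fracX K (π i.succ)) := by
  have hne : fracX K (π i.castSucc) - fracX K (π i.succ) ≠ 0 :=
    fracX_sub_ne_zero (π.injective.ne Fin.castSucc_lt_succ.ne)
  have h := congrArg (permFrac π) (X_sub_X_mul_divDiff i f)
  rw [sub_eq_add_neg f, sub_eq_add_neg (MvPolynomial.X _), ← neg_one_smul K (MvPolynomial.X _),
    ← neg_one_smul K (swapX K i f), permFrac_mul, permFrac_add, permFrac_add, permFrac_smul,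
    permFrac_smul, permFrac_X, permFrac_X, permFrac_swapX] at h
  simp only [map_neg, map_one, neg_mul, one_mul, ← sub_eq_add_neg] at h
  rw [delta_apply, permFrac_smul, permFrac_mul, permFrac_X, eq_div_iff hne, map_sub, map_sub,
    map_one, map_one, ← h]
  ring

theorem delta_delta (s : K) (i : Fin n) (f : MvPolynomial (Fin (n + 1)) K) :
    delta s i (delta s i f) = (s - 1) • delta s i f := by
  apply permFrac_one_injective
  have h1 := fracX_sub_ne_zero (K := K) (Fin.castSucc_lt_succ (i := i)).ne
  have h2 := fracX_sub_ne_zero (K := K) (Fin.castSucc_lt_succ (i := i)).ne'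
  simp only [permFrac_smul, permFrac_delta, one_mul, adj_mul_self,
    Equiv.Perm.one_apply, adj_castSucc, adj_succ, map_sub, map_one]
  field_simp
  ring

theorem delta_swapX_add (s : K) (i : Fin n) (f : MvPolynomial (Fin (n + 1)) K) :
    delta s i (swapX K i f) + swapX K i (delta s i f) + (s - 1) • f =
      (s - 1) • swapX K i f := by
  apply permFrac_one_injective
  have h1 := fracX_sub_ne_zero (K := K) (Fin.castSucc_lt_succ (i := i)).ne
  have h2 := fracX_sub_ne_zero (K := K) (Fin.castSucc_lt_succ (i := i)).ne'
  simp only [permFrac_add, permFrac_smul, permFrac_delta, permFrac_swapX, one_mul, adj_mul_self,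
    Equiv.Perm.one_apply, adj_castSucc, adj_succ, map_sub, map_one]
  field_simp
  ring

/-- The values of the adjacent transpositions `i` and `j = i + 1` on the three positions that
they move. -/
theorem adj_near {i j : Fin n} (hij : (j : ℕ) = i + 1) :
    j.castSucc = i.succ ∧ adj i j.succ = j.succ ∧ adj j i.castSucc = i.castSucc ∧
      adj j i.succ = j.succ ∧ adj j j.succ = i.succ := by
  have hs : j.castSucc = i.succ := Fin.ext (by simp [hij])
  refine ⟨hs, ?_, ?_, by rw [← hs, adj_castSucc], by rw [adj_succ, hs]⟩ <;>
  · rw [adj_of_ne] <;> simp [Fin.ext_iff] <;> omega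

theorem delta_braid_self (s : K) {i j : Fin n} (hij : (j : ℕ) = i + 1)
    (f : MvPolynomial (Fin (n + 1)) K) :
    delta s i (delta s j (delta s i f)) + s • swapX K i (delta s j (swapX K i f)) =
      delta s j (delta s i (delta s j f)) + s • swapX K j (delta s i (swapX K j f)) := by
  apply permFrac_one_injective
  obtain ⟨hs, a1, a2, a3, a4⟩ := adj_near hij
  have n1 : i.castSucc ≠ i.succ := Fin.castSucc_lt_succ.ne
  have n2 : i.succ ≠ j.succ := hs ▸ Fin.castSucc_lt_succ.ne
  have n3 : i.castSucc ≠ j.succ := by simp [Fin.ext_iff, hij]; omega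
  have h1 := fracX_sub_ne_zero (K := K) n1
  have h2 := fracX_sub_ne_zero (K := K) n2
  have h3 := fracX_sub_ne_zero (K := K) n3
  have h1' := fracX_sub_ne_zero (K := K) n1.symm
  have h2' := fracX_sub_ne_zero (K := K) n2.symm
  have h3' := fracX_sub_ne_zero (K := K) n3.symm
  have hb : adj i * (adj j * adj i) = adj j * (adj i * adj j) := by
    rw [← mul_assoc, adj_braid hij, mul_assoc]
  simp only [permFrac_add, permFrac_smul, permFrac_delta, permFrac_swapX, one_mul, mul_assoc,
    adj_mul_self, Equiv.Perm.one_apply, Equiv.Perm.mul_apply, adj_castSucc, adj_succ, hs,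
    a1, a2, a3, a4, hb]
  field_simp
  ring

theorem delta_braid_left (s : K) {i j : Fin n} (hij : (j : ℕ) = i + 1)
    (f : MvPolynomial (Fin (n + 1)) K) :
    swapX K i (delta s j (delta s i f)) + delta s i (delta s j (swapX K i f)) +
      (s - 1) • swapX K i (delta s j (swapX K i f)) = delta s j (swapX K i (delta s j f)) := by
  apply permFrac_one_injective
  obtain ⟨hs, a1, a2, a3, a4⟩ := adj_near hij
  have n1 : i.castSucc ≠ i.succ := Fin.castSucc_lt_succ.ne
  have n2 : i.succ ≠ j.succ := hs ▸ Fin.castSucc_lt_succ.ne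
  have n3 : i.castSucc ≠ j.succ := by simp [Fin.ext_iff, hij]; omega
  have h1 := fracX_sub_ne_zero (K := K) n1
  have h2 := fracX_sub_ne_zero (K := K) n2
  have h3 := fracX_sub_ne_zero (K := K) n3
  have h1' := fracX_sub_ne_zero (K := K) n1.symm
  have h2' := fracX_sub_ne_zero (K := K) n2.symm
  have h3' := fracX_sub_ne_zero (K := K) n3.symm
  have hb : adj i * (adj j * adj i) = adj j * (adj i * adj j) := by
    rw [← mul_assoc, adj_braid hij, mul_assoc]
  simp only [permFrac_add, permFrac_smul, permFrac_delta, permFrac_swapX, one_mul, mul_assoc,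
    adj_mul_self, Equiv.Perm.one_apply, Equiv.Perm.mul_apply, adj_castSucc, adj_succ, hs,
    a1, a2, a3, a4, hb, map_sub, map_one]
  field_simp
  ring

theorem delta_braid_right (s : K) {i j : Fin n} (hij : (j : ℕ) = i + 1)
    (f : MvPolynomial (Fin (n + 1)) K) :
    swapX K j (delta s i (delta s j f)) + delta s j (delta s i (swapX K j f)) +
      (s - 1) • swapX K j (delta s i (swapX K j f)) = delta s i (swapX K j (delta s i f)) := by
  apply permFrac_one_injective
  obtain ⟨hs, a1, a2, a3, a4⟩ := adj_near hij
  have n1 : i.castSucc ≠ i.succ := Fin.castSucc_lt_succ.ne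
  have n2 : i.succ ≠ j.succ := hs ▸ Fin.castSucc_lt_succ.ne
  have n3 : i.castSucc ≠ j.succ := by simp [Fin.ext_iff, hij]; omega
  have h1 := fracX_sub_ne_zero (K := K) n1
  have h2 := fracX_sub_ne_zero (K := K) n2
  have h3 := fracX_sub_ne_zero (K := K) n3
  have h1' := fracX_sub_ne_zero (K := K) n1.symm
  have h2' := fracX_sub_ne_zero (K := K) n2.symm
  have h3' := fracX_sub_ne_zero (K := K) n3.symm
  have hb : adj i * (adj j * adj i) = adj j * (adj i * adj j) := by
    rw [← mul_assoc, adj_braid hij, mul_assoc]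
  simp only [permFrac_add, permFrac_smul, permFrac_delta, permFrac_swapX, one_mul, mul_assoc,
    adj_mul_self, Equiv.Perm.one_apply, Equiv.Perm.mul_apply, adj_castSucc, adj_succ, hs,
    a1, a2, a3, a4, hb, map_sub, map_one]
  field_simp
  ring

theorem swapX_swapX_delta (s : K) {i j : Fin n} (hij : (j : ℕ) = i + 1)
    (f : MvPolynomial (Fin (n + 1)) K) :
    swapX K i (swapX K j (delta s i f)) = delta s j (swapX K i (swapX K j f)) ∧
      swapX K j (swapX K i (delta s j f)) = delta s i (swapX K j (swapX K i f)) := by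
  obtain ⟨hs, a1, a2, a3, a4⟩ := adj_near hij
  have hb : adj i * (adj j * adj i) = adj j * (adj i * adj j) := by
    rw [← mul_assoc, adj_braid hij, mul_assoc]
  constructor <;>
  · apply permFrac_one_injective
    simp only [permFrac_delta, permFrac_swapX, one_mul, mul_assoc, Equiv.Perm.mul_apply,
      Equiv.Perm.one_apply, adj_castSucc, adj_succ, hs, a1, a2, a3, a4, hb]

theorem swapX_braid {i j : Fin n} (hij : (j : ℕ) = i + 1) (f : MvPolynomial (Fin (n + 1)) K) :
    swapX K i (swapX K j (swapX K i f)) = swapX K j (swapX K i (swapX K j f)) := by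
  have hb : adj i * (adj j * adj i) = adj j * (adj i * adj j) := by
    rw [← mul_assoc, adj_braid hij, mul_assoc]
  apply permFrac_one_injective
  simp only [permFrac_swapX, one_mul, mul_assoc, hb]

theorem swapX_swapX (i : Fin n) (f : MvPolynomial (Fin (n + 1)) K) :
    swapX K i (swapX K i f) = f := by
  apply permFrac_one_injective
  simp only [permFrac_swapX, one_mul, adj_mul_self]

/-- Adjacent transpositions at distance at least `2` move disjoint sets of positions. -/
theorem adj_far {i j : Fin n} (hij : (i : ℕ) + 1 < j) :
    adj i j.castSucc = j.castSucc ∧ adj i j.succ = j.succ ∧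
      adj j i.castSucc = i.castSucc ∧ adj j i.succ = i.succ := by
  refine ⟨?_, ?_, ?_, ?_⟩ <;>
  · rw [adj_of_ne] <;> simp [Fin.ext_iff] <;> omega

theorem delta_comm (s : K) {i j : Fin n} (hij : (i : ℕ) + 1 < j)
    (f : MvPolynomial (Fin (n + 1)) K) : delta s i (delta s j f) = delta s j (delta s i f) := by
  apply permFrac_one_injective
  obtain ⟨a1, a2, a3, a4⟩ := adj_far hij
  have h1 := fracX_sub_ne_zero (K := K) (Fin.castSucc_lt_succ (i := i)).ne
  have h2 := fracX_sub_ne_zero (K := K) (Fin.castSucc_lt_succ (i := j)).ne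
  simp only [permFrac_delta, one_mul, Equiv.Perm.one_apply, a1, a2, a3, a4,
    adj_comm hij]
  field_simp
  ring

theorem swapX_delta_comm (s : K) {i j : Fin n} (hij : (i : ℕ) + 1 < j)
    (f : MvPolynomial (Fin (n + 1)) K) :
    swapX K i (delta s j f) = delta s j (swapX K i f) ∧
      swapX K j (delta s i f) = delta s i (swapX K j f) ∧
      swapX K i (swapX K j f) = swapX K j (swapX K i f) := by
  obtain ⟨a1, a2, a3, a4⟩ := adj_far hij
  refine ⟨?_, ?_, ?_⟩ <;>
  · apply permFrac_one_injective
    simp only [permFrac_delta, permFrac_swapX, one_mul, Equiv.Perm.one_apply, a1, a2, a3, a4,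
      adj_comm hij]

theorem delta_X_castSucc_mul (s : K) (i : Fin n) (f : MvPolynomial (Fin (n + 1)) K) :
    delta s i (MvPolynomial.X i.castSucc * f) =
      MvPolynomial.X i.succ * (delta s i f + (1 - s) • f) := by
  apply permFrac_one_injective
  have h1 := fracX_sub_ne_zero (K := K) (Fin.castSucc_lt_succ (i := i)).ne
  simp only [permFrac_add, permFrac_smul, permFrac_mul, permFrac_X, permFrac_delta, one_mul,
    Equiv.Perm.one_apply, adj_castSucc, map_sub, map_one]
  field_simp
  ring

theorem swapX_mul (i : Fin n) (f g : MvPolynomial (Fin (n + 1)) K) :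
    swapX K i (f * g) = swapX K i f * swapX K i g := by
  simp [swapX]

theorem swapX_X (i : Fin n) (k : Fin (n + 1)) :
    swapX K i (MvPolynomial.X k) = MvPolynomial.X (adj i k) := by
  simp [swapX]

theorem delta_mul_of_swapX_eq (s : K) (i : Fin n) {p : MvPolynomial (Fin (n + 1)) K}
    (hp : swapX K i p = p) (f : MvPolynomial (Fin (n + 1)) K) :
    delta s i (p * f) = p * delta s i f := by
  rw [delta_apply, delta_apply]
  have : divDiff K i (p * f) = p * divDiff K i f := by
    apply mul_left_cancel₀ (X_sub_X_ne_zero (K := K) i)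
    rw [X_sub_X_mul_divDiff, swapX_mul, hp, mul_left_comm, X_sub_X_mul_divDiff]
    ring
  rw [this, mul_smul_comm, mul_left_comm]

end Polynomials

section HeckeVPoly

variable {K : Type*} [Field K] {n : ℕ} {μ : YoungDiagram}

theorem hecke_tmul (s : K) (i : Fin n) (f : MvPolynomial (Fin (n + 1)) K) (u : VMod K n μ) :
    hecke s i (f ⊗ₜ[K] u) = delta s i f ⊗ₜ[K] u + swapX K i f ⊗ₜ[K] heckeV s i u := by
  simp [hecke]

/-- Linear operators on vector valued polynomials that agree on pure tensors are equal. -/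
theorem vpoly_ext {A B : VPoly K n μ →ₗ[K] VPoly K n μ}
    (h : ∀ (f : MvPolynomial (Fin (n + 1)) K) (u : VMod K n μ), A (f ⊗ₜ[K] u) = B (f ⊗ₜ[K] u))
    (m : VPoly K n μ) : A m = B m := by
  rw [TensorProduct.ext' h]

/-- The relations of the Hecke algebra pass from `V_λ` to vector valued polynomials: the terms are
sorted by the element of the Hecke algebra that acts on the tableau, and each group is an identity of
operators on polynomials. -/
theorem hecke_isHecke {s : K} (hV : IsHecke s (heckeV (K := K) (n := n) (μ := μ) s)) :
    IsHecke s (hecke (K := K) (n := n) (μ := μ) s) where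
  quad i m := by
    refine vpoly_ext (A := hecke s i ∘ₗ hecke s i)
      (B := (s - 1) • hecke s i + s • LinearMap.id) (fun f u => ?_) m
    have e1 := congrArg (· ⊗ₜ[K] u) (delta_delta s i f)
    have e2 := congrArg (· ⊗ₜ[K] heckeV s i u) (delta_swapX_add s i f)
    simp only [TensorProduct.add_tmul, ← TensorProduct.smul_tmul'] at e1 e2
    simp only [LinearMap.comp_apply, LinearMap.add_apply, LinearMap.smul_apply, LinearMap.id_apply,
      hecke_tmul, map_add, hV.quad, swapX_swapX, TensorProduct.tmul_add, TensorProduct.tmul_smul]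
    linear_combination (norm := module) e1 + e2
  comm i j hij m := by
    refine vpoly_ext (A := hecke s i ∘ₗ hecke s j) (B := hecke s j ∘ₗ hecke s i) (fun f u => ?_) m
    obtain ⟨e1, e2, e3⟩ := swapX_delta_comm s hij f
    simp only [LinearMap.comp_apply, hecke_tmul, map_add, delta_comm s hij, e1, e2, e3,
      hV.comm i j hij]
    abel
  braid i j hij m := by
    refine vpoly_ext (A := hecke s i ∘ₗ hecke s j ∘ₗ hecke s i)
      (B := hecke s j ∘ₗ hecke s i ∘ₗ hecke s j) (fun f u => ?_) m
    have e1 := congrArg (· ⊗ₜ[K] u) (delta_braid_self s hij f)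
    have e2 := congrArg (· ⊗ₜ[K] heckeV s i u) (delta_braid_left s hij f)
    have e3 := congrArg (· ⊗ₜ[K] heckeV s j u) (delta_braid_right s hij f)
    obtain ⟨e4, e5⟩ := swapX_swapX_delta s hij f
    simp only [TensorProduct.add_tmul, ← TensorProduct.smul_tmul'] at e1 e2 e3
    simp only [LinearMap.comp_apply, hecke_tmul, map_add, e4, e5, swapX_braid hij,
      hV.braid i j hij, hV.quad, TensorProduct.tmul_add, TensorProduct.tmul_smul]
    linear_combination (norm := module) e1 + e2 - e3

/-- Multiplication by the variable `x_k`. -/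
noncomputable def mulX (K : Type*) [Field K] {n : ℕ} {μ : YoungDiagram} (k : Fin (n + 1)) :
    VPoly K n μ →ₗ[K] VPoly K n μ :=
  TensorProduct.map (LinearMap.mulLeft K (MvPolynomial.X k)) LinearMap.id

theorem mulX_tmul (k : Fin (n + 1)) (f : MvPolynomial (Fin (n + 1)) K) (u : VMod K n μ) :
    mulX K k (f ⊗ₜ[K] u) = (MvPolynomial.X k * f) ⊗ₜ[K] u := by
  simp [mulX]

theorem hecke_mulX_castSucc (s : K) (i : Fin n) (m : VPoly K n μ) :
    hecke s i (mulX K i.castSucc m) = mulX K i.succ (hecke s i m + (1 - s) • m) := by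
  refine vpoly_ext (A := hecke s i ∘ₗ mulX K i.castSucc)
    (B := mulX K i.succ ∘ₗ (hecke s i + (1 - s) • LinearMap.id)) (fun f u => ?_) m
  simp only [LinearMap.comp_apply, LinearMap.add_apply, LinearMap.smul_apply, LinearMap.id_apply,
    hecke_tmul, mulX_tmul, map_add, delta_X_castSucc_mul, swapX_mul, swapX_X,
    adj_castSucc, mul_add, TensorProduct.add_tmul, mul_smul_comm, TensorProduct.smul_tmul']
  abel

theorem hecke_mulX_of_ne (s : K) {i : Fin n} {k : Fin (n + 1)} (h1 : k ≠ i.castSucc)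
    (h2 : k ≠ i.succ) (m : VPoly K n μ) :
    hecke s i (mulX K k m) = mulX K k (hecke s i m) := by
  refine vpoly_ext (A := hecke s i ∘ₗ mulX K k) (B := mulX K k ∘ₗ hecke s i) (fun f u => ?_) m
  have e : swapX K i (MvPolynomial.X k) = MvPolynomial.X k := by rw [swapX_X, adj_of_ne h1 h2]
  simp only [LinearMap.comp_apply, hecke_tmul, mulX_tmul, map_add, delta_mul_of_swapX_eq s i e,
    swapX_mul, e]

theorem hecke_mulX_mulX (s : K) (i : Fin n) (m : VPoly K n μ) :
    hecke s i (mulX K i.castSucc (mulX K i.succ m)) =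
      mulX K i.castSucc (mulX K i.succ (hecke s i m)) := by
  refine vpoly_ext (A := hecke s i ∘ₗ mulX K i.castSucc ∘ₗ mulX K i.succ)
    (B := mulX K i.castSucc ∘ₗ mulX K i.succ ∘ₗ hecke s i) (fun f u => ?_) m
  have e : swapX K i (MvPolynomial.X i.castSucc * MvPolynomial.X i.succ) =
      MvPolynomial.X i.castSucc * MvPolynomial.X i.succ := by
    rw [swapX_mul, swapX_X, swapX_X, adj_castSucc, adj_succ, mul_comm]
  simp only [LinearMap.comp_apply, hecke_tmul, mulX_tmul, map_add]
  simp only [← mul_assoc, delta_mul_of_swapX_eq s i e]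
  rw [swapX_mul, e]

theorem heckeInv_apply (s : K) (i : Fin n) (m : VPoly K n μ) :
    heckeInv s i m = s⁻¹ • (hecke s i m + (1 - s) • m) := by
  simp [heckeInv]

end HeckeVPoly

/-! ### The raising operator -/

section Raising

variable {K : Type*} [Field K] {n : ℕ} {μ : YoungDiagram} {s : K}

theorem heckeInv_hecke (hs : s ≠ 0) (H : IsHecke s (hecke (K := K) (n := n) (μ := μ) s)) (i : Fin n)
    (m : VPoly K n μ) : heckeInv s i (hecke s i m) = m := by
  rw [heckeInv_apply, H.quad]
  rw [show (s - 1) • hecke s i m + s • m + (1 - s) • hecke s i m = s • m by module, smul_smul,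
    inv_mul_cancel₀ hs, one_smul]

theorem hecke_heckeInv (hs : s ≠ 0) (H : IsHecke s (hecke (K := K) (n := n) (μ := μ) s)) (i : Fin n)
    (m : VPoly K n μ) : hecke s i (heckeInv s i m) = m := by
  rw [heckeInv_apply, map_smul, map_add, map_smul, H.quad]
  rw [show (s - 1) • hecke s i m + s • m + (1 - s) • hecke s i m = s • m by module, smul_smul,
    inv_mul_cancel₀ hs, one_smul]

theorem hecke_comm_heckeInv (H : IsHecke s (hecke (K := K) (n := n) (μ := μ) s)) {i j : Fin n}
    (hij : (i : ℕ) + 1 < j ∨ (j : ℕ) + 1 < i) (m : VPoly K n μ) :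
    hecke s i (heckeInv s j m) = heckeInv s j (hecke s i m) := by
  simp only [heckeInv_apply, map_smul, map_add]
  rcases hij with h | h
  · rw [H.comm i j h]
  · rw [H.comm j i h]

theorem heckeInv_braid (hs : s ≠ 0) (H : IsHecke s (hecke (K := K) (n := n) (μ := μ) s))
    {i j : Fin n} (hij : (j : ℕ) = i + 1) (m : VPoly K n μ) :
    heckeInv s j (heckeInv s i (hecke s j m)) = hecke s i (heckeInv s j (heckeInv s i m)) := by
  have h := H.braid i j hij (heckeInv s j (heckeInv s i m))
  rw [hecke_heckeInv hs H] at h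
  have h1 : heckeInv s j (heckeInv s i (hecke s j (hecke s i
      (hecke s j (heckeInv s j (heckeInv s i m)))))) =
      heckeInv s j (heckeInv s i (hecke s j m)) := by
    rw [hecke_heckeInv hs H, hecke_heckeInv hs H]
  rw [← h1, ← H.braid i j hij, heckeInv_hecke hs H, heckeInv_hecke hs H]

/-- The partial products `f ↦ f 𝐓_1⁻¹ ⋯ 𝐓_k⁻¹`. -/
noncomputable def partialInv (s : K) (n : ℕ) (μ : YoungDiagram) (k : ℕ) :
    VPoly K n μ →ₗ[K] VPoly K n μ :=
  wordOp (heckeInv s) ((List.finRange n).take k)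

theorem partialInv_zero (m : VPoly K n μ) : partialInv s n μ 0 m = m := rfl

theorem partialInv_succ {k : ℕ} (hk : k < n) (m : VPoly K n μ) :
    partialInv s n μ (k + 1) m = heckeInv s ⟨k, hk⟩ (partialInv s n μ k m) := by
  rw [partialInv, partialInv, ← wordOp_concat]
  congr 2
  rw [List.take_add_one]
  simp [hk]

theorem raising_apply (m : VPoly K n μ) :
    raising s m = mulX K (Fin.last n) (partialInv s n μ n m) := by
  rw [partialInv, List.take_of_length_le (by simp)]
  rfl

theorem partialInv_comm (B : VPoly K n μ →ₗ[K] VPoly K n μ) (k : ℕ)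
    (hB : ∀ (j : Fin n) m, (j : ℕ) < k → heckeInv s j (B m) = B (heckeInv s j m)) (hk : k ≤ n)
    (m : VPoly K n μ) : partialInv s n μ k (B m) = B (partialInv s n μ k m) := by
  induction k with
  | zero => rfl
  | succ k ih =>
    rw [partialInv_succ hk, partialInv_succ hk,
      ih (fun j m hj => hB j m (by omega)) (by omega), hB _ _ (Nat.lt_succ_self k)]

theorem partialInv_hecke (hs : s ≠ 0) (H : IsHecke s (hecke (K := K) (n := n) (μ := μ) s))
    {i j : Fin n} (hij : (j : ℕ) = i + 1) {k : ℕ} (hk : (i : ℕ) + 2 ≤ k) (hn : k ≤ n)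
    (m : VPoly K n μ) :
    partialInv s n μ k (hecke s j m) = hecke s i (partialInv s n μ k m) := by
  induction k, hk using Nat.le_induction with
  | base =>
    have e1 : ∀ m, partialInv s n μ (i + 2) m =
        heckeInv s j (heckeInv s i (partialInv s n μ i m)) := fun m => by
      have ej : j = ⟨i + 1, hn⟩ := Fin.ext hij
      rw [ej, partialInv_succ hn, partialInv_succ i.isLt]
    rw [e1, e1, partialInv_comm (hecke s j) i
      (fun l m hl => (hecke_comm_heckeInv H (Or.inr (by omega)) m).symm) i.isLt.le,
      heckeInv_braid hs H hij]
  | succ k hk ih =>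
    rw [partialInv_succ hn, partialInv_succ hn, ih (by omega),
      hecke_comm_heckeInv H (Or.inl (by simp; omega))]

/-- The raising operator shifts the indices of the generators: `𝐓_{i+1} 𝚽 = 𝚽 𝐓_i`, with operators
acting on the right. -/
theorem raising_hecke (hs : s ≠ 0) (H : IsHecke s (hecke (K := K) (n := n) (μ := μ) s))
    {i j : Fin n} (hij : (j : ℕ) = i + 1) (m : VPoly K n μ) :
    raising s (hecke s j m) = hecke s i (raising s m) := by
  rw [raising_apply, raising_apply, partialInv_hecke hs H hij (by omega) le_rfl, hecke_mulX_of_ne]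
  · simp [Fin.ext_iff]; omega
  · simp [Fin.ext_iff]; omega

/-- Moving the last factors of `(𝐓_1⁻¹ ⋯ 𝐓_{k+1}⁻¹)(𝐓_1⁻¹ ⋯ 𝐓_n⁻¹)`, except for the first one, through
the full product. -/
theorem partialInv_partialInv (hs : s ≠ 0) (H : IsHecke s (hecke (K := K) (n := n) (μ := μ) s))
    (h0 : 0 < n) {k : ℕ} (hk : k + 1 ≤ n) (m : VPoly K n μ) :
    partialInv s n μ n (partialInv s n μ (k + 1) m) =
      partialInv s n μ k (partialInv s n μ n (heckeInv s ⟨0, h0⟩ m)) := by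
  induction k with
  | zero => rw [partialInv_succ h0, partialInv_zero, partialInv_zero]
  | succ k ih =>
    rw [partialInv_succ hk, partialInv_succ (k := k) (by omega) (partialInv s n μ n _),
      ← ih (by omega)]
    simp only [heckeInv_apply, map_smul, map_add]
    rw [partialInv_hecke hs H (i := ⟨k, by omega⟩) rfl (by simp; omega) le_rfl]

theorem heckeInv_mulX_of_ne {i : Fin n} {k : Fin (n + 1)} (h1 : k ≠ i.castSucc) (h2 : k ≠ i.succ)
    (m : VPoly K n μ) : heckeInv s i (mulX K k m) = mulX K k (heckeInv s i m) := by
  simp only [heckeInv_apply, hecke_mulX_of_ne s h1 h2, map_smul, map_add]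

theorem mulX_succ_heckeInv (i : Fin n) (m : VPoly K n μ) :
    mulX K i.succ (heckeInv s i m) = s⁻¹ • hecke s i (mulX K i.castSucc m) := by
  rw [heckeInv_apply, map_smul, hecke_mulX_castSucc]

/-- The square of the raising operator carries the first generator to the last one:
`𝐓_1 𝚽² = 𝚽² 𝐓_{N-1}`, with operators acting on the right. -/
theorem raising_raising_hecke (hs : s ≠ 0)
    (H : IsHecke s (hecke (K := K) (n := n) (μ := μ) s)) {i l : Fin n} (hi : (i : ℕ) = 0)
    (hl : (l : ℕ) + 1 = n) (m : VPoly K n μ) :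
    raising s (raising s (hecke s i m)) = hecke s l (raising s (raising s m)) := by
  have h0 : 0 < n := by omega
  obtain rfl : i = ⟨0, h0⟩ := Fin.ext hi
  have el : Fin.last n = l.succ := Fin.ext (by simp [hl])
  have eC : ∀ m, partialInv s n μ n m = heckeInv s l (partialInv s n μ l m) := fun m => by
    have := partialInv_succ (s := s) (μ := μ) l.isLt m
    rwa [hl] at this
  have comm : ∀ m, partialInv s n μ l (mulX K (Fin.last n) m) =
      mulX K (Fin.last n) (partialInv s n μ l m) := fun m => by
    refine partialInv_comm (mulX K (Fin.last n)) l (fun j m hj => ?_) l.isLt.le m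
    rw [heckeInv_mulX_of_ne] <;> simp [Fin.ext_iff] <;> omega
  -- With `C` the full product of inverses and `A` the product without the last one,
  -- `C C 𝐓_1 = A C` (composed as functions).
  have eCC : ∀ m, partialInv s n μ n (partialInv s n μ n (hecke s ⟨0, h0⟩ m)) =
      partialInv s n μ l (partialInv s n μ n m) := fun m => by
    have := partialInv_partialInv hs H h0 (k := l) (by omega) (hecke s ⟨0, h0⟩ m)
    rwa [hl, heckeInv_hecke hs H] at this
  have key : ∀ m, raising s (raising s m) = s⁻¹ • mulX K l.castSucc (mulX K l.succ
      (hecke s l (partialInv s n μ l (partialInv s n μ n m)))) := fun m => by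
    rw [raising_apply, raising_apply, eC, comm, el, mulX_succ_heckeInv, hecke_mulX_mulX]
  rw [key, key, map_smul, hecke_mulX_mulX]
  congr 3
  have h1 := eCC m
  rw [eC] at h1
  rw [← h1, hecke_heckeInv hs H]

end Raising

/-! ### The rank function and the affine operation on exponents -/

section Rank

variable {n : ℕ}

/-- The total order on positions defined by `v`: larger values first, equal values from left to
right. -/
def Before (v : Fin (n + 1) → ℕ) (a b : Fin (n + 1)) : Prop :=
  v b < v a ∨ (v a = v b ∧ a < b)

theorem Before.rank_lt {v : Fin (n + 1) → ℕ} {a b : Fin (n + 1)} (h : Before v a b) :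
    rank v a < rank v b := by
  unfold Before at h
  rw [Fin.lt_def]
  simp only [rank]
  refine Finset.card_lt_card ((Finset.ssubset_iff_of_subset ?_).2 ⟨a, ?_, ?_⟩)
  · intro c hc
    have hc' := (Finset.mem_filter.1 hc).2
    refine Finset.mem_filter.2 ⟨Finset.mem_univ _, ?_⟩
    omega
  · exact Finset.mem_filter.2 ⟨Finset.mem_univ _, h⟩
  · intro hc
    have hc' := (Finset.mem_filter.1 hc).2
    omega

theorem before_trichotomy (v : Fin (n + 1) → ℕ) (a b : Fin (n + 1)) :
    Before v a b ∨ a = b ∨ Before v b a := by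
  unfold Before
  omega

theorem rank_lt_rank {v : Fin (n + 1) → ℕ} {a b : Fin (n + 1)} :
    rank v a < rank v b ↔ Before v a b := by
  refine ⟨fun h => ?_, Before.rank_lt⟩
  rcases before_trichotomy v a b with h1 | rfl | h1
  · exact h1
  · exact absurd h (lt_irrefl _)
  · exact absurd h1.rank_lt h.not_gt

theorem rank_injective (v : Fin (n + 1) → ℕ) : Function.Injective (rank v) := by
  intro a b h
  rcases before_trichotomy v a b with h1 | h1 | h1
  · exact absurd h h1.rank_lt.ne
  · exact h1
  · exact absurd h h1.rank_lt.ne'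

/-- The rank function as a permutation. -/
noncomputable def rankPerm (v : Fin (n + 1) → ℕ) : Equiv.Perm (Fin (n + 1)) :=
  Equiv.ofBijective (rank v) (Finite.injective_iff_bijective.1 (rank_injective v))

@[simp] theorem rankPerm_apply (v : Fin (n + 1) → ℕ) (a : Fin (n + 1)) :
    rankPerm v a = rank v a := rfl

/-- A permutation is determined by the order of its values. -/
theorem perm_eq_of_lt_imp_lt {σ τ : Equiv.Perm (Fin (n + 1))} (h : ∀ a b, σ a < σ b → τ a < τ b) :
    σ = τ := by
  have : τ * σ⁻¹ = 1 := by
    refine eq_one_of_strictMono fun a b hab => h _ _ ?_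
    rwa [perm_apply_inv_self, perm_apply_inv_self]
  exact (mul_inv_eq_one.1 this).symm

/-- The rank function is the only permutation that is compatible with the order `Before v`. -/
theorem rank_eq_of_before {v : Fin (n + 1) → ℕ} {σ : Equiv.Perm (Fin (n + 1))}
    (h : ∀ a b, Before v a b → σ a < σ b) (a : Fin (n + 1)) : rank v a = σ a := by
  have : rankPerm v = σ := perm_eq_of_lt_imp_lt fun a b hab => h a b (rank_lt_rank.1 hab)
  rw [← this, rankPerm_apply]

theorem rank_zero (a : Fin (n + 1)) : rank (fun _ => 0) a = a := by
  refine rank_eq_of_before (σ := 1) (fun a b h => ?_) a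
  simpa [Before] using h

theorem rank_comp_adj {v : Fin (n + 1) → ℕ} {i : Fin n} (h : v i.castSucc ≠ v i.succ)
    (a : Fin (n + 1)) : rank (v ∘ adj i) a = rank v (adj i a) := by
  refine rank_eq_of_before (σ := rankPerm v * adj i) (fun a b hab => ?_) a
  rw [Equiv.Perm.mul_apply, Equiv.Perm.mul_apply, rankPerm_apply, rankPerm_apply, rank_lt_rank]
  rcases hab with h1 | ⟨h1, h2⟩
  · exact Or.inl h1
  · refine Or.inr ⟨h1, adj_lt_adj h2 ?_⟩
    rintro ⟨rfl, rfl⟩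
    simp only [Function.comp_apply, adj_castSucc, adj_succ] at h1
    exact h h1.symm

/-- Equal consecutive values have consecutive ranks. -/
theorem rank_succ_of_eq {v : Fin (n + 1) → ℕ} {i : Fin n} (h : v i.castSucc = v i.succ) :
    ∃ k : Fin n, rank v i.castSucc = k.castSucc ∧ rank v i.succ = k.succ := by
  have h1 : rank v i.castSucc < rank v i.succ :=
    rank_lt_rank.2 (Or.inr ⟨h, Fin.castSucc_lt_succ⟩)
  have h2 : (rank v i.castSucc : ℕ) < n := by
    have := (rank v i.succ).isLt
    rw [Fin.lt_def] at h1
    omega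
  refine ⟨⟨rank v i.castSucc, h2⟩, rfl, ?_⟩
  obtain ⟨c, hc⟩ := (rankPerm v).surjective (Fin.succ ⟨rank v i.castSucc, h2⟩)
  rw [rankPerm_apply] at hc
  have h3 : rank v i.castSucc < rank v c := by
    rw [hc, Fin.lt_def]
    simp
  by_contra hne
  have h4 : rank v c < rank v i.succ := by
    rw [hc]
    refine lt_of_le_of_ne ?_ (Ne.symm hne)
    rw [Fin.le_def]
    rw [Fin.lt_def] at h1
    simpa using h1
  rw [rank_lt_rank] at h3 h4
  simp only [Before, Fin.lt_def] at h3 h4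
  simp at h3 h4
  omega

/-- The action of the affine arrow on exponents. -/
def affineV (v : Fin (n + 1) → ℕ) : Fin (n + 1) → ℕ :=
  Fin.snoc (α := fun _ => ℕ) (fun i : Fin n => v i.succ) (v 0 + 1)

/-- The inverse of the affine operation, for exponents whose last entry is nonzero. -/
def lowerV (v : Fin (n + 1) → ℕ) : Fin (n + 1) → ℕ :=
  Fin.cons (α := fun _ => ℕ) (v (Fin.last n) - 1) (fun i : Fin n => v i.castSucc)

@[simp] theorem affineV_castSucc (v : Fin (n + 1) → ℕ) (i : Fin n) :
    affineV v i.castSucc = v i.succ := by simp [affineV]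

@[simp] theorem affineV_last (v : Fin (n + 1) → ℕ) : affineV v (Fin.last n) = v 0 + 1 := by
  simp [affineV]

theorem lowerV_affineV (v : Fin (n + 1) → ℕ) : lowerV (affineV v) = v := by
  ext a
  refine Fin.cases ?_ (fun i => ?_) a <;> simp [lowerV]

theorem affineV_lowerV {v : Fin (n + 1) → ℕ} (h : v (Fin.last n) ≠ 0) :
    affineV (lowerV v) = v := by
  ext a
  refine Fin.lastCases ?_ (fun i => ?_) a
  · simp [lowerV]
    omega
  · simp [lowerV]

theorem rank_affineV (v : Fin (n + 1) → ℕ) :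
    rank (affineV v) (Fin.last n) = rank v 0 ∧
      ∀ i : Fin n, rank (affineV v) i.castSucc = rank v i.succ := by
  let c := rankPerm v * finRotate (n + 1)
  have c1 : c (Fin.last n) = rank v 0 := by simp [c]
  have c2 : ∀ i : Fin n, c i.castSucc = rank v i.succ := fun i => by simp [c]
  have h := rank_eq_of_before (v := affineV v) (σ := c) (fun a b hab => ?_)
  · exact ⟨by rw [h, c1], fun i => by rw [h, c2]⟩
  · refine Fin.lastCases ?_ (fun i => ?_) a (motive := fun a => Before (affineV v) a b → c a < c b)
      hab <;> refine Fin.lastCases ?_ (fun j => ?_) b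
    · intro h
      simp [Before] at h
    · intro h
      rw [c1, c2, rank_lt_rank]
      simp only [Before, affineV_castSucc, affineV_last] at h ⊢
      rcases h with h | ⟨-, h⟩
      · rcases (Nat.lt_succ_iff.1 h).lt_or_eq with h | h
        · exact Or.inl h
        · exact Or.inr ⟨h.symm, Fin.succ_pos j⟩
      · exact absurd h (Fin.castSucc_lt_last j).not_gt
    · intro h
      rw [c1, c2, rank_lt_rank]
      simp only [Before, affineV_castSucc, affineV_last] at h ⊢
      omega
    · intro h
      rw [c2, c2, rank_lt_rank]
      simpa [Before] using h

theorem affineV_comp_adj (v : Fin (n + 1) → ℕ) {i j : Fin n} (hij : (j : ℕ) = i + 1) :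
    affineV v ∘ adj i = affineV (v ∘ adj j) := by
  obtain ⟨hs, a1, a2, a3, a4⟩ := adj_near hij
  have hn := j.isLt
  ext a
  refine Fin.lastCases ?_ (fun k => ?_) a
  · have h1 : adj i (Fin.last n) = Fin.last n := by
      rw [adj_of_ne] <;> simp [Fin.ext_iff] <;> omega
    have h2 : adj j 0 = 0 := by
      rw [adj_of_ne] <;> (simp [Fin.ext_iff]; try omega)
    simp [h1, h2]
  · rw [Function.comp_apply, affineV_castSucc, Function.comp_apply]
    have : ∃ l : Fin n, adj i k.castSucc = l.castSucc ∧ adj j k.succ = l.succ := by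
      by_cases h1 : k = i
      · exact ⟨j, by rw [h1, adj_castSucc, hs], by rw [h1, a3]⟩
      · by_cases h2 : k = j
        · exact ⟨i, by rw [h2, hs, adj_succ], by rw [h2, a4]⟩
        · refine ⟨k, adj_of_ne ?_ ?_, adj_of_ne ?_ ?_⟩ <;>
            (simp [Fin.ext_iff] at h1 h2 ⊢; omega)
    obtain ⟨l, l1, l2⟩ := this
    rw [l1, l2, affineV_castSucc]

theorem affineV_affineV_comp_adj (v : Fin (n + 1) → ℕ) {i l : Fin n} (hi : (i : ℕ) = 0)
    (hl : (l : ℕ) + 1 = n) : affineV (affineV v) ∘ adj l = affineV (affineV (v ∘ adj i)) := by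
  have hi0 : (0 : Fin (n + 1)) = i.castSucc := Fin.ext (by simp [hi])
  have hll : Fin.last n = l.succ := Fin.ext (by simp [hl])
  have key : ∀ w : Fin (n + 1) → ℕ, affineV (affineV w) l.succ = w i.succ + 1 ∧
      affineV (affineV w) l.castSucc = w i.castSucc + 1 ∧
      ∀ k : Fin (n + 1), (k : ℕ) + 2 < n + 1 → ∃ m : Fin (n + 1), (m : ℕ) = k + 2 ∧
        affineV (affineV w) k = w m := by
    intro w
    refine ⟨?_, ?_, fun k hk => ?_⟩
    · rw [← hll, affineV_last, hi0, affineV_castSucc]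
    · rw [affineV_castSucc, ← hll, affineV_last, hi0]
    · refine ⟨⟨k + 2, hk⟩, rfl, ?_⟩
      have e1 : k = (⟨k, by omega⟩ : Fin n).castSucc := rfl
      have e2 : (⟨k, by omega⟩ : Fin n).succ = (⟨k + 1, by omega⟩ : Fin n).castSucc := rfl
      refine (congrArg (affineV (affineV w)) e1).trans ?_
      rw [affineV_castSucc, e2, affineV_castSucc]
      rfl
  obtain ⟨k1, k2, k3⟩ := key v
  obtain ⟨m1, m2, m3⟩ := key (v ∘ adj i)
  ext a
  rw [Function.comp_apply]
  by_cases h1 : a = l.castSucc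
  · rw [h1, adj_castSucc, k1, m2, Function.comp_apply, adj_castSucc]
  · by_cases h2 : a = l.succ
    · rw [h2, adj_succ, k2, m1, Function.comp_apply, adj_succ]
    · rw [adj_of_ne h1 h2]
      have ha : (a : ℕ) + 2 < n + 1 := by
        have := a.isLt
        simp [Fin.ext_iff] at h1 h2
        omega
      obtain ⟨p, hp, e⟩ := k3 a ha
      obtain ⟨p', hp', e'⟩ := m3 a ha
      obtain rfl : p = p' := Fin.ext (by omega)
      rw [e, e', Function.comp_apply, adj_of_ne] <;> simp [Fin.ext_iff] <;> omega

/-- The quantity that decreases with a step against the affine arrows. -/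
theorem sum_affineV (v : Fin (n + 1) → ℕ) : ∑ a, affineV v a = ∑ a, v a + 1 := by
  rw [Fin.sum_univ_castSucc, Fin.sum_univ_succ]
  simp only [affineV_castSucc, affineV_last]
  omega

/-- The weighted sum of exponents, which decreases with a step against an arrow `s_i`. -/
def weight (v : Fin (n + 1) → ℕ) : ℕ := ∑ a : Fin (n + 1), (n - a) * v a

theorem sum_comp_adj (v : Fin (n + 1) → ℕ) (i : Fin n) : ∑ a, (v ∘ adj i) a = ∑ a, v a :=
  Equiv.sum_comp (adj i) v

theorem weight_comp_adj {v : Fin (n + 1) → ℕ} {i : Fin n} (h : v i.succ < v i.castSucc) :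
    weight (v ∘ adj i) < weight v := by
  have hne : i.castSucc ≠ i.succ := Fin.castSucc_lt_succ.ne
  have split : ∀ w : Fin (n + 1) → ℕ, weight w =
      ∑ a ∈ (Finset.univ.erase i.succ).erase i.castSucc, (n - (a : ℕ)) * w a +
        (n - (i : ℕ)) * w i.castSucc + (n - (i + 1 : ℕ)) * w i.succ := by
    intro w
    rw [weight, ← Finset.sum_erase_add _ _ (Finset.mem_univ i.succ),
      ← Finset.sum_erase_add _ _ (Finset.mem_erase.2 ⟨hne, Finset.mem_univ i.castSucc⟩)]
    simp
  rw [split v, split (v ∘ adj i)]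
  have e : ∑ a ∈ (Finset.univ.erase i.succ).erase i.castSucc, (n - (a : ℕ)) * (v ∘ adj i) a =
      ∑ a ∈ (Finset.univ.erase i.succ).erase i.castSucc, (n - (a : ℕ)) * v a := by
    refine Finset.sum_congr rfl fun a ha => ?_
    simp only [Finset.mem_erase, Finset.mem_univ, and_true] at ha
    rw [Function.comp_apply, adj_of_ne ha.1 ha.2]
  rw [e, Function.comp_apply, Function.comp_apply, adj_castSucc, adj_succ]
  have hi := i.isLt
  obtain ⟨d, hd⟩ : ∃ d, n - (i : ℕ) = d + 1 := ⟨n - i - 1, by omega⟩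
  have hd' : n - ((i : ℕ) + 1) = d := by omega
  rw [hd, hd']
  nlinarith

end Rank

/-! ### The nonsymmetric Macdonald polynomials -/

section Macdonald

variable {K : Type*} [Field K]

/-- Genericity of the parameters: they are multiplicatively independent. -/
structure IsGeneric (q s : K) : Prop where
  q_ne_zero : q ≠ 0
  s_ne_zero : s ≠ 0
  indep : ∀ a b : ℤ, q ^ a * s ^ b = 1 → a = 0 ∧ b = 0

variable {n : ℕ} {μ : YoungDiagram} {q s : K}

theorem IsGeneric.s_zpow (G : IsGeneric q s) (m : ℤ) (hm : m ≠ 0) : s ^ m ≠ 1 := fun h =>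
  hm (G.indep 0 m (by simpa using h)).2

theorem IsGeneric.mul_injective (G : IsGeneric q s) {a a' : ℕ} {b b' : ℤ}
    (h : q ^ a * s ^ b = q ^ a' * s ^ b') : a = a' ∧ b = b' := by
  have h1 : q ^ ((a : ℤ) - a') * s ^ (b - b') = 1 := by
    rw [zpow_sub₀ G.q_ne_zero, zpow_sub₀ G.s_ne_zero, zpow_natCast, zpow_natCast, div_mul_div_comm,
      h, div_self]
    exact mul_ne_zero (pow_ne_zero _ G.q_ne_zero) (zpow_ne_zero _ G.s_ne_zero)
  have := G.indep _ _ h1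
  omega

theorem IsGeneric.heckeV_isHecke (G : IsGeneric q s) :
    IsHecke s (heckeV (K := K) (n := n) (μ := μ) s) :=
  VVMac.heckeV_isHecke G.s_ne_zero G.s_zpow

theorem IsGeneric.hecke_isHecke (G : IsGeneric q s) :
    IsHecke s (hecke (K := K) (n := n) (μ := μ) s) :=
  VVMac.hecke_isHecke G.heckeV_isHecke

/-- The operator of a step: `𝐓_i` shifted by a scalar that depends on the spectral values at the
source. -/
noncomputable def stepOp (s : K) (i : Fin n) (a b : K) (f : VPoly K n μ) : VPoly K n μ :=
  hecke s i f - diag s a b • f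

theorem diag_mul_left {c : K} (hc : c ≠ 0) (a b : K) : diag s (c * a) (c * b) = diag s a b := by
  rw [diag, diag, ← mul_sub, mul_left_comm, mul_div_mul_left _ _ hc]

theorem stepOp_mul_left {c : K} (hc : c ≠ 0) (i : Fin n) (a b : K) (f : VPoly K n μ) :
    stepOp s i (c * a) (c * b) f = stepOp s i a b f := by
  rw [stepOp, stepOp, diag_mul_left hc]

theorem stepOp_smul (i : Fin n) (a b c : K) (f : VPoly K n μ) :
    stepOp s i a b (c • f) = c • stepOp s i a b f := by
  rw [stepOp, stepOp, map_smul]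
  module

/-- The Yang-Baxter equation. -/
theorem stepOp_braid (H : IsHecke s (hecke (K := K) (n := n) (μ := μ) s)) {i j : Fin n}
    (hij : (j : ℕ) = i + 1) {x y z : K} (hxy : x ≠ y) (hyz : y ≠ z) (hxz : x ≠ z)
    (f : VPoly K n μ) :
    stepOp s i y z (stepOp s j x z (stepOp s i x y f)) =
      stepOp s j x y (stepOp s i x z (stepOp s j y z f)) := by
  have e : diag s x y * diag s y z =
      diag s x z * (diag s x y + diag s y z - (s - 1)) := by
    have h1 := sub_ne_zero.2 hxy
    have h2 := sub_ne_zero.2 hyz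
    have h3 := sub_ne_zero.2 hxz
    simp only [diag]
    field_simp
    ring
  have hb := H.braid i j hij f
  have qi := H.quad i f
  have qj := H.quad j f
  simp only [stepOp, map_sub, map_smul]
  linear_combination (norm := module) hb - diag s x z • qi + diag s x z • qj +
    e • (hecke s j f) - e • (hecke s i f)

theorem stepOp_comm (H : IsHecke s (hecke (K := K) (n := n) (μ := μ) s)) {i j : Fin n}
    (hij : (i : ℕ) + 1 < j ∨ (j : ℕ) + 1 < i) (a b c d : K) (f : VPoly K n μ) :
    stepOp s i a b (stepOp s j c d f) = stepOp s j c d (stepOp s i a b f) := by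
  have h : hecke s i (hecke s j f) = hecke s j (hecke s i f) := by
    rcases hij with h | h
    · exact H.comm i j h f
    · exact (H.comm j i h f).symm
  simp only [stepOp, map_sub, map_smul]
  linear_combination (norm := module) h

theorem raising_stepOp (hs : s ≠ 0) (H : IsHecke s (hecke (K := K) (n := n) (μ := μ) s))
    {i j : Fin n} (hij : (j : ℕ) = i + 1) (a b : K) (f : VPoly K n μ) :
    raising s (stepOp s j a b f) = stepOp s i a b (raising s f) := by
  rw [stepOp, stepOp, map_sub, map_smul, raising_hecke hs H hij]

theorem raising_raising_stepOp (hs : s ≠ 0)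
    (H : IsHecke s (hecke (K := K) (n := n) (μ := μ) s)) {i l : Fin n} (hi : (i : ℕ) = 0)
    (hl : (l : ℕ) + 1 = n) (a b : K) (f : VPoly K n μ) :
    raising s (raising s (stepOp s i a b f)) = stepOp s l a b (raising s (raising s f)) := by
  rw [stepOp, stepOp, map_sub, map_sub, map_smul, map_smul, raising_raising_hecke hs H hi hl]

open Classical in
/-- The nonsymmetric Macdonald polynomial `P_{v,𝕋}`, defined by recursion on `v` along paths that
end with an affine arrow or a step. -/
noncomputable def mac (q s : K) (v : Fin (n + 1) → ℕ) (t : RST n μ) : VPoly K n μ :=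
  if _h : v (Fin.last n) ≠ 0 then raising s (mac q s (lowerV v) t)
  else if h : ∃ i : Fin n, v i.succ < v i.castSucc then
    stepOp s h.choose (spec q s (t, v) h.choose.succ) (spec q s (t, v) h.choose.castSucc)
      (mac q s (v ∘ adj h.choose) t)
  else (1 : MvPolynomial (Fin (n + 1)) K) ⊗ₜ[K] Finsupp.single t 1
termination_by (∑ a, v a, weight v)
decreasing_by
  · apply Prod.Lex.left
    have := sum_affineV (lowerV v)
    rw [affineV_lowerV _h] at this
    omega
  · have := sum_comp_adj v h.choose
    rw [this]
    exact Prod.Lex.right _ (weight_comp_adj h.choose_spec)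

theorem mac_affineV (v : Fin (n + 1) → ℕ) (t : RST n μ) :
    mac q s (affineV v) t = raising s (mac q s v t) := by
  rw [mac, dif_pos (by simp), lowerV_affineV]

theorem mac_zero (t : RST n μ) : mac q s (fun _ => 0) t =
    (1 : MvPolynomial (Fin (n + 1)) K) ⊗ₜ[K] Finsupp.single t 1 := by
  rw [mac, dif_neg (by simp), dif_neg (by simp)]

theorem exists_mac_eq {v : Fin (n + 1) → ℕ} (h0 : v (Fin.last n) = 0)
    (h : ∃ i : Fin n, v i.succ < v i.castSucc) :
    ∃ i : Fin n, v i.succ < v i.castSucc ∧ ∀ t : RST n μ,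
      mac q s v t = stepOp s i (spec q s (t, v) i.succ) (spec q s (t, v) i.castSucc)
        (mac q s (v ∘ adj i) t) :=
  ⟨h.choose, h.choose_spec, fun t => by rw [mac, dif_neg (by simp [h0]), dif_pos h]⟩

theorem spec_apply (t : RST n μ) (v : Fin (n + 1) → ℕ) (a : Fin (n + 1)) :
    spec q s (t, v) a = q ^ v a * s ^ t.content (rank v a) := rfl

theorem spec_comp_adj {v : Fin (n + 1) → ℕ} {i : Fin n} (h : v i.castSucc ≠ v i.succ)
    (t : RST n μ) (a : Fin (n + 1)) :
    spec q s (t, v ∘ adj i) a = spec q s (t, v) (adj i a) := by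
  rw [spec_apply, spec_apply, rank_comp_adj h, Function.comp_apply]

theorem spec_affineV (t : RST n μ) (v : Fin (n + 1) → ℕ) :
    spec q s (t, affineV v) (Fin.last n) = q * spec q s (t, v) 0 ∧
      ∀ i : Fin n, spec q s (t, affineV v) i.castSucc = spec q s (t, v) i.succ := by
  obtain ⟨h1, h2⟩ := rank_affineV v
  refine ⟨?_, fun i => ?_⟩
  · rw [spec_apply, spec_apply, h1, affineV_last, pow_succ]
    ring
  · rw [spec_apply, spec_apply, h2, affineV_castSucc]

theorem IsGeneric.spec_ne (G : IsGeneric q s) (t : RST n μ) {v : Fin (n + 1) → ℕ}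
    {a b : Fin (n + 1)} (h : v a ≠ v b) : spec q s (t, v) a ≠ spec q s (t, v) b := fun e =>
  h (G.mul_injective e).1

/-- The transformation rule of the Macdonald polynomials along the steps. -/
def StepRule (q s : K) (μ : YoungDiagram) (v : Fin (n + 1) → ℕ) : Prop :=
  ∀ i : Fin n, v i.succ < v i.castSucc → ∀ t : RST n μ,
    mac q s v t = stepOp s i (spec q s (t, v) i.succ) (spec q s (t, v) i.castSucc)
      (mac q s (v ∘ adj i) t)

/-- At equal consecutive exponents the operator `𝐓_i` acts as the generator of the Hecke algebra
acts on the tableau. It comprises the rule for the jumps. -/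
def EqualRule (q s : K) (μ : YoungDiagram) (v : Fin (n + 1) → ℕ) : Prop :=
  ∀ i k : Fin n, v i.castSucc = v i.succ → rank v i.castSucc = k.castSucc →
    rank v i.succ = k.succ → ∀ t : RST n μ,
    stepOp s i (spec q s (t, v) i.castSucc) (spec q s (t, v) i.succ) (mac q s v t) =
      cellCoef s (t.1 k.castSucc) (t.1 k.succ) •
        mac q s v (t.exchange k.castSucc k.succ)

theorem content_exchange {t : RST n μ} {k : Fin n}
    (h : cellCoef s (t.1 k.castSucc) (t.1 k.succ) ≠ 0) (a : Fin (n + 1)) :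
    (t.exchange k.castSucc k.succ).content a = t.content (adj k a) := by
  have h1 : ¬ ((t.1 k.castSucc).1.1 = (t.1 k.succ).1.1 ∨
      (t.1 k.castSucc).1.2 = (t.1 k.succ).1.2) := fun h1 => h (by rw [cellCoef, if_pos h1])
  obtain ⟨h2, h3⟩ := not_or.1 h1
  simp only [RST.content, RST.row, RST.col, exchange_val h2 h3, Equiv.trans_apply]

theorem equalRule_zero (G : IsGeneric q s) : EqualRule q s μ (fun _ : Fin (n + 1) => 0) := by
  intro i k _ hk _ t
  rw [rank_zero] at hk
  obtain rfl : i = k := Fin.castSucc_injective n hk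
  have hX : swapX K i (1 : MvPolynomial (Fin (n + 1)) K) = 1 := by simp [swapX]
  have hd : delta s i (1 : MvPolynomial (Fin (n + 1)) K) = 0 := by
    have : divDiff K i (1 : MvPolynomial (Fin (n + 1)) K) = 0 := by
      apply mul_left_cancel₀ (X_sub_X_ne_zero (K := K) i)
      rw [X_sub_X_mul_divDiff, hX]
      simp
    rw [delta_apply, this]
    simp
  rw [stepOp, mac_zero, mac_zero, hecke_tmul, hX, hd, heckeV_single G.s_ne_zero G.s_zpow,
    spec_apply, spec_apply, rank_zero, rank_zero]
  simp only [pow_zero, one_mul, TensorProduct.zero_tmul, TensorProduct.tmul_add,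
    TensorProduct.tmul_smul]
  module

end Macdonald

/-! ### The transformation rules of the Macdonald polynomials -/

section Rules

variable {K : Type*} [Field K] {n : ℕ} {μ : YoungDiagram} {q s : K}

/-- The rule of the steps at `affineV u`: a step that does not involve the last position comes from
`u` by shifting the indices; the step at the last position comes from the first step at `w`, where
`u = affineV w`. -/
theorem stepRule_affineV (G : IsGeneric q s) {u : Fin (n + 1) → ℕ} (hu : StepRule q s μ u)
    (hu' : ∀ w, u = affineV w → StepRule q s μ w) : StepRule q s μ (affineV u) := by
  intro i hi t
  have H := G.hecke_isHecke (n := n) (μ := μ)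
  by_cases hn : (i : ℕ) + 1 < n
  · have hij : ((⟨i + 1, hn⟩ : Fin n) : ℕ) = i + 1 := rfl
    generalize (⟨i + 1, hn⟩ : Fin n) = j at hij
    have hs : j.castSucc = i.succ := (adj_near hij).1
    rw [← hs, affineV_castSucc, affineV_castSucc, ← hs] at hi
    rw [mac_affineV, hu j hi t, raising_stepOp G.s_ne_zero H hij, affineV_comp_adj u hij,
      mac_affineV, ← hs, (spec_affineV t u).2, (spec_affineV t u).2, hs]
  · have hl : (i : ℕ) + 1 = n := by omega
    have hll : i.succ = Fin.last n := Fin.ext (by simp [hl])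
    rw [hll, affineV_castSucc, affineV_last, hll] at hi
    obtain ⟨w, rfl⟩ : ∃ w, u = affineV w := ⟨lowerV u, (affineV_lowerV (by omega)).symm⟩
    have hi0 : ((⟨0, by omega⟩ : Fin n) : ℕ) = 0 := rfl
    generalize (⟨0, by omega⟩ : Fin n) = j at hi0
    have h0 : (0 : Fin (n + 1)) = j.castSucc := Fin.ext (by simp [hi0])
    rw [affineV_last, h0, affineV_castSucc] at hi
    have e1 : spec q s (t, affineV (affineV w)) i.succ = q * spec q s (t, w) j.succ := by
      rw [hll, (spec_affineV t _).1, h0, (spec_affineV t _).2]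
    have e2 : spec q s (t, affineV (affineV w)) i.castSucc = q * spec q s (t, w) j.castSucc := by
      rw [(spec_affineV t _).2, hll, (spec_affineV t _).1, h0]
    rw [mac_affineV, mac_affineV, hu' w rfl j (by omega) t,
      raising_raising_stepOp G.s_ne_zero H hi0 hl, affineV_affineV_comp_adj w hi0 hl, mac_affineV,
      mac_affineV, e1, e2, stepOp_mul_left G.q_ne_zero]

/-- The analogue of `stepRule_affineV` for equal consecutive exponents. -/
theorem equalRule_affineV (G : IsGeneric q s) {u : Fin (n + 1) → ℕ} (hu : EqualRule q s μ u)
    (hu' : ∀ w, u = affineV w → EqualRule q s μ w) : EqualRule q s μ (affineV u) := by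
  intro i k hi hk hk' t
  have H := G.hecke_isHecke (n := n) (μ := μ)
  by_cases hn : (i : ℕ) + 1 < n
  · have hij : ((⟨i + 1, hn⟩ : Fin n) : ℕ) = i + 1 := rfl
    generalize (⟨i + 1, hn⟩ : Fin n) = j at hij
    have hs : j.castSucc = i.succ := (adj_near hij).1
    rw [← hs, affineV_castSucc, affineV_castSucc, ← hs] at hi
    rw [(rank_affineV u).2, ← hs] at hk
    rw [← hs, (rank_affineV u).2] at hk'
    rw [mac_affineV, mac_affineV, ← hs, (spec_affineV t u).2, (spec_affineV t u).2, ← hs,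
      ← raising_stepOp G.s_ne_zero H hij, hu j k hi hk hk' t, map_smul]
  · have hl : (i : ℕ) + 1 = n := by omega
    have hll : i.succ = Fin.last n := Fin.ext (by simp [hl])
    rw [hll, affineV_castSucc, affineV_last, hll] at hi
    obtain ⟨w, rfl⟩ : ∃ w, u = affineV w := ⟨lowerV u, (affineV_lowerV (by omega)).symm⟩
    have hi0 : ((⟨0, by omega⟩ : Fin n) : ℕ) = 0 := rfl
    generalize (⟨0, by omega⟩ : Fin n) = j at hi0
    have h0 : (0 : Fin (n + 1)) = j.castSucc := Fin.ext (by simp [hi0])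
    rw [affineV_last, h0, affineV_castSucc] at hi
    rw [(rank_affineV _).2, hll, (rank_affineV _).1, h0] at hk
    rw [hll, (rank_affineV _).1, h0, (rank_affineV _).2] at hk'
    have e1 : spec q s (t, affineV (affineV w)) i.succ = q * spec q s (t, w) j.succ := by
      rw [hll, (spec_affineV t _).1, h0, (spec_affineV t _).2]
    have e2 : spec q s (t, affineV (affineV w)) i.castSucc = q * spec q s (t, w) j.castSucc := by
      rw [(spec_affineV t _).2, hll, (spec_affineV t _).1, h0]
    rw [e1, e2, stepOp_mul_left G.q_ne_zero, mac_affineV, mac_affineV,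
      ← raising_raising_stepOp G.s_ne_zero H hi0 hl, hu' w rfl j k (by omega) hk hk' t, map_smul,
      map_smul, mac_affineV, mac_affineV]

/-- At three decreasing exponents the two ways to descend agree, by the Yang-Baxter equation. -/
theorem hexagon (G : IsGeneric q s) {v : Fin (n + 1) → ℕ} {i j : Fin n} (hij : (j : ℕ) = i + 1)
    (h1 : v i.succ < v i.castSucc) (h2 : v j.succ < v i.succ)
    (ri : StepRule q s μ (v ∘ adj i)) (rij : StepRule q s μ ((v ∘ adj i) ∘ adj j))
    (rj : StepRule q s μ (v ∘ adj j)) (rji : StepRule q s μ ((v ∘ adj j) ∘ adj i)) (t : RST n μ) :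
    stepOp s i (spec q s (t, v) i.succ) (spec q s (t, v) i.castSucc) (mac q s (v ∘ adj i) t) =
      stepOp s j (spec q s (t, v) j.succ) (spec q s (t, v) j.castSucc)
        (mac q s (v ∘ adj j) t) := by
  obtain ⟨hs, a1, a2, a3, a4⟩ := adj_near hij
  have b1 : v i.castSucc ≠ v i.succ := h1.ne'
  have b2 : v j.castSucc ≠ v j.succ := by rw [hs]; exact h2.ne'
  have b3 : (v ∘ adj i) j.castSucc ≠ (v ∘ adj i) j.succ := by simp [hs, a1]; omega
  have b4 : (v ∘ adj j) i.castSucc ≠ (v ∘ adj j) i.succ := by simp [a2, a3]; omega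
  rw [ri j (by simp [hs, a1]; omega), rij i (by simp [a1, a2, a3]; omega),
    rj i (by simp [a2, a3]; omega), rji j (by simp [hs, a1, a2]; omega)]
  simp only [spec_comp_adj b1, spec_comp_adj b2, spec_comp_adj b3, spec_comp_adj b4, hs, a1, a2,
    a3, a4, adj_castSucc, adj_succ]
  have hX : ((v ∘ adj i) ∘ adj j) ∘ adj i = ((v ∘ adj j) ∘ adj i) ∘ adj j := by
    funext a
    exact congrArg v (Equiv.congr_fun (adj_braid hij) a)
  rw [hX]
  exact stepOp_braid G.hecke_isHecke hij (G.spec_ne t h2.ne) (G.spec_ne t h1.ne)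
    (G.spec_ne t (by omega)) _

/-- If the polynomials at `v` are obtained from the descent at `j`, they are obtained from every
other descent `i` in the same way: for distant `i` and `j` since the generators commute, for adjacent
ones by `hexagon`. -/
theorem stepRule_of_descent (G : IsGeneric q s) {v : Fin (n + 1) → ℕ} {j : Fin n}
    (hj : v j.succ < v j.castSucc)
    (hv : ∀ t : RST n μ, mac q s v t =
      stepOp s j (spec q s (t, v) j.succ) (spec q s (t, v) j.castSucc) (mac q s (v ∘ adj j) t))
    (r1 : ∀ i : Fin n, v i.succ < v i.castSucc → StepRule q s μ (v ∘ adj i))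
    (r2 : ∀ i j : Fin n, v i.succ < v i.castSucc → (v ∘ adj i) j.succ < (v ∘ adj i) j.castSucc →
      StepRule q s μ ((v ∘ adj i) ∘ adj j)) : StepRule q s μ v := by
  intro i hi t
  rw [hv t]
  have far : ∀ i j : Fin n, (i : ℕ) + 1 < j ∨ (j : ℕ) + 1 < i → adj i j.castSucc = j.castSucc ∧
      adj i j.succ = j.succ ∧ adj j i.castSucc = i.castSucc ∧ adj j i.succ = i.succ := by
    rintro i j (h | h)
    · exact adj_far h
    · obtain ⟨a1, a2, a3, a4⟩ := adj_far h
      exact ⟨a3, a4, a1, a2⟩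
  by_cases hf : (i : ℕ) + 1 < j ∨ (j : ℕ) + 1 < i
  · obtain ⟨a1, a2, a3, a4⟩ := far i j hf
    rw [r1 j hj i (by simpa [a3, a4] using hi), r1 i hi j (by simpa [a1, a2] using hj)]
    simp only [spec_comp_adj hi.ne', spec_comp_adj hj.ne', a1, a2, a3, a4]
    rw [stepOp_comm G.hecke_isHecke hf]
    have e : (v ∘ adj j) ∘ adj i = (v ∘ adj i) ∘ adj j := by
      funext a
      have : adj i * adj j = adj j * adj i := by
        rcases hf with h | h
        · exact adj_comm h
        · exact (adj_comm h).symm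
      exact congrArg v (Equiv.congr_fun this.symm a)
    rw [e]
  · rcases lt_trichotomy (i : ℕ) j with h | h | h
    · have hij : (j : ℕ) = i + 1 := by omega
      obtain ⟨hs, a1, a2, a3, a4⟩ := adj_near hij
      rw [hs] at hj
      exact (hexagon G hij hi hj (r1 i hi) (r2 i j hi (by simp [hs, a1]; omega)) (r1 j (by rwa [hs]))
        (r2 j i (by rwa [hs]) (by simp [a2, a3]; omega)) t).symm
    · rw [Fin.ext h]
    · have hij : (i : ℕ) = j + 1 := by omega
      obtain ⟨hs, a1, a2, a3, a4⟩ := adj_near hij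
      rw [hs] at hi
      exact hexagon G hij hj hi (r1 j hj) (r2 j i hj (by simp [hs, a1]; omega)) (r1 i (by rwa [hs]))
        (r2 i j (by rwa [hs]) (by simp [a2, a3]; omega)) t

theorem spec_exchange {v : Fin (n + 1) → ℕ} {i k : Fin n} (hi : v i.castSucc = v i.succ)
    (hk : rank v i.castSucc = k.castSucc) (hk' : rank v i.succ = k.succ) {t : RST n μ}
    (h : cellCoef s (t.1 k.castSucc) (t.1 k.succ) ≠ 0) (a : Fin (n + 1)) :
    spec q s (t.exchange k.castSucc k.succ, v) a = spec q s (t, v) (adj i a) := by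
  rw [spec_apply, spec_apply, content_exchange h]
  by_cases h1 : a = i.castSucc
  · rw [h1, adj_castSucc, hk, hk', adj_castSucc, hi]
  · by_cases h2 : a = i.succ
    · rw [h2, adj_succ, hk, hk', adj_succ, hi]
    · rw [adj_of_ne h1 h2, adj_of_ne]
      · rw [← hk]; exact fun e => h1 (rank_injective v e)
      · rw [← hk']; exact fun e => h2 (rank_injective v e)

theorem IsGeneric.spec_ne_of_eq (G : IsGeneric q s) {v : Fin (n + 1) → ℕ} {i k : Fin n}
    (hk : rank v i.castSucc = k.castSucc) (hk' : rank v i.succ = k.succ) (t : RST n μ) :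
    spec q s (t, v) i.castSucc ≠ spec q s (t, v) i.succ := fun e => by
  have := (G.mul_injective e).2
  rw [hk, hk'] at this
  exact content_ne_succ t k this

/-- If the polynomials at `v` are obtained from a descent at `j`, the rule for equal exponents at `i`
follows from the same rule at an exponent of smaller weight. For adjacent `i` and `j` this exponent is
reached by two steps, and the Yang-Baxter equation moves the operator at `i` through both. -/
theorem equalRule_of_descent (G : IsGeneric q s) {v : Fin (n + 1) → ℕ} {j : Fin n}
    (hj : v j.succ < v j.castSucc)
    (hv : ∀ t : RST n μ, mac q s v t =
      stepOp s j (spec q s (t, v) j.succ) (spec q s (t, v) j.castSucc) (mac q s (v ∘ adj j) t))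
    (r1 : StepRule q s μ (v ∘ adj j)) (e1 : EqualRule q s μ (v ∘ adj j))
    (e2 : ∀ i : Fin n, (v ∘ adj j) i.succ < (v ∘ adj j) i.castSucc →
      EqualRule q s μ ((v ∘ adj j) ∘ adj i)) : EqualRule q s μ v := by
  intro i k hi hk hk' t
  have H := G.hecke_isHecke (n := n) (μ := μ)
  have hc := fun h a => spec_exchange (q := q) (s := s) (t := t) hi hk hk' h a
  set t' := t.exchange k.castSucc k.succ
  have hsm : ∀ {x y : VPoly K n μ}, (cellCoef s (t.1 k.castSucc) (t.1 k.succ) ≠ 0 → x = y) →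
      cellCoef s (t.1 k.castSucc) (t.1 k.succ) • x =
        cellCoef s (t.1 k.castSucc) (t.1 k.succ) • y := by
    intro x y h
    by_cases h0 : cellCoef s (t.1 k.castSucc) (t.1 k.succ) = 0
    · rw [h0, zero_smul, zero_smul]
    · rw [h h0]
  have hne := G.spec_ne_of_eq hk hk' t
  by_cases hf : (i : ℕ) + 1 < j ∨ (j : ℕ) + 1 < i
  · obtain ⟨a1, a2, a3, a4⟩ : adj i j.castSucc = j.castSucc ∧ adj i j.succ = j.succ ∧
        adj j i.castSucc = i.castSucc ∧ adj j i.succ = i.succ := by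
      rcases hf with h | h
      · exact adj_far h
      · obtain ⟨a1, a2, a3, a4⟩ := adj_far h
        exact ⟨a3, a4, a1, a2⟩
    have h1 := e1 i k (by simpa [a3, a4] using hi) (by rw [rank_comp_adj hj.ne', a3, hk])
      (by rw [rank_comp_adj hj.ne', a4, hk']) t
    rw [spec_comp_adj hj.ne', spec_comp_adj hj.ne', a3, a4] at h1
    rw [hv t, stepOp_comm H hf, h1, stepOp_smul]
    refine hsm fun h0 => ?_
    rw [hv t', hc h0, hc h0, a1, a2]
  · rcases lt_trichotomy (i : ℕ) j with h | h | h
    · have hij : (j : ℕ) = i + 1 := by omega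
      obtain ⟨hs, a1, a2, a3, a4⟩ := adj_near hij
      have hj' := hj
      rw [hs] at hj
      have d2 : (v ∘ adj j) i.succ < (v ∘ adj j) i.castSucc := by simp [a2, a3]; omega
      have h1 := fun t => r1 i d2 t
      have h2 := e2 i d2 j k (by simp [hs, a2, a4, a1, hi])
        (by rw [rank_comp_adj d2.ne', rank_comp_adj hj'.ne', hs, adj_succ, a2, hk])
        (by rw [rank_comp_adj d2.ne', rank_comp_adj hj'.ne', a1, a4, hk']) t
      simp only [spec_comp_adj d2.ne', spec_comp_adj hj'.ne', hs, a1, a2, a3, a4, adj_succ] at h1 h2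
      rw [hv t, h1 t, hs, stepOp_braid H hij (G.spec_ne t (by omega)) hne
        (G.spec_ne t (by omega)), h2, stepOp_smul, stepOp_smul]
      refine hsm fun h0 => ?_
      rw [hv t', h1 t', hs]
      simp only [hc h0, adj_castSucc, adj_succ, a1]
      rfl
    · rw [Fin.ext h] at hi
      omega
    · have hij : (i : ℕ) = j + 1 := by omega
      obtain ⟨hs, a1, a2, a3, a4⟩ := adj_near hij
      rw [hs] at hi
      have d2 : (v ∘ adj j) i.succ < (v ∘ adj j) i.castSucc := by simp [hs, a1]; omega
      have h1 := fun t => r1 i d2 t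
      rw [hs] at hk hne
      have h2 := e2 i d2 j k (by simp [a2, a1, a3, hi])
        (by rw [rank_comp_adj d2.ne', rank_comp_adj hj.ne', a2, adj_castSucc, hk])
        (by rw [rank_comp_adj d2.ne', rank_comp_adj hj.ne', a3, a1, hk']) t
      simp only [spec_comp_adj d2.ne', spec_comp_adj hj.ne', hs, a1, a2, a3, adj_castSucc,
        adj_succ] at h1 h2
      rw [hv t, h1 t, hs, ← stepOp_braid H hij hne (G.spec_ne t (by omega))
        (G.spec_ne t (by omega)), h2, stepOp_smul, stepOp_smul]
      refine hsm fun h0 => ?_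
      rw [hv t', h1 t']
      have c1 := hc h0 j.castSucc
      have c2 := hc h0 j.succ
      have c3 := hc h0 i.succ
      rw [a2] at c1
      rw [a3] at c2
      rw [a4] at c3
      rw [c1, c2, c3]

/-- Induction on exponents: along the affine operation and along steps. -/
theorem exponent_induction {C : (Fin (n + 1) → ℕ) → Prop}
    (h : ∀ v, (∀ w, ∑ a, w a < ∑ a, v a → C w) →
      (∀ w, ∑ a, w a = ∑ a, v a → weight w < weight v → C w) → C v) (v : Fin (n + 1) → ℕ) :
    C v := by
  have wf : WellFounded (InvImage (Prod.Lex (· < ·) (· < ·))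
      fun v : Fin (n + 1) → ℕ => (∑ a, v a, weight v)) :=
    InvImage.wf _ (WellFounded.prod_lex Nat.lt_wfRel.wf Nat.lt_wfRel.wf)
  induction v using wf.induction with
  | _ v ih =>
    refine h v (fun w hw => ih w (Prod.Lex.left _ _ hw)) fun w hw hw' => ih w ?_
    simp only [InvImage]
    rw [hw]
    exact Prod.Lex.right _ hw'

theorem eq_zero_of_no_descent {v : Fin (n + 1) → ℕ} (h0 : v (Fin.last n) = 0)
    (h : ¬ ∃ i : Fin n, v i.succ < v i.castSucc) : v = fun _ => 0 := by
  have hm : Monotone v := Fin.monotone_iff_le_succ.2 fun i => not_lt.1 fun hi => h ⟨i, hi⟩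
  funext a
  have := hm (Fin.le_last a)
  omega

/-- The nonsymmetric Macdonald polynomials satisfy the transformation rules at every exponent. -/
theorem mac_rules (G : IsGeneric q s) (v : Fin (n + 1) → ℕ) :
    StepRule q s μ v ∧ EqualRule q s μ v := by
  induction v using exponent_induction with
  | _ v ih1 ih2 =>
  by_cases h0 : v (Fin.last n) = 0
  · by_cases h : ∃ i : Fin n, v i.succ < v i.castSucc
    · obtain ⟨j, hj, hv⟩ := exists_mac_eq (q := q) (s := s) (μ := μ) h0 h
      have i1 : ∀ i : Fin n, v i.succ < v i.castSucc →
          StepRule q s μ (v ∘ adj i) ∧ EqualRule q s μ (v ∘ adj i) := fun i hi =>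
        ih2 _ (sum_comp_adj v i) (weight_comp_adj hi)
      have i2 : ∀ i j : Fin n, v i.succ < v i.castSucc →
          (v ∘ adj i) j.succ < (v ∘ adj i) j.castSucc →
          StepRule q s μ ((v ∘ adj i) ∘ adj j) ∧ EqualRule q s μ ((v ∘ adj i) ∘ adj j) :=
        fun i j hi hij => ih2 _ ((sum_comp_adj _ j).trans (sum_comp_adj v i))
          ((weight_comp_adj hij).trans (weight_comp_adj hi))
      exact ⟨stepRule_of_descent G hj hv (fun i hi => (i1 i hi).1)
        fun i j hi hij => (i2 i j hi hij).1, equalRule_of_descent G hj hv (i1 j hj).1 (i1 j hj).2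
        fun i hi => (i2 j i hj hi).2⟩
    · obtain rfl := eq_zero_of_no_descent h0 h
      exact ⟨fun i hi => absurd hi (lt_irrefl 0), equalRule_zero G⟩
  · obtain ⟨u, rfl⟩ : ∃ u, v = affineV u := ⟨lowerV v, (affineV_lowerV h0).symm⟩
    have s1 := sum_affineV u
    have i1 := ih1 u (by omega)
    have i2 : ∀ w, u = affineV w → StepRule q s μ w ∧ EqualRule q s μ w := fun w hw => by
      have := sum_affineV w
      rw [← hw] at this
      exact ih1 w (by omega)
    exact ⟨stepRule_affineV G i1.1 fun w hw => (i2 w hw).1,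
      equalRule_affineV G i1.2 fun w hw => (i2 w hw).2⟩

end Rules

/-! ### Paths in the Yang-Baxter graph -/

section Paths

variable {K : Type*} [Field K] {n : ℕ} {μ : YoungDiagram} {q s : K}

theorem adj_comp_adj (i : Fin n) : adj i ∘ adj i = id := funext (adj_adj i)

theorem Arrow.jump_exchange {i : Fin n} {x : Vertex n μ} (h1 : x.2 i.castSucc = x.2 i.succ)
    (h2 : x.1.content (rank x.2 i.succ) + 2 ≤ x.1.content (rank x.2 i.castSucc)) :
    ∃ k : Fin n, rank x.2 i.castSucc = k.castSucc ∧ rank x.2 i.succ = k.succ ∧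
      x.1.row k.castSucc < x.1.row k.succ ∧ x.1.col k.succ < x.1.col k.castSucc := by
  obtain ⟨k, hk, hk'⟩ := rank_succ_of_eq h1
  rw [hk, hk'] at h2
  have := consecutive x.1 k
  simp only [RST.content] at h2
  exact ⟨k, hk, hk', by omega, by omega⟩

theorem arrow_mac (G : IsGeneric q s) {i : Fin n} {x y : Vertex n μ} (h : Arrow i x y) :
    mac q s y.2 y.1 =
      stepOp s i (spec q s x i.castSucc) (spec q s x i.succ) (mac q s x.2 x.1) := by
  obtain ⟨t, v⟩ := x
  rcases h with ⟨h1, rfl⟩ | ⟨h1, h2, rfl⟩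
  · simp only at h1
    rw [(mac_rules G (v ∘ adj i)).1 i (by simpa using h1) t, spec_comp_adj h1.ne,
      spec_comp_adj h1.ne, adj_castSucc, adj_succ, Function.comp_assoc, adj_comp_adj,
      Function.comp_id]
  · obtain ⟨k, hk, hk', h3, h4⟩ := Arrow.jump_exchange h1 h2
    simp only at h1 hk hk'
    rw [(mac_rules G v).2 i k h1 hk hk' t, cellCoef_of_lt h3 h4.ne', one_smul, hk, hk']

theorem IsGeneric.spec_ne_zero (G : IsGeneric q s) (x : Vertex n μ) (a : Fin (n + 1)) :
    spec q s x a ≠ 0 :=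
  mul_ne_zero (pow_ne_zero _ G.q_ne_zero) (zpow_ne_zero _ G.s_ne_zero)

theorem PathPoly.eq_mac (G : IsGeneric q s) {x : Vertex n μ} {f : VPoly K n μ}
    (h : PathPoly q s x f) : f = mac q s x.2 x.1 := by
  induction h with
  | nil t ht => exact (mac_zero t).symm
  | arrow i x y f _ hxy ih =>
    have h0 := G.spec_ne_zero x i.castSucc
    have e : (1 - s) / (1 - spec q s x i.succ / spec q s x i.castSucc) =
        -diag s (spec q s x i.castSucc) (spec q s x i.succ) := by
      rw [diag, ← neg_div, ← neg_mul, neg_sub, one_sub_div h0, div_div_eq_mul_div]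
    rw [arrow_mac G hxy, ← ih, stepOp, e]
    module
  | affine x f _ ih =>
    rw [ih, ← mac_affineV]
    rfl

theorem exchange_row {t : RST n μ} {k : Fin n} (h1 : t.row k.castSucc ≠ t.row k.succ)
    (h2 : t.col k.castSucc ≠ t.col k.succ) :
    (t.exchange k.castSucc k.succ).row = t.row ∘ adj k := by
  funext a
  simp only [RST.row, exchange_val h1 h2, Equiv.trans_apply, Function.comp_apply]

theorem exchange_col {t : RST n μ} {k : Fin n} (h1 : t.row k.castSucc ≠ t.row k.succ)
    (h2 : t.col k.castSucc ≠ t.col k.succ) :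
    (t.exchange k.castSucc k.succ).col = t.col ∘ adj k := by
  funext a
  simp only [RST.col, exchange_val h1 h2, Equiv.trans_apply, Function.comp_apply]

theorem exchange_exchange {t : RST n μ} {k : Fin n} (h1 : t.row k.castSucc ≠ t.row k.succ)
    (h2 : t.col k.castSucc ≠ t.col k.succ) :
    (t.exchange k.castSucc k.succ).exchange k.castSucc k.succ = t := by
  apply Subtype.ext
  rw [exchange_val, exchange_val h1 h2]
  · ext a : 1
    simp [adj_adj]
  · simpa [exchange_row h1 h2] using h1.symm
  · simpa [exchange_col h1 h2] using h2.symm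

theorem isInitial_of_forall (t : RST n μ) (h : ∀ k : Fin n,
    t.col k.succ < t.col k.castSucc ∨
      (t.col k.succ = t.col k.castSucc ∧ t.row k.succ < t.row k.castSucc)) : t.IsInitial := by
  have : StrictAnti fun a => toLex (t.col a, t.row a) :=
    Fin.strictAnti_iff_succ_lt.2 fun k => Prod.Lex.lt_iff.2 (h k)
  exact fun a b hab => Prod.Lex.lt_iff.1 (this hab)

/-- At exponent zero every tableau is reached by jumps from the initial one. -/
theorem exists_pathPoly_zero (m : ℕ) (t : RST n μ) (hm : weight t.row = m) :
    ∃ f, PathPoly q s (t, fun _ => 0) f := by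
  induction m using Nat.strong_induction_on generalizing t with
  | _ m ih =>
  by_cases h : ∃ k : Fin n, t.row k.succ < t.row k.castSucc ∧ t.col k.castSucc < t.col k.succ
  · obtain ⟨k, h1, h2⟩ := h
    obtain ⟨f, hf⟩ := ih (weight (t.exchange k.castSucc k.succ).row)
      (by rw [exchange_row h1.ne' h2.ne, ← hm]; exact weight_comp_adj h1) _ rfl
    refine ⟨_, hf.arrow k _ _ _ (Or.inr ⟨rfl, ?_, ?_⟩)⟩
    · simp only [rank_zero, RST.content, exchange_row h1.ne' h2.ne, exchange_col h1.ne' h2.ne,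
        Function.comp_apply, adj_castSucc, adj_succ]
      omega
    · simp only [rank_zero, exchange_exchange h1.ne' h2.ne]
  · refine ⟨_, .nil t (isInitial_of_forall t fun k => ?_)⟩
    have h1 := consecutive t k
    have h2 := not_and.1 (not_exists.1 h k)
    omega

theorem exists_pathPoly (x : Vertex n μ) : ∃ f, PathPoly q s x f := by
  obtain ⟨t, v⟩ := x
  induction v using exponent_induction with
  | _ v ih1 ih2 =>
  by_cases h0 : v (Fin.last n) = 0
  · by_cases h : ∃ i : Fin n, v i.succ < v i.castSucc
    · obtain ⟨i, hi⟩ := h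
      obtain ⟨f, hf⟩ := ih2 _ (sum_comp_adj v i) (weight_comp_adj hi)
      refine ⟨_, hf.arrow i _ _ _ (Or.inl ⟨by simpa using hi, ?_⟩)⟩
      simp only [Function.comp_assoc, adj_comp_adj, Function.comp_id]
    · rw [eq_zero_of_no_descent h0 h]
      exact exists_pathPoly_zero _ t rfl
  · have h1 := affineV_lowerV h0
    have h2 := sum_affineV (lowerV v)
    rw [h1] at h2
    obtain ⟨f, hf⟩ := ih1 (lowerV v) (by omega)
    have h3 : affine (t, lowerV v) = (t, v) := congrArg (Prod.mk t) h1
    exact ⟨_, h3 ▸ hf.affine _ _⟩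

theorem macdonald_eq_mac (G : IsGeneric q s) (x : Vertex n μ) :
    macdonald q s x = mac q s x.2 x.1 := by
  rw [macdonald, dif_pos (exists_pathPoly x)]
  exact (exists_pathPoly x).choose_spec.eq_mac G

end Paths

/-! ### The vertices of a component as orderings of the cells -/

section Ordering

variable {n : ℕ} {μ : YoungDiagram}

/-- The cells of the diagram in the order of the positions of `v`: position `i` is matched with
the cell of the entry `r_v[i]` of the tableau. -/
noncomputable def cellOrder (x : Vertex n μ) : Fin (n + 1) ≃ μ.cells :=
  (rankPerm x.2).trans x.1.1

theorem cellOrder_apply (x : Vertex n μ) (a : Fin (n + 1)) :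
    cellOrder x a = x.1.1 (rank x.2 a) := rfl

/-- Sorting `v` decreasingly moves its entries to their ranks. -/
theorem decreasing_rank (v : Fin (n + 1) → ℕ) (a : Fin (n + 1)) :
    decreasing v (rank v a) = v a := by
  let σ : Equiv.Perm (Fin (n + 1)) := Fin.revPerm.trans (rankPerm v).symm
  have hm : Monotone (v ∘ σ) := by
    intro b c hbc
    have h1 : rank v (σ b) = Fin.rev b := (rankPerm v).apply_symm_apply _
    have h2 : rank v (σ c) = Fin.rev c := (rankPerm v).apply_symm_apply _
    rcases before_trichotomy v (σ b) (σ c) with h | h | h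
    · rcases h with h | ⟨h, -⟩
      · have h3 := Fin.rev_le_rev.2 hbc
        rw [← h1, ← h2] at h3
        exact absurd (Before.rank_lt (Or.inl h)) h3.not_gt
      · exact h.le
    · exact (congrArg v h).le
    · rcases h with h | ⟨h, -⟩
      · exact h.le
      · exact h.ge
  have h := congrFun (Tuple.comp_sort_eq_comp_iff_monotone.2 hm) (Fin.rev (rank v a))
  simp only [Function.comp_apply] at h
  rw [decreasing, ← h]
  simp [σ, ← rankPerm_apply]

theorem fillingOf_cellOrder (x : Vertex n μ) (a : Fin (n + 1)) :
    fillingOf x (cellOrder x a) = x.2 a := by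
  rw [fillingOf, cellOrder_apply, Equiv.symm_apply_apply, decreasing_rank]

theorem fillingOf_eq_iff {x : Vertex n μ} {T : Filling μ} :
    fillingOf x = T ↔ ∀ a, x.2 a = T (cellOrder x a) := by
  constructor
  · rintro rfl a
    exact (fillingOf_cellOrder x a).symm
  · intro h
    funext c
    obtain ⟨a, rfl⟩ := (cellOrder x).surjective c
    rw [fillingOf_cellOrder, h]

/-- A vertex is determined by its filling and its order of the cells. -/
theorem vertex_ext {x y : Vertex n μ} {T : Filling μ} (hx : fillingOf x = T)
    (hy : fillingOf y = T) (h : cellOrder x = cellOrder y) : x = y := by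
  rw [fillingOf_eq_iff] at hx hy
  obtain ⟨t, v⟩ := x
  obtain ⟨t', v'⟩ := y
  obtain rfl : v = v' := funext fun a => (hx a).trans ((h ▸ hy a).symm)
  have h1 : t.1 = t'.1 := by
    ext1 b
    obtain ⟨a, rfl⟩ := (rankPerm v).surjective b
    exact Equiv.congr_fun h a
  rw [Subtype.ext h1]

theorem arrow_cellOrder {i : Fin n} {x y : Vertex n μ} (h : Arrow i x y) (a : Fin (n + 1)) :
    cellOrder y a = cellOrder x (adj i a) ∧ y.2 a = x.2 (adj i a) := by
  obtain ⟨t, v⟩ := x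
  rcases h with ⟨h1, rfl⟩ | ⟨h1, h2, rfl⟩
  · exact ⟨congrArg t.1 (rank_comp_adj h1.ne a), rfl⟩
  · obtain ⟨k, hk, hk', h3, h4⟩ := Arrow.jump_exchange h1 h2
    simp only at h1 hk hk' h3 h4 ⊢
    rw [cellOrder_apply, cellOrder_apply, hk, hk', exchange_val h3.ne h4.ne', Equiv.trans_apply]
    by_cases e1 : a = i.castSucc
    · rw [e1, adj_castSucc, hk, hk', adj_castSucc]
      exact ⟨rfl, h1⟩
    · by_cases e2 : a = i.succ
      · rw [e2, adj_succ, hk, hk', adj_succ]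
        exact ⟨rfl, h1.symm⟩
      · rw [adj_of_ne e1 e2, adj_of_ne]
        · exact ⟨rfl, rfl⟩
        · rw [← hk]; exact fun e => e1 (rank_injective v e)
        · rw [← hk']; exact fun e => e2 (rank_injective v e)

theorem arrow_fillingOf {i : Fin n} {x y : Vertex n μ} (h : Arrow i x y) :
    fillingOf y = fillingOf x := by
  rw [fillingOf_eq_iff]
  intro a
  rw [(arrow_cellOrder h a).1, (arrow_cellOrder h a).2, fillingOf_cellOrder]

/-- Arrows preserve the filling, so `H_T` consists exactly of the vertices with filling `T`. -/
theorem mem_component {x : Vertex n μ} {T : Filling μ} :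
    x ∈ component n T ↔ fillingOf x = T := by
  constructor
  · rintro ⟨y, rfl, h⟩
    induction h with
    | rel a b hab =>
      obtain ⟨i, hi⟩ := hab
      exact arrow_fillingOf hi
    | refl => rfl
    | symm a b _ ih => exact ih.symm
    | trans a b c _ _ h1 h2 => exact h2.trans h1
  · intro h
    exact ⟨x, h, Relation.EqvGen.refl x⟩

end Ordering

/-! ### Column-strict and row-strict fillings -/

section Strict

variable {n : ℕ} {μ : YoungDiagram}

/-- A common description of column-strict and row-strict fillings. The lines are the rows for
`ε = -1` and the columns for `ε = 1`; `l` is the line of a cell and `m` its place in the line. The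
filling increases weakly along the lines and strictly across them. -/
structure LineStrict (T : Filling μ) (ε : ℤ) (l m : μ.cells → ℕ) : Prop where
  coord : (ε = -1 ∧ (∀ c, l c = c.1.1) ∧ ∀ c, m c = c.1.2) ∨
    (ε = 1 ∧ (∀ c, l c = c.1.2) ∧ ∀ c, m c = c.1.1)
  weak : ∀ c d, l c = l d → m c ≤ m d → T c ≤ T d
  strict : ∀ c d, m c = m d → l c < l d → T c < T d

theorem ColumnStrict.lineStrict {T : Filling μ} (h : ColumnStrict T) :
    LineStrict T (-1) (fun c => c.1.1) (fun c => c.1.2) :=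
  ⟨Or.inl ⟨rfl, fun _ => rfl, fun _ => rfl⟩, h.1, h.2⟩

theorem RowStrict.lineStrict {T : Filling μ} (h : RowStrict T) :
    LineStrict T 1 (fun c => c.1.2) (fun c => c.1.1) :=
  ⟨Or.inr ⟨rfl, fun _ => rfl, fun _ => rfl⟩, h.2, h.1⟩

/-- The order in which the sink of a component lists the cells: by decreasing value, then line by
line, each line backwards. -/
def sinkKey (T : Filling μ) (ε : ℤ) (l m : μ.cells → ℕ) (c : μ.cells) : ℤ ×ₗ ℤ ×ₗ ℤ :=
  toLex (-(T c : ℤ), toLex (ε * l c, -(m c : ℤ)))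

theorem sinkKey_lt {T : Filling μ} {ε : ℤ} {l m : μ.cells → ℕ} {c d : μ.cells} :
    sinkKey T ε l m c < sinkKey T ε l m d ↔ T d < T c ∨ (T c = T d ∧
      (ε * l c < ε * l d ∨ (ε * l c = ε * l d ∧ m d < m c))) := by
  simp only [sinkKey, Prod.Lex.toLex_lt_toLex]
  omega

/-- The block of a cell: its value and its line. -/
def cellBlock (T : Filling μ) (ε : ℤ) (l : μ.cells → ℕ) (c : μ.cells) : ℤ ×ₗ ℤ :=
  toLex (-(T c : ℤ), ε * l c)

theorem cellBlock_eq {T : Filling μ} {ε : ℤ} {l : μ.cells → ℕ} (hε : ε ≠ 0) {c d : μ.cells} :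
    cellBlock T ε l c = cellBlock T ε l d ↔ T c = T d ∧ l c = l d := by
  rw [cellBlock, cellBlock, toLex_inj, Prod.mk.injEq, neg_inj, mul_right_inj' hε]
  norm_cast

theorem cellBlock_le {T : Filling μ} {ε : ℤ} {l m : μ.cells → ℕ} {c d : μ.cells}
    (h : sinkKey T ε l m c < sinkKey T ε l m d) : cellBlock T ε l c ≤ cellBlock T ε l d := by
  rw [sinkKey_lt] at h
  rw [cellBlock, cellBlock, Prod.Lex.toLex_le_toLex]
  omega

namespace LineStrict

variable {T : Filling μ} {ε : ℤ} {l m : μ.cells → ℕ} (S : LineStrict T ε l m)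
include S

theorem sign : ε = -1 ∨ ε = 1 := S.coord.imp And.left And.left

theorem sign_ne_zero : ε ≠ 0 := by
  have := S.sign
  omega

theorem ext {c d : μ.cells} (h1 : l c = l d) (h2 : m c = m d) : c = d := by
  rcases S.coord with ⟨-, hl, hm⟩ | ⟨-, hl, hm⟩ <;> rw [hl, hl] at h1 <;> rw [hm, hm] at h2
  · exact Subtype.ext (Prod.ext h1 h2)
  · exact Subtype.ext (Prod.ext h2 h1)

theorem content (c : μ.cells) : ((c.1.2 : ℤ) - c.1.1) = ε * (l c - m c) := by
  rcases S.coord with ⟨rfl, hl, hm⟩ | ⟨rfl, hl, hm⟩ <;> rw [hl, hm] <;> ring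

theorem exists_cell (d : μ.cells) {x y : ℕ} (hx : x ≤ l d) (hy : y ≤ m d) :
    ∃ c, l c = x ∧ m c = y := by
  have hd : (d.1.1, d.1.2) ∈ μ := d.2
  rcases S.coord with ⟨-, hl, hm⟩ | ⟨-, hl, hm⟩ <;> rw [hl] at hx <;> rw [hm] at hy
  · exact ⟨⟨(x, y), μ.up_left_mem hx hy hd⟩, hl _, hm _⟩
  · exact ⟨⟨(y, x), μ.up_left_mem hy hx hd⟩, hl _, hm _⟩

/-- The cells with a given value form a strip: they have at most one cell in each cross line. -/
theorem strip {c d : μ.cells} (h1 : T c = T d) (h2 : l c < l d) : m d < m c := by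
  by_contra hc
  obtain ⟨f, hf1, hf2⟩ := S.exists_cell d le_rfl (not_lt.1 hc)
  have h3 := S.strict c f hf2.symm (by omega)
  have h4 := S.weak f d hf1 (by omega)
  omega

theorem sinkKey_injective : Function.Injective (sinkKey T ε l m) := by
  intro c d h
  simp only [sinkKey, toLex_inj, Prod.mk.injEq] at h
  obtain ⟨-, h1, h2⟩ := h
  rw [mul_right_inj' S.sign_ne_zero] at h1
  exact S.ext (by omega) (by omega)

/-- At equal values, the direction of the jumps is towards increasing blocks. -/
theorem content_iff {c d : μ.cells} (h1 : T c = T d) (h2 : l c ≠ l d) :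
    ((d.1.2 : ℤ) - d.1.1) + 2 ≤ (c.1.2 : ℤ) - c.1.1 ↔ ε * l d < ε * l c := by
  have h3 := fun h => S.strip h1 h
  have h4 := fun h => S.strip h1.symm h
  rw [S.content, S.content]
  rcases S.sign with rfl | rfl <;> omega

theorem content_ne {c d : μ.cells} (h1 : T c = T d) (h2 : l c ≠ l d) (e : ℤ) (he : e.natAbs ≤ 1) :
    (c.1.2 : ℤ) - c.1.1 ≠ (d.1.2 : ℤ) - d.1.1 + e := by
  have h3 := fun h => S.strip h1 h
  have h4 := fun h => S.strip h1.symm h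
  rw [S.content, S.content]
  rcases S.sign with rfl | rfl <;> omega

/-- Whether `e` is a reverse standard tableau can be tested on pairs of cells with the same value
in the same line, provided that the values decrease. -/
theorem isRST_iff {e : Fin (n + 1) ≃ μ.cells} (he : Antitone (T ∘ e)) :
    IsRST e ↔ ∀ a b, T (e a) = T (e b) → l (e a) = l (e b) → m (e a) < m (e b) → b < a := by
  have key : (∀ a b, (l (e a) = l (e b) → m (e a) < m (e b) → b < a) ∧
      (m (e a) = m (e b) → l (e a) < l (e b) → b < a)) ↔
      ∀ a b, T (e a) = T (e b) → l (e a) = l (e b) → m (e a) < m (e b) → b < a := by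
    refine ⟨fun h a b _ => (h a b).1, fun h a b => ⟨fun h1 h2 => ?_, fun h1 h2 => ?_⟩⟩
    · rcases (S.weak _ _ h1 h2.le).lt_or_eq with h3 | h3
      · exact he.reflect_lt h3
      · exact h a b h3 h1 h2
    · exact he.reflect_lt (S.strict _ _ h1 h2)
  rw [← key]
  rcases S.coord with ⟨-, hl, hm⟩ | ⟨-, hl, hm⟩
  · simp only [hl, hm]
    rfl
  · simp only [hl, hm]
    exact forall₂_congr fun a b => and_comm

end LineStrict

end Strict

/-! ### The labelling of a component by permutations -/

section Label

variable {n : ℕ} {μ : YoungDiagram}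

theorem exists_strictMono_equiv {α β : Type*} [Fintype α] [LinearOrder β] {f : α → β}
    (hf : Function.Injective f) {k : ℕ} (hk : Fintype.card α = k) :
    ∃ w : Fin k ≃ α, StrictMono (f ∘ w) := by
  let w₀ : Fin k ≃ α := (Fintype.equivFinOfCardEq hk).symm
  refine ⟨(Tuple.sort (f ∘ w₀)).trans w₀, (Tuple.monotone_sort (f ∘ w₀)).strictMono_of_injective ?_⟩
  exact (hf.comp w₀.injective).comp (Tuple.sort (f ∘ w₀)).injective

/-- The permutation that describes the order of the cells at a vertex, relative to a numbering `w`
of the cells. -/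
noncomputable def label (w : Fin (n + 1) ≃ μ.cells) (x : Vertex n μ) :
    Equiv.Perm (Fin (n + 1)) := (cellOrder x).trans w.symm

@[simp] theorem apply_label (w : Fin (n + 1) ≃ μ.cells) (x : Vertex n μ) (a : Fin (n + 1)) :
    w (label w x a) = cellOrder x a := w.apply_symm_apply _

theorem vertex_eq_of_label {w : Fin (n + 1) ≃ μ.cells} {x y : Vertex n μ} {T : Filling μ}
    (hx : fillingOf x = T) (hy : fillingOf y = T) (h : label w x = label w y) : x = y := by
  refine vertex_ext hx hy ?_
  ext1 a
  rw [← apply_label w, h, apply_label]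

theorem label_arrow (w : Fin (n + 1) ≃ μ.cells) {i : Fin n} {x y : Vertex n μ}
    (h : Arrow i x y) : label w y = label w x * adj i := by
  ext1 a
  apply w.injective
  rw [apply_label, Equiv.Perm.mul_apply, apply_label, (arrow_cellOrder h a).1]

theorem antitone_of_rank {v : Fin (n + 1) → ℕ} {f : Fin (n + 1) → ℕ}
    (h : ∀ a, f (rank v a) = v a) : Antitone f := by
  intro b c hbc
  obtain ⟨b, rfl⟩ := (rankPerm v).surjective b
  obtain ⟨c, rfl⟩ := (rankPerm v).surjective c
  rw [rankPerm_apply, rankPerm_apply] at *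
  rw [h, h]
  by_contra hc
  exact absurd (Before.rank_lt (Or.inl (not_le.1 hc))) hbc.not_gt

namespace LineStrict

variable {T : Filling μ} {ε : ℤ} {l m : μ.cells → ℕ} (S : LineStrict T ε l m)
  {w : Fin (n + 1) ≃ μ.cells} (hw : StrictMono (sinkKey T ε l m ∘ w))
include S hw

theorem monotone_cellBlock : Monotone (cellBlock T ε l ∘ w) := by
  intro a b hab
  rcases hab.lt_or_eq with h | rfl
  · exact cellBlock_le (hw h)
  · exact le_rfl

theorem lt_iff_of_cellBlock_eq {a b : Fin (n + 1)} (hT : T (w a) = T (w b))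
    (hl : l (w a) = l (w b)) : a < b ↔ m (w b) < m (w a) := by
  rw [← hw.lt_iff_lt, Function.comp_apply, Function.comp_apply, sinkKey_lt, hT, hl]
  omega

theorem inOrder_label {x : Vertex n μ} (hx : fillingOf x = T) :
    InOrder (cellBlock T ε l ∘ w) (label w x) := by
  intro a b hab he
  obtain ⟨a', rfl⟩ := (label w x).surjective a
  obtain ⟨b', rfl⟩ := (label w x).surjective b
  rw [Function.comp_apply, Function.comp_apply, cellBlock_eq S.sign_ne_zero] at he
  obtain ⟨hT, hl⟩ := he
  rw [S.lt_iff_of_cellBlock_eq hw hT hl] at hab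
  rw [perm_inv_apply_self, perm_inv_apply_self]
  simp only [apply_label] at hT hl hab
  rw [fillingOf_eq_iff] at hx
  have h1 := (S.isRST_iff (antitone_of_rank fun a => (hx a).symm)).1 x.1.2 _ _ hT.symm hl.symm hab
  rw [rankPerm_apply, rankPerm_apply, rank_lt_rank] at h1
  rcases h1 with h1 | h1
  · rw [hx, hx] at h1
    omega
  · exact h1.2

/-- Every permutation that is in order is the label of a vertex: at equal values and in the same line
this order is the condition on the entries of a reverse standard tableau. -/
theorem exists_vertex {π : Equiv.Perm (Fin (n + 1))} (hπ : InOrder (cellBlock T ε l ∘ w) π) :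
    ∃ x : Vertex n μ, fillingOf x = T ∧ label w x = π := by
  let v : Fin (n + 1) → ℕ := fun a => T (w (π a))
  let e : Fin (n + 1) ≃ μ.cells := (rankPerm v).symm.trans (π.trans w)
  have he : ∀ a, e (rank v a) = w (π a) := fun a => by
    simp [e, ← rankPerm_apply]
  have hR : IsRST e := by
    rw [S.isRST_iff (antitone_of_rank (v := v) fun a => congrArg T (he a))]
    intro a b hT hl hm
    obtain ⟨a, rfl⟩ := (rankPerm v).surjective a
    obtain ⟨b, rfl⟩ := (rankPerm v).surjective b
    simp only [rankPerm_apply, he] at hT hl hm ⊢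
    have h1 := hπ _ _ ((S.lt_iff_of_cellBlock_eq hw hT.symm hl.symm).2 hm)
      ((cellBlock_eq S.sign_ne_zero).2 ⟨hT.symm, hl.symm⟩)
    rw [perm_inv_apply_self, perm_inv_apply_self] at h1
    exact rank_lt_rank.2 (Or.inr ⟨hT.symm, h1⟩)
  refine ⟨(⟨e, hR⟩, v), ?_, ?_⟩
  · rw [fillingOf_eq_iff]
    intro a
    rw [cellOrder_apply]
    exact (congrArg T (he a)).symm
  · ext1 a
    apply w.injective
    rw [apply_label, cellOrder_apply]
    exact he a

/-- The arrows that start at a vertex, in terms of its label: steps exchange cells with different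
values, and jumps exchange cells with the same value in different lines. -/
theorem exists_arrow_iff {x : Vertex n μ} (hx : fillingOf x = T) (i : Fin n) :
    (∃ y, Arrow i x y) ↔ (cellBlock T ε l ∘ w) (label w x i.castSucc) ≠
      (cellBlock T ε l ∘ w) (label w x i.succ) ∧ label w x i.succ < label w x i.castSucc := by
  have hT := fillingOf_eq_iff.1 hx
  rw [Function.comp_apply, Function.comp_apply, ← hw.lt_iff_lt, Function.comp_apply,
    Function.comp_apply, ne_eq, cellBlock_eq S.sign_ne_zero, sinkKey_lt]
  simp only [apply_label, ← hT]
  have hcon : ∀ a, x.1.content (rank x.2 a) =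
      ((cellOrder x a).1.2 : ℤ) - (cellOrder x a).1.1 := fun a => rfl
  have hci := fun (h1 : x.2 i.castSucc = x.2 i.succ) =>
    S.content_iff (c := cellOrder x i.castSucc) (d := cellOrder x i.succ)
      (by rw [← hT, ← hT, h1])
  rw [← hcon, ← hcon] at hci
  constructor
  · rintro ⟨y, ⟨h1, -⟩ | ⟨h1, h2, -⟩⟩
    · exact ⟨fun h => by omega, Or.inl h1⟩
    · have hl : l (cellOrder x i.castSucc) ≠ l (cellOrder x i.succ) := by
        intro hl
        obtain ⟨k, hk, hk', h3, h4⟩ := Arrow.jump_exchange h1 h2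
        rcases S.coord with ⟨-, h5, -⟩ | ⟨-, h5, -⟩ <;>
          rw [h5, h5, cellOrder_apply, cellOrder_apply, hk, hk'] at hl
        · exact h3.ne hl
        · exact h4.ne' hl
      exact ⟨fun h => hl h.2, Or.inr ⟨h1.symm, Or.inl ((hci h1 hl).1 h2)⟩⟩
  · rintro ⟨h1, h2⟩
    rcases h2 with h2 | ⟨h2, h3⟩
    · exact ⟨_, Or.inl ⟨h2, rfl⟩⟩
    · have hl : l (cellOrder x i.castSucc) ≠ l (cellOrder x i.succ) := fun h => h1 ⟨h2.symm, h⟩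
      refine ⟨_, Or.inr ⟨h2.symm, (hci h2.symm hl).2 ?_, rfl⟩⟩
      refine h3.resolve_right fun h => hl ?_
      have := mul_left_cancel₀ S.sign_ne_zero h.1
      omega

theorem arrow_iff {x y : Vertex n μ} (hx : fillingOf x = T) (hy : fillingOf y = T) (i : Fin n) :
    Arrow i x y ↔ (cellBlock T ε l ∘ w) (label w x i.castSucc) ≠
      (cellBlock T ε l ∘ w) (label w x i.succ) ∧ label w x i.succ < label w x i.castSucc ∧
      label w y = label w x * adj i := by
  rw [← and_assoc, ← S.exists_arrow_iff hw hx]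
  constructor
  · exact fun h => ⟨⟨y, h⟩, label_arrow w h⟩
  · rintro ⟨⟨y', h1⟩, h2⟩
    rwa [vertex_eq_of_label hy ((arrow_fillingOf h1).trans hx) (h2.trans (label_arrow w h1).symm)]

theorem isRoot_iff {ρ : Equiv.Perm (Fin (n + 1))} (hρ : IsTop (cellBlock T ε l ∘ w) ρ)
    {x : Vertex n μ} : IsRoot T x ↔ fillingOf x = T ∧ label w x = ρ := by
  rw [IsRoot, mem_component]
  refine and_congr_right fun hx => ⟨fun h => ?_, ?_⟩
  · have hx' := S.inOrder_label hw hx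
    refine (hx'.isTop (S.monotone_cellBlock hw) fun i hi hlt => ?_).unique hρ
    obtain ⟨y, hy, hyπ⟩ := S.exists_vertex hw (hx'.mul_adj hi)
    refine h i y ((S.arrow_iff hw hy hx i).2 ?_)
    rw [hyπ, mul_adj_adj]
    simp only [Equiv.Perm.mul_apply, adj_castSucc, adj_succ]
    exact ⟨Ne.symm hi, hlt, trivial⟩
  · rintro rfl i y hyx
    have hy := (arrow_fillingOf hyx).symm.trans hx
    obtain ⟨h1, h2, h3⟩ := (S.arrow_iff hw hy hx i).1 hyx
    have := hρ.not_lt i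
    rw [h3] at this
    simp only [Equiv.Perm.mul_apply, adj_castSucc, adj_succ] at this
    exact this h1.symm h2

theorem isSink_iff {x : Vertex n μ} : IsSink T x ↔ fillingOf x = T ∧ label w x = 1 := by
  rw [IsSink, mem_component]
  refine and_congr_right fun hx => ⟨fun h => ?_, ?_⟩
  · refine (S.inOrder_label hw hx).eq_one fun i hi hlt => ?_
    obtain ⟨y, hy⟩ := (S.exists_arrow_iff hw hx i).2 ⟨hi, hlt⟩
    exact h i y hy
  · intro h i y hxy
    have := ((S.exists_arrow_iff hw hx i).1 ⟨y, hxy⟩).2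
    rw [h] at this
    exact absurd this Fin.castSucc_lt_succ.not_gt

end LineStrict

end Label

/-! ### The spectral values of the cells -/

section CellSpec

variable {K : Type*} [Field K] {n : ℕ} {μ : YoungDiagram} {q s : K}

/-- The spectral value attached to a cell of a filling. -/
def cellSpec (q s : K) (T : Filling μ) (c : μ.cells) : K :=
  q ^ T c * s ^ ((c.1.2 : ℤ) - (c.1.1 : ℤ))

theorem spec_eq_cellSpec {x : Vertex n μ} {T : Filling μ} (hx : fillingOf x = T)
    (a : Fin (n + 1)) : spec q s x a = cellSpec q s T (cellOrder x a) := by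
  rw [cellSpec, ← fillingOf_eq_iff.1 hx]
  rfl

theorem IsGeneric.cellSpec_ne_zero (G : IsGeneric q s) (T : Filling μ) (c : μ.cells) :
    cellSpec q s T c ≠ 0 :=
  mul_ne_zero (pow_ne_zero _ G.q_ne_zero) (zpow_ne_zero _ G.s_ne_zero)

namespace LineStrict

variable {T : Filling μ} {ε : ℤ} {l m : μ.cells → ℕ} (S : LineStrict T ε l m)
include S

theorem cellSpec_injective (G : IsGeneric q s) : Function.Injective (cellSpec q s T) := by
  intro c d h
  obtain ⟨h1, h2⟩ := G.mul_injective h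
  have h3 : l c = l d := by
    by_contra h3
    exact S.content_ne h1 h3 0 (by decide) (by rw [h2, add_zero])
  rw [S.content, S.content, h3] at h2
  have := mul_left_cancel₀ S.sign_ne_zero h2
  exact S.ext h3 (by omega)

theorem cellSpec_ne_mul (G : IsGeneric q s) {c d : μ.cells}
    (h : cellBlock T ε l c ≠ cellBlock T ε l d) : s * cellSpec q s T c ≠ cellSpec q s T d := by
  intro e
  have e' : q ^ T c * s ^ ((c.1.2 : ℤ) - c.1.1 + 1) = q ^ T d * s ^ ((d.1.2 : ℤ) - d.1.1) := by
    rw [zpow_add_one₀ G.s_ne_zero, ← cellSpec.eq_1 q s T d, ← e, cellSpec]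
    ring
  obtain ⟨h1, h2⟩ := G.mul_injective e'
  have h3 : l c ≠ l d := fun h3 => h ((cellBlock_eq S.sign_ne_zero).2 ⟨h1, h3⟩)
  exact S.content_ne h1 h3 (-1) (by decide) (by omega)

/-- Consecutive cells of the same block are neighbours. -/
theorem place_eq {w : Fin (n + 1) ≃ μ.cells} (hw : StrictMono (sinkKey T ε l m ∘ w)) {i : Fin n}
    (h : cellBlock T ε l (w i.castSucc) = cellBlock T ε l (w i.succ)) :
    m (w i.castSucc) = m (w i.succ) + 1 := by
  rw [cellBlock_eq S.sign_ne_zero] at h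
  have h1 := (S.lt_iff_of_cellBlock_eq hw h.1 h.2).1 Fin.castSucc_lt_succ
  by_contra hc
  obtain ⟨f, hf1, hf2⟩ := S.exists_cell (w i.castSucc) le_rfl (y := m (w i.succ) + 1) (by omega)
  obtain ⟨k, rfl⟩ := w.surjective f
  have t1 := S.weak (w i.succ) (w k) (by omega) (by omega)
  have t2 := S.weak (w k) (w i.castSucc) (by omega) (by omega)
  have h2 := (S.lt_iff_of_cellBlock_eq hw (a := i.castSucc) (b := k) (by omega) (by omega)).2
    (by omega)
  have h3 := (S.lt_iff_of_cellBlock_eq hw (a := k) (b := i.succ) (by omega) (by omega)).2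
    (by omega)
  rw [Fin.lt_def] at h2 h3
  simp at h2 h3
  omega

theorem cellSpec_ratio (G : IsGeneric q s) {w : Fin (n + 1) ≃ μ.cells}
    (hw : StrictMono (sinkKey T ε l m ∘ w)) {i : Fin n}
    (h : cellBlock T ε l (w i.castSucc) = cellBlock T ε l (w i.succ)) :
    cellSpec q s T (w i.castSucc) = s ^ (-ε) * cellSpec q s T (w i.succ) := by
  have h1 := S.place_eq hw h
  rw [cellBlock_eq S.sign_ne_zero] at h
  rw [cellSpec, cellSpec, h.1, mul_left_comm, ← zpow_add₀ G.s_ne_zero, S.content, S.content, h.2,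
    h1]
  congr 2
  push_cast
  ring

/-- The values on which the formal model of the component is built: the spectral values for
column-strict fillings, their inverses for row-strict ones. -/
theorem isSpectrum (G : IsGeneric q s) {w : Fin (n + 1) ≃ μ.cells}
    (hw : StrictMono (sinkKey T ε l m ∘ w)) :
    IsSpectrum s (fun k => cellSpec q s T (w k) ^ (-ε)) (cellBlock T ε l ∘ w) where
  mono := S.monotone_cellBlock hw
  inj a b h := by
    refine w.injective (S.cellSpec_injective G ?_)
    rcases S.sign with rfl | rfl
    · simpa using h
    · simpa using h
  ratio i h := by
    rw [S.cellSpec_ratio G hw h]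
    rcases S.sign with rfl | rfl
    · simp
    · simp [mul_comm]
  generic a b h := by
    have ha := G.cellSpec_ne_zero T (w a)
    have hb := G.cellSpec_ne_zero T (w b)
    rcases S.sign with rfl | rfl
    · simpa using S.cellSpec_ne_mul G h
    · intro e
      refine S.cellSpec_ne_mul G h.symm ?_
      simp only [zpow_neg, zpow_one] at e
      field_simp at e
      exact e

end LineStrict

end CellSpec

/-! ### Coefficients and Macdonald polynomials of a component -/

section Component

variable {K : Type*} [Field K] {n : ℕ} {μ : YoungDiagram} {q s : K}

theorem ell_le_card (σ : Equiv.Perm (Fin (n + 1))) :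
    ell σ ≤ Fintype.card (Fin (n + 1) × Fin (n + 1)) := Finset.card_le_univ _

theorem sign_adj (i : Fin n) : Equiv.Perm.sign (adj i) = -1 :=
  Equiv.Perm.sign_swap Fin.castSucc_lt_succ.ne

theorem DirPath.exists_pathCoeff (fac : K → K → K) {r x : Vertex n μ} {k : ℕ}
    (h : DirPath r x k) : ∃ c, PathCoeff q s fac r x c := by
  induction h with
  | nil => exact ⟨1, .nil⟩
  | cons i y z k _ hyz ih =>
    obtain ⟨c, hc⟩ := ih
    exact ⟨_, hc.cons i y z c hyz⟩

theorem DirPath.sign_label (w : Fin (n + 1) ≃ μ.cells) {r x : Vertex n μ} {k : ℕ}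
    (h : DirPath r x k) :
    Equiv.Perm.sign (label w x) = (-1) ^ k * Equiv.Perm.sign (label w r) := by
  induction h with
  | nil => simp
  | cons i y z k _ hyz ih =>
    rw [label_arrow w hyz, map_mul, sign_adj, ih, pow_succ]
    simp

theorem PathCoeff.label_eq {fac : K → K → K} {w : Fin (n + 1) ≃ μ.cells} {T : Filling μ}
    {Y : Equiv.Perm (Fin (n + 1)) → K}
    (hY : ∀ (i : Fin n) (x y : Vertex n μ), fillingOf x = T → Arrow i x y →
      Y (label w y) = fac (spec q s x i.castSucc) (spec q s x i.succ) * Y (label w x))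
    {r x : Vertex n μ} {c : K} (hr : fillingOf r = T) (h : PathCoeff q s fac r x c) :
    fillingOf x = T ∧ Y (label w x) = c * Y (label w r) := by
  induction h with
  | nil => exact ⟨hr, (one_mul _).symm⟩
  | cons i x y c _ hxy ih =>
    exact ⟨(arrow_fillingOf hxy).trans ih.1, by rw [hY i x y ih.1 hxy, ih.2, mul_assoc]⟩

open Classical in
/-- The Macdonald polynomial of the vertex with filling `T` and label `π` (zero if there is no such
vertex). -/
noncomputable def family (q s : K) (T : Filling μ) (w : Fin (n + 1) ≃ μ.cells)
    (π : Equiv.Perm (Fin (n + 1))) : VPoly K n μ :=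
  if h : ∃ x : Vertex n μ, fillingOf x = T ∧ label w x = π then macdonald q s h.choose else 0

theorem family_label {T : Filling μ} {w : Fin (n + 1) ≃ μ.cells} {x : Vertex n μ}
    (hx : fillingOf x = T) : family q s T w (label w x) = macdonald q s x := by
  have h : ∃ y : Vertex n μ, fillingOf y = T ∧ label w y = label w x := ⟨x, hx, rfl⟩
  rw [family, dif_pos h, vertex_eq_of_label h.choose_spec.1 hx h.choose_spec.2]

namespace LineStrict

variable {T : Filling μ} {ε : ℤ} {l m : μ.cells → ℕ} (S : LineStrict T ε l m)
  {w : Fin (n + 1) ≃ μ.cells} (hw : StrictMono (sinkKey T ε l m ∘ w))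
include S hw

/-- The root reaches every vertex of the component. The induction goes against the arrows, which
increases the length of the label. -/
theorem exists_dirPath {r : Vertex n μ} (hr : fillingOf r = T)
    (hρ : IsTop (cellBlock T ε l ∘ w) (label w r)) {x : Vertex n μ} (hx : fillingOf x = T) :
    ∃ k, DirPath r x k := by
  induction hk : Fintype.card (Fin (n + 1) × Fin (n + 1)) - ell (label w x)
    using Nat.strong_induction_on generalizing x with
  | _ k ih =>
  have hx' := S.inOrder_label hw hx
  by_cases h : ∃ i : Fin n, (cellBlock T ε l ∘ w) (label w x i.castSucc) ≠
      (cellBlock T ε l ∘ w) (label w x i.succ) ∧ label w x i.castSucc < label w x i.succ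
  · obtain ⟨i, hi, hlt⟩ := h
    obtain ⟨y, hy, hyπ⟩ := S.exists_vertex hw (hx'.mul_adj hi)
    have hyx : Arrow i y x := by
      rw [S.arrow_iff hw hy hx i, hyπ, mul_adj_adj]
      simp only [Equiv.Perm.mul_apply, adj_castSucc, adj_succ]
      exact ⟨Ne.symm hi, hlt, trivial⟩
    have h1 := ell_mul_adj_of_lt hlt
    have h2 := ell_le_card (label w x * adj i)
    obtain ⟨j, hj⟩ := ih _ (by rw [hyπ]; omega) hy rfl
    exact ⟨_, hj.cons i y x j hyx⟩
  · have : IsTop (cellBlock T ε l ∘ w) (label w x) :=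
      hx'.isTop (S.monotone_cellBlock hw) fun i hi hlt => h ⟨i, hi, hlt⟩
    rw [vertex_eq_of_label hx hr (this.unique hρ)]
    exact ⟨0, .nil⟩

/-- A function on the labels that is multiplied along the arrows by the factors `fac` describes the
coefficients up to normalization. -/
theorem coeff_eq {fac : K → K → K} {Y : Equiv.Perm (Fin (n + 1)) → K}
    (hY : ∀ (i : Fin n) (x y : Vertex n μ), fillingOf x = T → Arrow i x y →
      Y (label w y) = fac (spec q s x i.castSucc) (spec q s x i.succ) * Y (label w x))
    (hY1 : Y 1 ≠ 0) {r : Vertex n μ} (hr : fillingOf r = T)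
    (hρ : IsTop (cellBlock T ε l ∘ w) (label w r)) :
    Y (label w r) ≠ 0 ∧ ∀ x : Vertex n μ, fillingOf x = T →
      coeff q s fac r x = Y (label w x) / Y (label w r) := by
  have key : ∀ x : Vertex n μ, fillingOf x = T →
      Y (label w x) = coeff q s fac r x * Y (label w r) := by
    intro x hx
    obtain ⟨k, hk⟩ := S.exists_dirPath hw hr hρ hx
    have h := hk.exists_pathCoeff (q := q) (s := s) fac
    rw [coeff, dif_pos h]
    exact (h.choose_spec.label_eq hY hr).2
  have h0 : Y (label w r) ≠ 0 := by
    obtain ⟨x, hx, hx1⟩ := S.exists_vertex hw inOrder_one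
    intro h0
    have := key x hx
    rw [hx1, h0, mul_zero] at this
    exact hY1 this
  exact ⟨h0, fun x hx => (eq_div_iff h0).2 (key x hx).symm⟩

theorem finsum_component (Y : Equiv.Perm (Fin (n + 1)) → K) (f : Vertex n μ → K)
    (hf : ∀ x, fillingOf x = T → f x = Y (label w x)) :
    ∑ᶠ x ∈ component n T, f x • macdonald q s x = ∑ π, Y π • family q s T w π := by
  have hb : Set.BijOn (label w) (component n T) {π | InOrder (cellBlock T ε l ∘ w) π} := by
    refine ⟨fun x hx => S.inOrder_label hw (mem_component.1 hx), fun x hx y hy h => ?_,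
      fun π hπ => ?_⟩
    · exact vertex_eq_of_label (mem_component.1 hx) (mem_component.1 hy) h
    · obtain ⟨x, hx, hx'⟩ := S.exists_vertex hw hπ
      exact ⟨x, mem_component.2 hx, hx'⟩
  rw [finsum_mem_eq_of_bijOn (g := fun π => Y π • family q s T w π) (label w) hb,
    finsum_mem_inter_support_eq _ _ Set.univ, finsum_mem_univ, finsum_eq_sum_of_fintype]
  · ext π
    simp only [Set.mem_inter_iff, Set.mem_ofPred_eq, Set.mem_univ, true_and, and_iff_right_iff_imp,
      Function.mem_support]
    intro h
    by_contra hπ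
    refine h ?_
    rw [family, dif_neg, smul_zero]
    rintro ⟨x, hx, rfl⟩
    exact hπ (S.inOrder_label hw hx)
  · intro x hx
    have hx' := mem_component.1 hx
    rw [hf x hx', family_label hx']

theorem hecke_family_of_same (G : IsGeneric q s) {π : Equiv.Perm (Fin (n + 1))} {i : Fin n}
    (hπ : InOrder (cellBlock T ε l ∘ w) π)
    (h : (cellBlock T ε l ∘ w) (π i.castSucc) = (cellBlock T ε l ∘ w) (π i.succ)) :
    hecke s i (family q s T w π) = diag s (cellSpec q s T (w (π i.castSucc)))
      (cellSpec q s T (w (π i.succ))) • family q s T w π := by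
  obtain ⟨x, hx, rfl⟩ := S.exists_vertex hw hπ
  simp only [Function.comp_apply, apply_label] at h
  rw [cellBlock_eq S.sign_ne_zero] at h
  have hT := fillingOf_eq_iff.1 hx
  have hv : x.2 i.castSucc = x.2 i.succ := by rw [hT, hT, h.1]
  obtain ⟨k, hk, hk'⟩ := rank_succ_of_eq hv
  have h1 := (mac_rules G x.2).2 i k hv hk hk' x.1
  have h2 : cellCoef s (x.1.1 k.castSucc) (x.1.1 k.succ) = 0 := by
    have h3 := h.2
    rw [cellOrder_apply, cellOrder_apply, hk, hk'] at h3
    rw [cellCoef, if_pos]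
    rcases S.coord with ⟨-, h4, -⟩ | ⟨-, h4, -⟩ <;> rw [h4, h4] at h3
    · exact Or.inl h3
    · exact Or.inr h3
  rw [h2, zero_smul, stepOp, sub_eq_zero] at h1
  rw [family_label hx, apply_label, apply_label, ← spec_eq_cellSpec hx, ← spec_eq_cellSpec hx,
    macdonald_eq_mac G]
  exact h1

theorem hecke_family_of_ne (G : IsGeneric q s) {π : Equiv.Perm (Fin (n + 1))} {i : Fin n}
    (hπ : InOrder (cellBlock T ε l ∘ w) π)
    (h : (cellBlock T ε l ∘ w) (π i.castSucc) ≠ (cellBlock T ε l ∘ w) (π i.succ))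
    (hlt : π i.succ < π i.castSucc) :
    hecke s i (family q s T w π) = diag s (cellSpec q s T (w (π i.castSucc)))
      (cellSpec q s T (w (π i.succ))) • family q s T w π + family q s T w (π * adj i) := by
  obtain ⟨x, hx, rfl⟩ := S.exists_vertex hw hπ
  obtain ⟨y, hxy⟩ := (S.exists_arrow_iff hw hx i).2 ⟨h, hlt⟩
  have hy := (arrow_fillingOf hxy).trans hx
  rw [← label_arrow w hxy, family_label hx, family_label hy, apply_label, apply_label,
    ← spec_eq_cellSpec hx, ← spec_eq_cellSpec hx, macdonald_eq_mac G, macdonald_eq_mac G,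
    arrow_mac G hxy, stepOp]
  module

end LineStrict

end Component

/-! ### The Poincaré polynomial of the stabilizer -/

section Poincare

variable {K : Type*} [Field K] {n : ℕ} {μ : YoungDiagram}

theorem blk_eq_of_inversion {B : Type*} [LinearOrder B] {blk : Fin (n + 1) → B}
    (hb : Monotone blk) {τ : Equiv.Perm (Fin (n + 1))} (hτ : ∀ k, blk (τ k) = blk k)
    {a b : Fin (n + 1)} (hab : a < b) (h : τ b < τ a) : blk a = blk b :=
  le_antisymm (hb hab.le) (by rw [← hτ a, ← hτ b]; exact hb h.le)

/-- Conjugation by a permutation that is increasing on each block, and carries one partition into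
blocks to another, preserves the length, since inversions occur only inside the blocks. -/
theorem ell_conj_eq {B B' : Type*} [LinearOrder B] [LinearOrder B']
    {blk : Fin (n + 1) → B} {blk' : Fin (n + 1) → B'} (hb : Monotone blk) (hb' : Monotone blk')
    (g : Equiv.Perm (Fin (n + 1))) (hg : ∀ a b, blk' (g a) = blk' (g b) ↔ blk a = blk b)
    (hlt : ∀ a b, blk a = blk b → (g a < g b ↔ a < b)) {τ : Equiv.Perm (Fin (n + 1))}
    (hτ : ∀ k, blk (τ k) = blk k) : ell τ = ell (g * τ * g⁻¹) := by
  have hτ' : ∀ k, blk' ((g * τ * g⁻¹) k) = blk' k := fun k => by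
    obtain ⟨k, rfl⟩ := g.surjective k
    simp only [Equiv.Perm.mul_apply, perm_inv_apply_self]
    exact (hg _ _).2 (hτ k)
  rw [ell, ell]
  refine Finset.card_equiv (g.prodCongr g) fun ⟨a, b⟩ => ?_
  rw [Finset.mem_filter, Finset.mem_filter, Equiv.prodCongr_apply, Prod.map_apply]
  simp only [Finset.mem_univ, true_and, Equiv.Perm.mul_apply, perm_inv_apply_self]
  have key : blk a = blk b → ((a < b ∧ τ b < τ a) ↔ (g a < g b ∧ g (τ b) < g (τ a))) := fun h => by
    rw [hlt _ _ h, hlt _ _ (by rw [hτ, hτ, h])]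
  constructor
  · intro h
    exact (key (blk_eq_of_inversion hb hτ h.1 h.2)).1 h
  · intro h
    refine (key ((hg _ _).1 (blk_eq_of_inversion hb' hτ' h.1 ?_))).2 h
    simpa only [Equiv.Perm.mul_apply, perm_inv_apply_self] using h.2

/-- The generating function of the lengths of the permutations that preserve each block does not
depend on the order of the blocks. -/
theorem sum_pow_ell_eq {B B' : Type*} [LinearOrder B] [LinearOrder B'] (s : K)
    {blk : Fin (n + 1) → B} {blk' : Fin (n + 1) → B'} (hb : Monotone blk) (hb' : Monotone blk')
    (g : Equiv.Perm (Fin (n + 1))) (hg : ∀ a b, blk' (g a) = blk' (g b) ↔ blk a = blk b)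
    (hlt : ∀ a b, blk a = blk b → (g a < g b ↔ a < b)) :
    ∑ τ with ∀ k, blk (τ k) = blk k, s ^ ell τ =
      ∑ τ with ∀ k, blk' (τ k) = blk' k, s ^ ell τ := by
  refine Finset.sum_equiv (MulAut.conj g).toEquiv (fun τ => ?_) fun τ hτ => ?_
  · simp only [Finset.mem_filter, Finset.mem_univ, true_and, MulEquiv.toEquiv_eq_coe,
      MulEquiv.coe_toEquiv, MulAut.conj_apply]
    rw [← g.forall_congr_right (q := fun k => blk' ((g * τ * g⁻¹) k) = blk' k)]
    simp only [Equiv.Perm.mul_apply, perm_inv_apply_self, hg]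
  · rw [Finset.mem_filter] at hτ
    exact congrArg _ (ell_conj_eq hb hb' g hg hlt hτ.2)

theorem std1_eq_card (T : Filling μ) (c : μ.cells) : std1 T c =
    (Finset.univ.filter fun d : μ.cells => T c < T d ∨ (T d = T c ∧
      (c.1.1 < d.1.1 ∨ (d.1.1 = c.1.1 ∧ c.1.2 ≤ d.1.2)))).card := by
  rw [std1, ← Finset.card_union_of_disjoint, ← Finset.card_union_of_disjoint]
  · congr 1
    ext d
    simp only [Finset.mem_union, Finset.mem_filter, Finset.mem_univ, true_and]
    tauto
  · rw [Finset.disjoint_left]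
    intro d
    simp only [Finset.mem_union, Finset.mem_filter, Finset.mem_univ, true_and]
    omega
  · rw [Finset.disjoint_left]
    intro d
    simp only [Finset.mem_filter, Finset.mem_univ, true_and]
    omega

/-- The standardization is the numbering of the cells in the order of the sink of a component. -/
theorem std1_apply {T : Filling μ} {w : Fin (n + 1) ≃ μ.cells}
    (hw : StrictMono (sinkKey T (-1) (fun c => c.1.1) (fun c => c.1.2) ∘ w)) (k : Fin (n + 1)) :
    std1 T (w k) = (k : ℕ) + 1 := by
  rw [std1_eq_card, ← Fin.card_Iic k, ← Finset.card_map w.toEmbedding]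
  congr 1
  ext d
  obtain ⟨j, rfl⟩ := w.surjective d
  have h1 := hw.lt_iff_lt (a := k) (b := j)
  rw [Function.comp_apply, Function.comp_apply, sinkKey_lt] at h1
  simp only [Finset.mem_filter, Finset.mem_univ, true_and, Finset.mem_map_equiv,
    Equiv.symm_apply_apply, Finset.mem_Iic]
  rw [← @not_lt _ _ k j, ← h1]
  omega

/-- The group `𝔖_T` consists of the permutations that preserve each block. -/
theorem poincare_eq_sum (s : K) {T : Filling μ} {w : Fin (n + 1) ≃ μ.cells}
    (hw : StrictMono (sinkKey T (-1) (fun c => c.1.1) (fun c => c.1.2) ∘ w)) :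
    poincare s n T = ∑ τ with ∀ k, (cellBlock T (-1) (fun c => c.1.1) ∘ w) (τ k) =
      (cellBlock T (-1) (fun c => c.1.1) ∘ w) k, s ^ ell τ := by
  rw [poincare]
  congr 1
  ext τ
  simp only [stabilizer, Finset.mem_filter, Finset.mem_univ, true_and, Function.comp_apply,
    cellBlock_eq (show (-1 : ℤ) ≠ 0 by decide)]
  constructor
  · intro h k
    exact (h k (w k) (w (τ k)) (std1_apply hw k) (std1_apply hw (τ k))).symm
  · intro h k c d hc hd
    obtain ⟨i, rfl⟩ := w.surjective c
    obtain ⟨j, rfl⟩ := w.surjective d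
    rw [std1_apply hw] at hc hd
    obtain rfl : i = k := Fin.ext (by omega)
    obtain rfl : j = τ i := Fin.ext (by omega)
    exact (h i).symm

/-- The Poincaré polynomial in terms of the blocks at the sink. The filling `T'` is `T` itself if the
lines are rows, and the conjugate filling if they are columns. -/
theorem LineStrict.poincare_eq (s : K) {T : Filling μ} {ε : ℤ} {l m : μ.cells → ℕ}
    (S : LineStrict T ε l m) {w : Fin (n + 1) ≃ μ.cells}
    (hw : StrictMono (sinkKey T ε l m ∘ w)) {ν : YoungDiagram} {T' : Filling ν}
    (e : μ.cells ≃ ν.cells) (hT : ∀ c, T' (e c) = T c) (hl : ∀ c, (e c).1.1 = l c)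
    (hm : ∀ c, (e c).1.2 = m c) :
    poincare s n T' = ∑ τ with ∀ k, (cellBlock T ε l ∘ w) (τ k) = (cellBlock T ε l ∘ w) k,
      s ^ ell τ := by
  have S' : LineStrict T' (-1) (fun c => c.1.1) (fun c => c.1.2) := by
    refine ⟨Or.inl ⟨rfl, fun _ => rfl, fun _ => rfl⟩, fun c d => ?_, fun c d => ?_⟩
    · obtain ⟨c, rfl⟩ := e.surjective c
      obtain ⟨d, rfl⟩ := e.surjective d
      rw [hT, hT, hl, hl, hm, hm]
      exact S.weak c d
    · obtain ⟨c, rfl⟩ := e.surjective c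
      obtain ⟨d, rfl⟩ := e.surjective d
      rw [hT, hT, hl, hl, hm, hm]
      exact S.strict c d
  obtain ⟨w', hw'⟩ := exists_strictMono_equiv S'.sinkKey_injective
    ((Fintype.card_congr (w.trans e)).symm.trans (Fintype.card_fin (n + 1)))
  rw [poincare_eq_sum s hw']
  have hg : ∀ a, w' (((w.trans e).trans w'.symm) a) = e (w a) := fun a => by simp
  refine (sum_pow_ell_eq s (S.monotone_cellBlock hw) (S'.monotone_cellBlock hw')
    ((w.trans e).trans w'.symm) (fun a b => ?_) fun a b hab => ?_).symm
  · rw [Function.comp_apply, Function.comp_apply, Function.comp_apply, Function.comp_apply, hg, hg,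
      cellBlock_eq S.sign_ne_zero, cellBlock_eq S'.sign_ne_zero, hT, hT, hl, hl]
  · rw [Function.comp_apply, Function.comp_apply, cellBlock_eq S.sign_ne_zero] at hab
    rw [S.lt_iff_of_cellBlock_eq hw hab.1 hab.2, S'.lt_iff_of_cellBlock_eq hw', hg, hg, hm, hm]
    · rw [hg, hg, hT, hT, hab.1]
    · rw [hg, hg, hl, hl, hab.2]

/-- The reflection of the cells of a diagram onto the cells of the conjugate diagram. -/
def transposeCells (μ : YoungDiagram) : μ.cells ≃ μ.transpose.cells where
  toFun c := ⟨c.1.swap, (YoungDiagram.mem_cells _).2 (YoungDiagram.mem_transpose.2 (by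
    simp))⟩
  invFun c := ⟨c.1.swap, (YoungDiagram.mem_cells _).2 (YoungDiagram.mem_transpose.1
    ((YoungDiagram.mem_cells _).1 c.2))⟩
  left_inv c := Subtype.ext (Prod.swap_swap c.1)
  right_inv c := Subtype.ext (Prod.swap_swap c.1)

end Poincare

/-! ### The symmetrizer and the antisymmetrizer on the polynomial of the root -/

section Final

variable {K : Type*} [Field K] {n : ℕ} {μ : YoungDiagram} {q s : K}

/-- The operators `-s 𝐓_i⁻¹`, which satisfy the same quadratic relation as the `𝐓_i`. -/
noncomputable def heckeNeg (s : K) (i : Fin n) : VPoly K n μ →ₗ[K] VPoly K n μ :=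
  (-s) • heckeInv s i

theorem heckeNeg_apply (hs : s ≠ 0) (i : Fin n) (f : VPoly K n μ) :
    heckeNeg s i f = -hecke s i f - (1 - s) • f := by
  rw [heckeNeg, LinearMap.smul_apply, heckeInv, LinearMap.smul_apply, smul_smul, neg_mul,
    mul_inv_cancel₀ hs]
  simp only [LinearMap.add_apply, LinearMap.smul_apply, LinearMap.id_apply]
  module

theorem wordOp_heckeNeg (l : List (Fin n)) (f : VPoly K n μ) :
    wordOp (heckeNeg s) l f = (-s) ^ l.length • wordOp (heckeInv s) l f := by
  induction l using List.reverseRecOn with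
  | nil => simp [wordOp_nil]
  | append_singleton l i ih =>
    rw [wordOp_concat, wordOp_concat, ih, map_smul, heckeNeg, LinearMap.smul_apply, smul_smul,
      List.length_append, List.length_singleton, pow_succ]

theorem antisymmetrizer_apply (f : VPoly K n μ) :
    antisymmetrizer s f = ∑ σ, wordOp (heckeNeg s) (reducedWord σ) f := by
  rw [antisymmetrizer, LinearMap.sum_apply]
  refine Finset.sum_congr rfl fun σ _ => ?_
  rw [wordOp_heckeNeg, length_reducedWord, LinearMap.smul_apply]

/-- The sign of a permutation in the field of coefficients. -/
def signK (K : Type*) [Field K] (π : Equiv.Perm (Fin (n + 1))) : K :=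
  ((Equiv.Perm.sign π : ℤ) : K)

theorem signK_mul_adj (π : Equiv.Perm (Fin (n + 1))) (i : Fin n) :
    signK K (π * adj i) = -signK K π := by
  rw [signK, signK, map_mul, sign_adj]
  simp

theorem signK_mul_self (π : Equiv.Perm (Fin (n + 1))) :
    signK K π * signK K π = 1 := by
  rw [signK, ← Int.cast_mul, ← Units.val_mul, Int.units_mul_self]
  simp

namespace LineStrict

variable {T : Filling μ} {l m : μ.cells → ℕ} {w : Fin (n + 1) ≃ μ.cells}

/-- The symmetrization of the polynomial of the root, for lines that are rows. The quotient
`b_sink / φ` is the inverse of the coefficient of the root in the symmetrization. -/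
theorem symMacdonald_eq (G : IsGeneric q s) (S : LineStrict T (-1) l m)
    (hw : StrictMono (sinkKey T (-1) l m ∘ w)) {r k : Vertex n μ} (hr : fillingOf r = T)
    (hρ : IsTop (cellBlock T (-1) l ∘ w) (label w r)) (hk : fillingOf k = T)
    (hk1 : label w k = 1) {φ : K} (hφ : φ ≠ 0)
    (hφ' : φ = ∑ τ with ∀ k, (cellBlock T (-1) l ∘ w) (τ k) = (cellBlock T (-1) l ∘ w) k,
      s ^ ell τ) :
    symMacdonald q s T r = (symCoeff q s r k / φ) • symmetrizer s (macdonald q s r) := by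
  have H : IsSpectrum s (fun k => cellSpec q s T (w k)) (cellBlock T (-1) l ∘ w) := by
    simpa using S.isSpectrum G hw
  obtain ⟨X, hX1, hX2, -, hX4⟩ := exists_expansion H (A := hecke s)
    (G.hecke_isHecke (n := n) (μ := μ)).quad (P := family q s T w)
    (fun π i hπ h => by
      rw [S.hecke_family_of_same hw G hπ h]
      congr 1
      exact hπ.diag_of_blk_eq H h)
    (fun π i hπ h hlt => S.hecke_family_of_ne hw G hπ h hlt) hρ
  rw [← hφ'] at hX1
  obtain ⟨h0, hc⟩ := S.coeff_eq hw (q := q) (s := s)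
    (fac := fun a b => (a - b) / (s * a - b)) (Y := X) (fun i x y hx hxy => by
      obtain ⟨h1, h2⟩ := (S.exists_arrow_iff hw hx i).1 ⟨y, hxy⟩
      rw [label_arrow w hxy, hX2 _ i (S.inOrder_label hw hx) h1 h2, apply_label, apply_label,
        spec_eq_cellSpec hx, spec_eq_cellSpec hx]) (hX1 ▸ hφ) hr hρ
  rw [family_label hr] at hX4
  simp only [symMacdonald, symCoeff]
  rw [S.finsum_component hw (fun π => X π / X (label w r)) _ hc, hc k hk, hk1, hX1, symmetrizer, LinearMap.sum_apply, hX4, Finset.smul_sum]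
  refine Finset.sum_congr rfl fun π _ => ?_
  rw [smul_smul]
  congr 1
  field_simp

/-- The antisymmetrization of the polynomial of the root, for lines that are columns. The sign is that
of the label of the root, which changes along every arrow. -/
theorem antiMacdonald_eq (G : IsGeneric q s) (S : LineStrict T 1 l m)
    (hw : StrictMono (sinkKey T 1 l m ∘ w)) {r k : Vertex n μ} (hr : fillingOf r = T)
    (hρ : IsTop (cellBlock T 1 l ∘ w) (label w r)) (hk : fillingOf k = T)
    (hk1 : label w k = 1) {φ : K} (hφ : φ ≠ 0)
    (hφ' : φ = ∑ τ with ∀ k, (cellBlock T 1 l ∘ w) (τ k) = (cellBlock T 1 l ∘ w) k,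
      s ^ ell τ) :
    antiMacdonald q s T r = ((-1) ^ pathLength r k * antiCoeff q s r k / φ) •
      antisymmetrizer s (macdonald q s r) := by
  have H : IsSpectrum s (fun k => (cellSpec q s T (w k))⁻¹) (cellBlock T 1 l ∘ w) := by
    simpa using S.isSpectrum G hw
  have hz := fun a => G.cellSpec_ne_zero (q := q) (s := s) T (w a)
  -- Inverting the spectral values replaces a diagonal entry by that of `-s 𝐓_i⁻¹ = -𝐓_i - (1 - s)`.
  have hd : ∀ {a b : Fin (n + 1)}, a ≠ b → diag s (cellSpec q s T (w a))⁻¹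
      (cellSpec q s T (w b))⁻¹ = s - 1 - diag s (cellSpec q s T (w a)) (cellSpec q s T (w b)) := by
    intro a b hab
    have h1 := sub_ne_zero.2 ((S.cellSpec_injective G).ne (w.injective.ne hab))
    have h2 := sub_ne_zero.2 (H.inj.ne hab)
    have ha := hz a
    have hb := hz b
    rw [diag, diag, eq_sub_iff_add_eq, div_add_div _ _ h2 h1, div_eq_iff (mul_ne_zero h2 h1)]
    field_simp
    ring
  have hne : ∀ (π : Equiv.Perm (Fin (n + 1))) (i : Fin n), π i.castSucc ≠ π i.succ := fun π i =>
    π.injective.ne Fin.castSucc_lt_succ.ne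
  obtain ⟨X, hX1, hX2, -, hX4⟩ := exists_expansion H (A := heckeNeg s)
    (fun i f => by
      have := (G.hecke_isHecke (n := n) (μ := μ)).quad i f
      simp only [heckeNeg_apply G.s_ne_zero, map_sub, map_neg, map_smul]
      linear_combination (norm := module) this)
    (P := fun π => signK K π • family q s T w π)
    (fun π i hπ h => by
      have h1 := hπ.diag_of_blk_eq H h
      rw [hd (hne π i)] at h1
      have h2 : diag s (cellSpec q s T (w (π i.castSucc))) (cellSpec q s T (w (π i.succ))) = -1 := by
        linear_combination -h1
      rw [map_smul, heckeNeg_apply G.s_ne_zero, S.hecke_family_of_same hw G hπ h, h2]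
      module)
    (fun π i hπ h hlt => by
      rw [map_smul, heckeNeg_apply G.s_ne_zero, S.hecke_family_of_ne hw G hπ h hlt,
        hd (hne π i), signK_mul_adj]
      module) hρ
  rw [← hφ'] at hX1
  have hs1 : signK K (1 : Equiv.Perm (Fin (n + 1))) = 1 := by simp [signK]
  obtain ⟨h0, hc⟩ := S.coeff_eq hw (q := q) (s := s)
    (fac := fun a b => -((a - b) / (a - s * b))) (Y := fun π => signK K π * X π)
    (fun i x y hx hxy => by
      obtain ⟨h1, h2⟩ := (S.exists_arrow_iff hw hx i).1 ⟨y, hxy⟩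
      rw [label_arrow w hxy, hX2 _ i (S.inOrder_label hw hx) h1 h2, signK_mul_adj,
        spec_eq_cellSpec hx, spec_eq_cellSpec hx, ← apply_label w, ← apply_label w]
      have e : ∀ {a b : Fin (n + 1)}, (cellSpec q s T (w a))⁻¹ - (cellSpec q s T (w b))⁻¹ =
          -((cellSpec q s T (w a) - cellSpec q s T (w b)) /
            (cellSpec q s T (w a) * cellSpec q s T (w b))) ∧
          s * (cellSpec q s T (w a))⁻¹ - (cellSpec q s T (w b))⁻¹ =
          -((cellSpec q s T (w a) - s * cellSpec q s T (w b)) /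
            (cellSpec q s T (w a) * cellSpec q s T (w b))) := by
        intro a b
        have ha := hz a
        have hb := hz b
        constructor <;> field_simp <;> ring
      rw [e.1, e.2, neg_div_neg_eq, div_div_div_cancel_right₀ (mul_ne_zero (hz _) (hz _))]
      ring) (by simpa [hs1, hX1] using hφ) hr hρ
  have hX4' : antisymmetrizer s (signK K (label w r) • macdonald q s r) =
      ∑ π, X π • signK K π • family q s T w π := by
    rw [antisymmetrizer_apply, ← hX4, family_label hr]
  rw [map_smul] at hX4'
  have hsign : signK K (label w r) = (-1) ^ pathLength r k := by
    have hmem : DirPath r k (pathLength r k) := Nat.sInf_mem (S.exists_dirPath hw hr hρ hk)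
    have h1 := hmem.sign_label w
    rw [hk1, map_one] at h1
    have h2 : Equiv.Perm.sign (label w r) = (-1) ^ pathLength r k := by
      have h3 := congrArg ((-1) ^ pathLength r k * ·) h1
      simpa [← mul_assoc, Int.units_mul_self] using h3.symm
    rw [signK, h2]
    simp
  have hsq := signK_mul_self (K := K) (label w r)
  simp only [antiMacdonald, antiCoeff]
  rw [S.finsum_component hw
    (fun π => signK K π * X π / (signK K (label w r) * X (label w r))) _ hc, hc k hk,
    hk1, hs1, hX1, ← hsign, one_mul]
  have e : (signK K (label w r) * (φ / (signK K (label w r) * X (label w r))) / φ) •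
      antisymmetrizer s (macdonald q s r) = (signK K (label w r) * X (label w r))⁻¹ •
        signK K (label w r) • antisymmetrizer s (macdonald q s r) := by
    rw [smul_smul]
    congr 1
    field_simp
  rw [e, hX4', Finset.smul_sum]
  refine Finset.sum_congr rfl fun π _ => ?_
  rw [smul_smul, smul_smul]
  congr 1
  ring

end LineStrict

end Final

/-! ### The field of rational functions -/

section RationalFunctions

theorem isGeneric_qq_ss : IsGeneric qq ss := by
  have hinj : Function.Injective (algebraMap (MvPolynomial (Fin 2) ℂ) Coeff) :=
    IsFractionRing.injective _ _
  have hq : qq ≠ 0 := (map_ne_zero_iff _ hinj).2 (MvPolynomial.X_ne_zero 0)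
  have hs : ss ≠ 0 := (map_ne_zero_iff _ hinj).2 (MvPolynomial.X_ne_zero 1)
  refine ⟨hq, hs, fun a b h => ?_⟩
  -- The equation is cleared of negative powers and evaluated at `(2, 1)` and `(1, 2)`.
  have h1 : qq ^ a.toNat * ss ^ b.toNat = qq ^ (-a).toNat * ss ^ (-b).toNat := by
    rw [← Int.toNat_sub_toNat_neg a, ← Int.toNat_sub_toNat_neg b, zpow_sub₀ hq, zpow_sub₀ hs,
      div_mul_div_comm, div_eq_one_iff_eq (mul_ne_zero (zpow_ne_zero _ hq) (zpow_ne_zero _ hs))] at h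
    simpa only [zpow_natCast] using h
  simp only [qq, ss, ← map_pow, ← map_mul] at h1
  have h2 := hinj h1
  have key : ∀ {k j : ℕ}, (2 : ℂ) ^ k = 2 ^ j → k = j := fun h =>
    Nat.pow_right_injective le_rfl (by exact_mod_cast h)
  have e1 := congrArg (MvPolynomial.eval ![(2 : ℂ), 1]) h2
  have e2 := congrArg (MvPolynomial.eval ![(1 : ℂ), 2]) h2
  simp at e1 e2
  have := key e1
  have := key e2
  omega

/-- At `s = 0` only the permutations of length zero contribute. -/
theorem sum_pow_ell_ne_zero {n : ℕ} {F : Finset (Equiv.Perm (Fin (n + 1)))} (hF : 1 ∈ F) :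
    ∑ τ ∈ F, ss ^ ell τ ≠ 0 := by
  have hinj : Function.Injective (algebraMap (MvPolynomial (Fin 2) ℂ) Coeff) :=
    IsFractionRing.injective _ _
  simp only [ss, ← map_pow, ← map_sum]
  rw [map_ne_zero_iff _ hinj]
  intro h
  have h1 := congrArg (MvPolynomial.eval (0 : Fin 2 → ℂ)) h
  simp only [map_sum, map_pow, MvPolynomial.eval_X, Pi.zero_apply, map_zero, zero_pow_eq,
    Finset.sum_boole, Nat.cast_eq_zero, Finset.card_eq_zero] at h1
  exact Finset.notMem_empty _ (h1 ▸ Finset.mem_filter.2 ⟨hF, ell_one⟩)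

end RationalFunctions

end VVMac

theorem mainTheorem7 (n : ℕ) (μ : YoungDiagram) (hμ : μ.card = n + 1) :
    (∀ T : VVMac.Filling μ, VVMac.ColumnStrict T →
      ∃ root sink : VVMac.Vertex n μ,
        (∀ x : VVMac.Vertex n μ, VVMac.IsRoot T x ↔ x = root) ∧
        (∀ x : VVMac.Vertex n μ, VVMac.IsSink T x ↔ x = sink) ∧
        VVMac.symMacdonald VVMac.qq VVMac.ss T root =
          (VVMac.symCoeff VVMac.qq VVMac.ss root sink / VVMac.poincare VVMac.ss n T) •
            VVMac.symmetrizer VVMac.ss (VVMac.macdonald VVMac.qq VVMac.ss root)) ∧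
    (∀ T : VVMac.Filling μ, VVMac.RowStrict T →
      ∃ root sink : VVMac.Vertex n μ,
        (∀ x : VVMac.Vertex n μ, VVMac.IsRoot T x ↔ x = root) ∧
        (∀ x : VVMac.Vertex n μ, VVMac.IsSink T x ↔ x = sink) ∧
        VVMac.antiMacdonald VVMac.qq VVMac.ss T root =
          ((-1) ^ VVMac.pathLength root sink * VVMac.antiCoeff VVMac.qq VVMac.ss root sink / VVMac.poincare VVMac.ss n (VVMac.conj T)) •
            VVMac.antisymmetrizer VVMac.ss (VVMac.macdonald VVMac.qq VVMac.ss root)) := by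
  have hcard : Fintype.card μ.cells = n + 1 := (Fintype.card_coe _).trans hμ
  constructor
  · intro T hT
    have S := hT.lineStrict
    obtain ⟨w, hw⟩ := VVMac.exists_strictMono_equiv S.sinkKey_injective hcard
    obtain ⟨ρ, hρ⟩ := VVMac.exists_isTop _ (S.monotone_cellBlock hw)
    obtain ⟨r, hr, hr'⟩ := S.exists_vertex hw hρ.1
    obtain ⟨k, hk, hk'⟩ := S.exists_vertex hw VVMac.inOrder_one
    have hφ := S.poincare_eq VVMac.ss hw (Equiv.refl _) (fun _ => rfl) (fun _ => rfl) fun _ => rfl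
    refine ⟨r, k, fun x => ?_, fun x => ?_, ?_⟩
    · rw [S.isRoot_iff hw hρ]
      exact ⟨fun h => VVMac.vertex_eq_of_label h.1 hr (h.2.trans hr'.symm), by
        rintro rfl; exact ⟨hr, hr'⟩⟩
    · rw [S.isSink_iff hw]
      exact ⟨fun h => VVMac.vertex_eq_of_label h.1 hk (h.2.trans hk'.symm), by
        rintro rfl; exact ⟨hk, hk'⟩⟩
    · refine S.symMacdonald_eq VVMac.isGeneric_qq_ss hw hr (hr' ▸ hρ) hk hk' ?_ hφ
      rw [hφ]
      exact VVMac.sum_pow_ell_ne_zero (by simp)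
  · intro T hT
    have S := hT.lineStrict
    obtain ⟨w, hw⟩ := VVMac.exists_strictMono_equiv S.sinkKey_injective hcard
    obtain ⟨ρ, hρ⟩ := VVMac.exists_isTop _ (S.monotone_cellBlock hw)
    obtain ⟨r, hr, hr'⟩ := S.exists_vertex hw hρ.1
    obtain ⟨k, hk, hk'⟩ := S.exists_vertex hw VVMac.inOrder_one
    have hφ := S.poincare_eq VVMac.ss hw (VVMac.transposeCells μ) (T' := VVMac.conj T)
      (fun _ => rfl) (fun _ => rfl) fun _ => rfl
    refine ⟨r, k, fun x => ?_, fun x => ?_, ?_⟩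
    · rw [S.isRoot_iff hw hρ]
      exact ⟨fun h => VVMac.vertex_eq_of_label h.1 hr (h.2.trans hr'.symm), by
        rintro rfl; exact ⟨hr, hr'⟩⟩
    · rw [S.isSink_iff hw]
      exact ⟨fun h => VVMac.vertex_eq_of_label h.1 hk (h.2.trans hk'.symm), by
        rintro rfl; exact ⟨hk, hk'⟩⟩
    · refine S.antiMacdonald_eq VVMac.isGeneric_qq_ss hw hr (hr' ▸ hρ) hk hk' ?_ hφ
      rw [hφ]
      exact VVMac.sum_pow_ell_ne_zero (by simp)
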